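/- **Proposition 2.2 (pr2).** Setting. Let $F$ be a closed surface (a compact smooth 2-manifold without boundary). A (smooth) immersion $F\to\mathbb R^3$ is *generic* if over every point of $\mathbb R^3$ there lie at most three sheets and their tangent planes are in general position (any two distinct, any three meeting, as linear planes, only in $0$). A *generic quadruple point* is a point through which exactly four sheets pass, with tangent planes in general position. Let $I_n$ be the set of immersions $F\to\mathbb R^3$ all of whose self intersections are as for generic immersions, except for precisely $n$ generic quadruple points; thus $I_0$ is the set of generic immersions. Put $I=\bigcup_{n\ge 0} I_n$. A regular homotopy is a smooth family $H_t:F\to\mathbb R^3$ ($0\le t\le 1$) of immersions. It is *generic* if $H_0,H_1\in I_0$, at each time at most one point of $\mathbb R^3$ is an unstable self intersection, and at such a point the family passes, with nonzero relative speed of the sheets, through one of the codimension one degeneracies: a nondegenerate (elliptic or hyperbolic) tangency of two sheets; a point where three pairwise transverse sheets have a common tangent line, the double line of two of them having a simple tangency with the third; a generic quadruple point. A *$q$-invariant* is a function $f:I_0\to\mathbb Z/2$ with $f(H_0)=f(H_1)$ for every generic regular homotopy $H_t$ without quadruple points. It is extended to $I$ as follows: for $i\in I_n$, $f(i)=\sum_{k=1}^{2^n}f(i_k)$,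 where $i_1,\dots,i_{2^n}\in I_0$ are the $2^n$ generic immersions obtained from $i$ by slightly pushing one sheet off each of the $n$ quadruple points, to either side (the sum does not depend on the choice of the sheets and of the small pushes). Statement. Let $B(r)\subseteq\mathbb R^3$ be the closed ball of radius $r$ about the origin. Let $D_1(1),\dots,D_4(1)\subseteq F$ be four disjoint discs, each smoothly parametrized by the closed unit disc; for $0\le r\le 1$ let $D_k(r)\subseteq D_k(1)$ be the concentric disc of radius $r$ and $D(r)=\bigcup_{k=1}^4D_k(r)$. Let $i\in I$, and assume that $i^{-1}(B(1))=D(1)$ and that, in the given parametrizations, $i$ maps each $D_k(1)$ linearly onto $L_k\cap B(1)$, where $L_1,\dots,L_4$ are planes through the origin in general position. Let $i':D(1)\to B(1)$ be a map of the same sort, i.e. it maps each $D_k(1)$ linearly onto $L'_k\cap B(1)$, where $L'_1,\dots,L'_4$ are planes through the origin in general position. Then there exists an immersion $j:F\to\mathbb R^3$ in $I$ such that 1. $j$ is regularly homotopic to $i$ via a regular homotopy that fixes $F-D(1)$; 2. $j^{-1}(B(\tfrac12))=D(\tfrac12)$; 3. $j|_{D(1/2)}=i'|_{D(1/2)}$;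 4. $f(j)=f(i)$ for every $q$-invariant $f$ (both sides being well defined). -/

import Mathlib

open Set Filter Topology
open scoped Manifold ContDiff

noncomputable section

namespace QInvariant

/-- The Euclidean plane, on which surfaces are modelled. -/
abbrev E2 : Type := EuclideanSpace ℝ (Fin 2)

/-- Euclidean 3-space. -/
abbrev E3 : Type := EuclideanSpace ℝ (Fin 3)

/-- A family of planes (2-dimensional linear subspaces) of 3-space is in general position if any
two of them are distinct, hence transverse, and any three of them meet only in the origin. -/
def PlanesInGeneralPosition {ι : Type*} (L : ι → Submodule ℝ E3) : Prop :=
  (∀ a b, a ≠ b → L a ≠ L b) ∧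
  (∀ a b c, a ≠ b → a ≠ c → b ≠ c → L a ⊓ L b ⊓ L c = ⊥)

section Surface

variable {F : Type*} [TopologicalSpace F] [ChartedSpace E2 F]

/-- A smooth immersion of the surface `F` into 3-space: a smooth map with injective
differential at every point. -/
def IsImmersion (i : F → E3) : Prop :=
  ContMDiff (𝓡 2) 𝓘(ℝ, E3) ∞ i ∧
    ∀ x, Function.Injective (mfderiv (𝓡 2) 𝓘(ℝ, E3) i x)

/-- The first derivative of `i` at `x`, in the preferred chart at `x`. -/
def chartDeriv (i : F → E3) (x : F) : E2 →L[ℝ] E3 :=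
  fderiv ℝ (i ∘ (extChartAt (𝓡 2) x).symm) (extChartAt (𝓡 2) x x)

/-- `chartDeriv` is the differential of `i`, as tangent spaces are identified with the model space
through the preferred chart. -/
theorem mfderiv_eq_chartDeriv {i : F → E3} (hi : IsImmersion i) (x : F) :
    mfderiv (𝓡 2) 𝓘(ℝ, E3) i x = chartDeriv i x := by
  have h := hi.1.mdifferentiable (by simp) x
  refine h.mfderiv.trans ?_
  simp [chartDeriv, writtenInExtChartAt]
  rfl

/-- The second derivative of `i` at `x`, in the preferred chart at `x`. -/
def chartDeriv₂ (i : F → E3) (x : F) : E2 →L[ℝ] E2 →L[ℝ] E3 :=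
  fderiv ℝ (fderiv ℝ (i ∘ (extChartAt (𝓡 2) x).symm)) (extChartAt (𝓡 2) x x)

/-- The tangent plane of the sheet of `i` through `x`: the image of the differential of `i`
at `x`. -/
def tangentPlane (i : F → E3) (x : F) : Submodule ℝ E3 :=
  LinearMap.range (chartDeriv i x).toLinearMap

/-- The sheets of `i` passing through `p` have tangent planes in general position. -/
def SheetsInGeneralPosition (i : F → E3) (p : E3) : Prop :=
  PlanesInGeneralPosition (fun x : i ⁻¹' {p} => tangentPlane i (x : F))

/-- The self intersection of `i` at `p` is stable: at most three sheets pass through `p`, and they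
are in general position (so `p` is not in the image, or it is an embedded point, a point of
transverse double intersection, or a transverse triple point). -/
def IsStableAt (i : F → E3) (p : E3) : Prop :=
  (i ⁻¹' {p}).encard ≤ 3 ∧ SheetsInGeneralPosition i p

/-- `p` is a generic quadruple point of `i`: exactly four sheets pass through `p`, and any three of
them intersect transversely. -/
def IsGenericQuadruplePoint (i : F → E3) (p : E3) : Prop :=
  (i ⁻¹' {p}).encard = 4 ∧ SheetsInGeneralPosition i p

/-- The set of generic quadruple points of `i`. -/
def quadruplePoints (i : F → E3) : Set E3 := {p | IsGenericQuadruplePoint i p}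

/-- `i` is a generic immersion: all its self intersections are stable. -/
def IsGenericImmersion (i : F → E3) : Prop :=
  IsImmersion i ∧ ∀ p, IsStableAt i p

/-- `i ∈ I_n`: the unstable self intersection of the immersion `i` consists of precisely `n`
generic quadruple points. -/
def MemI (n : ℕ) (i : F → E3) : Prop :=
  IsImmersion i ∧ (∀ p, IsStableAt i p ∨ IsGenericQuadruplePoint i p) ∧
    (quadruplePoints i).encard = n

variable (F) in
/-- The set `I_0` of all generic immersions of `F`. -/
abbrev GenericImm : Type _ := {i : F → E3 // IsGenericImmersion i}

/-! ### Regular homotopies -/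

/-- A regular homotopy `H t`, `0 ≤ t ≤ 1`: smooth in both variables, and an immersion at all
times. (Values of `H` at times outside `[0, 1]` play no role.) -/
def IsRegularHomotopy (H : ℝ → F → E3) : Prop :=
  ContMDiffOn ((𝓘(ℝ, ℝ)).prod (𝓡 2)) 𝓘(ℝ, E3) ∞ (fun q : ℝ × F => H q.1 q.2)
      (Icc (0 : ℝ) 1 ×ˢ (univ : Set F)) ∧
    ∀ t ∈ Icc (0 : ℝ) 1, IsImmersion (H t)

/-- `μ` is a linear relation between conormals of the sheets of `i` at the points of `S`: each
`μ x` is orthogonal to the tangent plane of the sheet through `x`, and the sum vanishes. -/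
def IsConormalRelation (i : F → E3) (S : Finset F) (μ : F → E3) : Prop :=
  (∀ x ∈ S, ∀ a : E2, inner ℝ (μ x) (chartDeriv i x a) = 0) ∧ ∑ x ∈ S, μ x = 0

/-- At time `t` the regular homotopy `H` passes transversely through a codimension one unstable
self intersection located at `p`.

The sheets through `p` satisfy precisely one conormal relation `μ` up to scaling, in which every
sheet takes part, so that one of the following occurs: two tangent sheets; three sheets that are
pairwise transverse with a common tangent line; four sheets any three of which are transverse.
The two remaining conditions are: the sheets move through the degenerate position with nonzero
relative velocity; and the degeneracy is quadratically nondegenerate, i.e. the form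
`∑ ⟨μ x, second derivative of the sheet at x⟩` on the intersection of the tangent planes is
nondegenerate (as `μ x` is normal to the sheet, this form does not depend on the charts).
For two tangent sheets this says that they have nondegenerate (elliptic or hyperbolic) tangency,
for three sheets that the intersection line of any two has a simple tangency with the third, and
for four sheets it is void. -/
def IsCodimOneEvent (H : ℝ → F → E3) (t : ℝ) (p : E3) : Prop :=
  ∃ (S : Finset F) (μ : F → E3), (S : Set F) = H t ⁻¹' {p} ∧
    IsConormalRelation (H t) S μ ∧
    (∀ x ∈ S, μ x ≠ 0) ∧
    (∀ μ', IsConormalRelation (H t) S μ' → ∃ r : ℝ, ∀ x ∈ S, μ' x = r • μ x) ∧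
    (∑ x ∈ S, inner ℝ (μ x) (deriv (fun s => H s x) t) : ℝ) ≠ 0 ∧
    ∀ (a : F → E2) (w : E3), (∀ x ∈ S, chartDeriv (H t) x (a x) = w) →
      (∀ (b : F → E2) (w' : E3), (∀ x ∈ S, chartDeriv (H t) x (b x) = w') →
        (∑ x ∈ S, inner ℝ (μ x) (chartDeriv₂ (H t) x (a x) (b x)) : ℝ) = 0) →
      w = 0

/-- A generic regular homotopy between generic immersions: at each time there is at most one
unstable self intersection, and at it the homotopy passes transversely through one of the
codimension one degeneracies. (Such events are isolated, so only finitely many occur.) -/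
structure IsGenericRegularHomotopy (H : ℝ → F → E3) : Prop where
  regular : IsRegularHomotopy H
  start : IsGenericImmersion (H 0)
  finish : IsGenericImmersion (H 1)
  subsingleton : ∀ t ∈ Ioo (0 : ℝ) 1, {p | ¬ IsStableAt (H t) p}.Subsingleton
  event : ∀ t ∈ Ioo (0 : ℝ) 1, ∀ p, ¬ IsStableAt (H t) p → IsCodimOneEvent H t p

/-- The regular homotopy `H` has no quadruple points: at no time do four sheets meet. -/
def NoQuadruplePoints (H : ℝ → F → E3) : Prop :=
  ∀ t ∈ Icc (0 : ℝ) 1, ∀ p, (H t ⁻¹' {p}).encard < 4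

/-! ### q-invariants and their extension -/

/-- A `ℤ/2`-valued function on the generic immersions is a q-invariant if it takes equal values at
the two ends of any generic regular homotopy with no quadruple points. -/
def IsQInvariant (f : GenericImm F → ZMod 2) : Prop :=
  ∀ (H : ℝ → F → E3) (hH : IsGenericRegularHomotopy H), NoQuadruplePoints H →
    f ⟨H 0, hH.start⟩ = f ⟨H 1, hH.finish⟩

/-- Data for pushing sheets off the quadruple points of `i`: `x` selects one sheet at each of the
quadruple points, and `V k` is a smooth vector field along `i` that is transverse to the sheet
selected at the `k`-th quadruple point, and that leaves all the other sheets at quadruple points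
in place. -/
structure IsPushSystem {n : ℕ} (i : F → E3) (x : Fin n → F) (V : Fin n → F → E3) : Prop where
  bijOn : BijOn (fun k => i (x k)) univ (quadruplePoints i)
  smooth : ∀ k, ContMDiff (𝓡 2) 𝓘(ℝ, E3) ∞ (V k)
  transverse : ∀ k, V k (x k) ∉ tangentPlane i (x k)
  local_support : ∀ k y, i y ∈ quadruplePoints i → y ≠ x k → ∀ᶠ z in 𝓝 y, V k z = 0

/-- The deformation of `i` by a push of size `ε`, to the side `s k` at the `k`-th quadruple
point. -/
def pushed {n : ℕ} (i : F → E3) (V : Fin n → F → E3) (ε : ℝ) (s : Fin n → ℤˣ) : F → E3 :=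
  fun y => i y + ε • ∑ k, (((s k : ℤˣ) : ℤ) : ℝ) • V k y

/-- The extension of `f` to `I = ⋃ I_n` is defined at `i`, with `f(i) = v`: `i ∈ I_n` for some `n`,
and `v` is the sum of the values of `f` at the `2 ^ n` generic immersions obtained by slightly
pushing a sheet off each of the quadruple points, to either side; these are indeed generic, and
the sum is `v`, for every choice of the push (of which there is at least one) and all small
sizes. -/
def HasValue (f : GenericImm F → ZMod 2) (i : F → E3) (v : ZMod 2) : Prop :=
  ∃ n : ℕ, MemI n i ∧
    (∃ (x : Fin n → F) (V : Fin n → F → E3), IsPushSystem i x V) ∧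
    ∀ (x : Fin n → F) (V : Fin n → F → E3), IsPushSystem i x V →
      ∀ᶠ ε : ℝ in 𝓝[>] 0, ∃ h : ∀ s : Fin n → ℤˣ, IsGenericImmersion (pushed i V ε s),
        ∑ s, f ⟨pushed i V ε s, h s⟩ = v

/-- The value of the extension is unique. -/
theorem HasValue.unique {f : GenericImm F → ZMod 2} {i : F → E3} {v w : ZMod 2}
    (hv : HasValue f i v) (hw : HasValue f i w) : v = w := by
  obtain ⟨n, hn, ⟨x, V, hV⟩, h⟩ := hv
  obtain ⟨m, hm, -, h'⟩ := hw
  obtain rfl : n = m := by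
    have := hn.2.2.symm.trans hm.2.2
    exact_mod_cast this
  obtain ⟨ε, ⟨h₁, e₁⟩, ⟨h₂, e₂⟩⟩ := ((h x V hV).and (h' x V hV)).exists
  exact e₁.symm.trans e₂

/-! ### Linear discs -/

/-- The linear maps `A k` map the unit disc onto the unit discs about the origin of four planes in
general position. -/
def AreLinearDiscs (A : Fin 4 → E2 →ₗ[ℝ] E3) : Prop :=
  ∃ L : Fin 4 → Submodule ℝ E3, (∀ k, Module.finrank ℝ (L k) = 2) ∧
    PlanesInGeneralPosition L ∧
    ∀ k, A k '' Metric.closedBall 0 1 = (L k : Set E3) ∩ Metric.closedBall 0 1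

/-- The union `D(r)` of the four concentric discs of radius `r`, where `c k` is the parametrization
of the `k`-th disc by the unit disc. -/
def discs (c : Fin 4 → E2 → F) (r : ℝ) : Set F :=
  ⋃ k, c k '' Metric.closedBall 0 r

end Surface

end QInvariant

end

/-! The discs are moved one at a time, while the other three stay flat. A disc is moved by a
`Twist`, which rotates each sphere about the origin by an angle depending on its radius and on time:
zero outside a small ball, and at the final time equal to the full angle near the origin. Twists
preserve norms, so nothing changes over the outside of the ball, and preimages of concentric balls
are preserved.

During a twist the four planes may leave general position, so the immersion itself need not stay in
`I`. The value of a q-invariant is, however, a sum over immersions in which one sheet has been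
pushed off each quadruple point, and at the origin this sheet can be the moving one. Such a pushed
immersion can be twisted without quadruple points: the three fixed planes meet only at the origin,
and the pushed disc misses the origin at all times (`IsTwistFrame.exists_sheetFunction_ne_zero`).
This homotopy is generic for the following reasons. The moving disc stays transverse to each fixed
plane as long as its rotating normal is never parallel to the normal of that plane. The only
remaining degeneracy is a tangency of the disc with the line in which two fixed planes meet. Along
such a line, spanned by a unit vector `e` and with coordinate `z`, the disc is given near the origin
by `z * h - ε = 0`, where `h` is the height of the rotating normal over `e`. If `h` has only simple
zeros, then for small `ε ≠ 0` the tangencies are nondegenerate, are crossed with nonzero speed, and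
occur at most once at a time (`eventually_isLineTangency_nondegenerate`,
`eventually_isLineTangency_unique`, `eventually_isLineTangency_disjoint`). At the final time pushing
commutes with twisting (`pushed_twistOn`), so the sums for the original and for the twisted
immersion agree term by term (`exists_hasValue_twistOn`).

The extension of a q-invariant has to be shown to be well defined (`IsQInvariant.exists_hasValue`).
The four sheets at a quadruple point satisfy a conormal relation, and the sign of its pairing with a
push tells the two sides apart. Pushes to the same sides are joined by a segment of generic
immersions, by a first order estimate together with compactness
(`eventually_isGenericImmersion_perturb`).

Two kinds of twist are needed: turning a normal along a great circle that avoids the other normals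
(`reachable_of_arc`), and spinning a disc in its own plane (`reachable_of_spin`). If a disc arrives
in the right plane with the wrong orientation, half a turn more along the same great circle corrects
this. A detour through a generic normal makes every admissible move of a single disc possible
(`reachable_update`). Passing through four generic positions keeps all intermediate configurations
in general position (`reachable_of_inGeneralPosition`). -/

noncomputable section

namespace QInvariant

set_option linter.unusedSectionVars false

/-! ### Derivatives of maps of the surface in a fixed chart. -/

section
variable {F : Type*} [TopologicalSpace F] [ChartedSpace E2 F]
variable {G : Type*} [NormedAddCommGroup G] [NormedSpace ℝ G]

/-- The representation of a map on the surface in the preferred chart at `x₀`. -/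
def chartRep (h : F → G) (x₀ : F) : E2 → G := h ∘ (extChartAt (𝓡 2) x₀).symm

/-- The derivative at the point `x`, in the preferred chart at `x₀`. -/
def chartDerivAt (h : F → G) (x₀ x : F) : E2 →L[ℝ] G :=
  fderiv ℝ (chartRep h x₀) (extChartAt (𝓡 2) x₀ x)

theorem chartDerivAt_self (h : F → E3) (x : F) : chartDerivAt h x x = chartDeriv h x := rfl

section Smooth
variable [IsManifold (𝓡 2) ∞ F]

theorem contDiffAt_chartRep {h : F → G} {x₀ x : F} (hx : x ∈ (chartAt E2 x₀).source)
    (hh : ContMDiffAt (𝓡 2) 𝓘(ℝ, G) ∞ h x) :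
    ContDiffAt ℝ ∞ (chartRep h x₀) (extChartAt (𝓡 2) x₀ x) := by
  have hx' : x ∈ (extChartAt (𝓡 2) x₀).source := by rwa [extChartAt_source]
  have ht : extChartAt (𝓡 2) x₀ x ∈ (extChartAt (𝓡 2) x₀).target :=
    (extChartAt (𝓡 2) x₀).map_source hx'
  have h1 : ContMDiffAt 𝓘(ℝ, E2) (𝓡 2) ∞ (extChartAt (𝓡 2) x₀).symm (extChartAt (𝓡 2) x₀ x) :=
    (contMDiffOn_extChartAt_symm x₀).contMDiffAt
      ((isOpen_extChartAt_target x₀).mem_nhds ht)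
  have h2 : ContMDiffAt 𝓘(ℝ, E2) 𝓘(ℝ, G) ∞ (h ∘ (extChartAt (𝓡 2) x₀).symm)
      (extChartAt (𝓡 2) x₀ x) := by
    apply ContMDiffAt.comp _ _ h1
    rwa [(extChartAt (𝓡 2) x₀).left_inv hx']
  exact h2.contDiffAt

theorem chartRep_eventuallyEq {h : F → G} {κ : F → E2} {g : E2 → G} {x₀ x : F}
    (hx : x ∈ (chartAt E2 x₀).source)
    (he : h =ᶠ[𝓝 x] g ∘ κ) :
    chartRep h x₀ =ᶠ[𝓝 (extChartAt (𝓡 2) x₀ x)] g ∘ chartRep κ x₀ := by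
  have hx' : x ∈ (extChartAt (𝓡 2) x₀).source := by rwa [extChartAt_source]
  have hc : Tendsto (extChartAt (𝓡 2) x₀).symm (𝓝 (extChartAt (𝓡 2) x₀ x)) (𝓝 x) := by
    have := continuousAt_extChartAt_symm' (I := 𝓡 2) hx'
    unfold ContinuousAt at this
    rwa [(extChartAt (𝓡 2) x₀).left_inv hx'] at this
  exact hc.eventually he

theorem chartDerivAt_comp {h : F → G} {κ : F → E2} {g : E2 → G} {x₀ x : F}
    (hx : x ∈ (chartAt E2 x₀).source)
    (hκ : ContMDiffAt (𝓡 2) 𝓘(ℝ, E2) ∞ κ x) (hg : DifferentiableAt ℝ g (κ x))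
    (he : h =ᶠ[𝓝 x] g ∘ κ) :
    chartDerivAt h x₀ x = (fderiv ℝ g (κ x)).comp (chartDerivAt κ x₀ x) := by
  have hx' : x ∈ (extChartAt (𝓡 2) x₀).source := by rwa [extChartAt_source]
  have hk : chartRep κ x₀ (extChartAt (𝓡 2) x₀ x) = κ x := by
    simp only [chartRep, Function.comp, (extChartAt (𝓡 2) x₀).left_inv hx']
  unfold chartDerivAt
  rw [(chartRep_eventuallyEq hx he).fderiv_eq, fderiv_comp, hk]
  · rwa [hk]
  · exact (contDiffAt_chartRep hx hκ).differentiableAt (by simp)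

theorem continuousAt_chartDerivAt {h : F → G} {x₀ x : F} (hx : x ∈ (chartAt E2 x₀).source)
    (hh : ContMDiffAt (𝓡 2) 𝓘(ℝ, G) ∞ h x) :
    ContinuousAt (chartDerivAt h x₀) x := by
  have hx' : x ∈ (extChartAt (𝓡 2) x₀).source := by rwa [extChartAt_source]
  have h1 : ContinuousAt (fderiv ℝ (chartRep h x₀)) (extChartAt (𝓡 2) x₀ x) :=
    ((contDiffAt_chartRep hx hh).fderiv_right (m := 0) (by norm_num)).continuousAt
  exact ContinuousAt.comp h1 (continuousAt_extChartAt' hx')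

theorem chartDerivAt_extChartAt_bijective {x₀ x : F} (hx : x ∈ (chartAt E2 x₀).source) :
    Function.Bijective (chartDerivAt (extChartAt (𝓡 2) x₀ : F → E2) x x) := by
  have hx' : x ∈ (extChartAt (𝓡 2) x₀).source := by rwa [extChartAt_source]
  have : IsManifold (𝓡 2) 1 F := IsManifold.of_le (n := ∞) (by norm_num)
  have h := isInvertible_mfderiv_extChartAt (I := 𝓡 2) hx'
  have hd : MDifferentiableAt (𝓡 2) 𝓘(ℝ, E2) (extChartAt (𝓡 2) x₀) x :=
    mdifferentiableAt_extChartAt hx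
  have := hd.mfderiv
  have h3 : chartDerivAt (extChartAt (𝓡 2) x₀ : F → E2) x x =
      mfderiv (𝓡 2) 𝓘(ℝ, E2) (extChartAt (𝓡 2) x₀) x := by
    rw [this]
    simp [chartDerivAt, chartRep, writtenInExtChartAt]
    rfl
  rw [h3]
  obtain ⟨M, hM⟩ := h
  rw [← hM]
  exact M.bijective

theorem chartDeriv_eq_chartDerivAt_comp {h : F → E3} {x₀ x : F}
    (hx : x ∈ (chartAt E2 x₀).source) (hh : ContMDiffAt (𝓡 2) 𝓘(ℝ, E3) ∞ h x) :
    chartDeriv h x =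
      (chartDerivAt h x₀ x).comp (chartDerivAt (extChartAt (𝓡 2) x₀ : F → E2) x x) := by
  have hx' : x ∈ (extChartAt (𝓡 2) x₀).source := by rwa [extChartAt_source]
  have := chartDerivAt_comp (h := h) (κ := extChartAt (𝓡 2) x₀) (g := chartRep h x₀) (x₀ := x)
    (x := x) (mem_chart_source E2 x) (contMDiffAt_extChartAt' hx)
    ((contDiffAt_chartRep hx hh).differentiableAt (by simp)) (by
      filter_upwards [(chartAt E2 x₀).open_source.mem_nhds hx] with z hz
      simp only [chartRep, Function.comp]
      rw [(extChartAt (𝓡 2) x₀).left_inv (by rwa [extChartAt_source])])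
  exact this

/-- The preferred chart may jump from point to point, so `chartDeriv` need not be continuous in the
point. The derivative in a fixed chart is, and the coordinate change is invertible, hence harmless
for ranges. -/
theorem tangentPlane_eq_range {h : F → E3} {x₀ x : F}
    (hx : x ∈ (chartAt E2 x₀).source) (hh : ContMDiffAt (𝓡 2) 𝓘(ℝ, E3) ∞ h x) :
    tangentPlane h x = LinearMap.range (chartDerivAt h x₀ x).toLinearMap := by
  have hb := chartDerivAt_extChartAt_bijective hx
  ext v
  simp only [tangentPlane, chartDeriv_eq_chartDerivAt_comp hx hh]
  constructor
  · rintro ⟨a, rfl⟩; exact ⟨_, rfl⟩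
  · rintro ⟨a, rfl⟩
    obtain ⟨b, rfl⟩ := hb.2 a
    exact ⟨b, rfl⟩

theorem chartDeriv_injective_iff {h : F → E3} {x₀ x : F}
    (hx : x ∈ (chartAt E2 x₀).source) (hh : ContMDiffAt (𝓡 2) 𝓘(ℝ, E3) ∞ h x) :
    Function.Injective (chartDeriv h x) ↔ Function.Injective (chartDerivAt h x₀ x) := by
  have hb := chartDerivAt_extChartAt_bijective hx
  rw [chartDeriv_eq_chartDerivAt_comp hx hh, ContinuousLinearMap.coe_comp]
  exact Function.Injective.of_comp_iff' _ hb

end Smooth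

theorem isImmersion_iff {h : F → E3} :
    IsImmersion h ↔ ContMDiff (𝓡 2) 𝓘(ℝ, E3) ∞ h ∧ ∀ x, Function.Injective (chartDeriv h x) := by
  have key : ContMDiff (𝓡 2) 𝓘(ℝ, E3) ∞ h → ∀ x,
      mfderiv (𝓡 2) 𝓘(ℝ, E3) h x = chartDeriv h x := by
    intro hs x
    refine ((hs.mdifferentiable (by simp)) x).mfderiv.trans ?_
    simp [chartDeriv, writtenInExtChartAt]
    rfl
  constructor
  · rintro ⟨h1, h2⟩
    exact ⟨h1, fun x => by rw [← key h1 x]; exact h2 x⟩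
  · rintro ⟨h1, h2⟩
    exact ⟨h1, fun x => by rw [key h1 x]; exact h2 x⟩

theorem sheetsInGeneralPosition_iff {h : F → E3} {p : E3} :
    SheetsInGeneralPosition h p ↔
      (∀ x y, h x = p → h y = p → x ≠ y → tangentPlane h x ≠ tangentPlane h y) ∧
      (∀ x y z, h x = p → h y = p → h z = p → x ≠ y → x ≠ z → y ≠ z →
        tangentPlane h x ⊓ tangentPlane h y ⊓ tangentPlane h z = ⊥) := by
  simp only [SheetsInGeneralPosition, PlanesInGeneralPosition, Subtype.forall, mem_preimage,
    mem_singleton_iff, ne_eq, Subtype.mk.injEq]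
  constructor
  · rintro ⟨h1, h2⟩
    exact ⟨fun x y hx hy hxy => h1 x hx y hy hxy,
      fun x y z hx hy hz hxy hxz hyz => h2 x hx y hy z hz hxy hxz hyz⟩
  · rintro ⟨h1, h2⟩
    exact ⟨fun x hx y hy hxy => h1 x y hx hy hxy,
      fun x hx y hy z hz hxy hxz hyz => h2 x y z hx hy hz hxy hxz hyz⟩

theorem finrank_tangentPlane {h : F → E3} {x : F} (hi : Function.Injective (chartDeriv h x)) :
    Module.finrank ℝ (tangentPlane h x) = 2 := by
  unfold tangentPlane
  rw [LinearMap.finrank_range_of_inj hi]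
  simp

theorem chartDeriv_congr {h h' : F → E3} {x : F} (he : h =ᶠ[𝓝 x] h') :
    chartDeriv h x = chartDeriv h' x := by
  have hc : Tendsto (extChartAt (𝓡 2) x).symm (𝓝 (extChartAt (𝓡 2) x x)) (𝓝 x) := by
    have := continuousAt_extChartAt_symm (I := 𝓡 2) x
    unfold ContinuousAt at this
    rwa [extChartAt_to_inv] at this
  have h2 : h ∘ (extChartAt (𝓡 2) x).symm =ᶠ[𝓝 (extChartAt (𝓡 2) x x)]
      h' ∘ (extChartAt (𝓡 2) x).symm := hc.eventually he
  exact h2.fderiv_eq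

theorem tangentPlane_congr {h h' : F → E3} {x : F} (he : h =ᶠ[𝓝 x] h') :
    tangentPlane h x = tangentPlane h' x := by
  unfold tangentPlane
  rw [chartDeriv_congr he]

/-- General position at `p` depends only on the germs at the preimages of `p`. This settles the
points outside the ball, where a twist changes nothing. -/
theorem sheetsInGeneralPosition_congr {h h' : F → E3} {p : E3} (hp : h ⁻¹' {p} = h' ⁻¹' {p})
    (he : ∀ x, h x = p → h =ᶠ[𝓝 x] h') :
    SheetsInGeneralPosition h p ↔ SheetsInGeneralPosition h' p := by
  have hp' : ∀ x, h' x = p ↔ h x = p := fun x => by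
    have := Set.ext_iff.1 hp x
    simpa using this.symm
  rw [sheetsInGeneralPosition_iff, sheetsInGeneralPosition_iff]
  simp only [hp']
  have ht : ∀ x, h x = p → tangentPlane h x = tangentPlane h' x :=
    fun x hx => tangentPlane_congr (he x hx)
  constructor
  · rintro ⟨h1, h2⟩
    exact ⟨fun x y hx hy => by rw [← ht x hx, ← ht y hy]; exact h1 x y hx hy,
      fun x y z hx hy hz => by rw [← ht x hx, ← ht y hy, ← ht z hz]; exact h2 x y z hx hy hz⟩
  · rintro ⟨h1, h2⟩
    exact ⟨fun x y hx hy => by rw [ht x hx, ht y hy]; exact h1 x y hx hy,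
      fun x y z hx hy hz => by rw [ht x hx, ht y hy, ht z hz]; exact h2 x y z hx hy hz⟩

theorem isStableAt_congr {h h' : F → E3} {p : E3} (hp : h ⁻¹' {p} = h' ⁻¹' {p})
    (he : ∀ x, h x = p → h =ᶠ[𝓝 x] h') : IsStableAt h p ↔ IsStableAt h' p := by
  rw [IsStableAt, IsStableAt, sheetsInGeneralPosition_congr hp he, hp]

theorem isGenericQuadruplePoint_congr {h h' : F → E3} {p : E3} (hp : h ⁻¹' {p} = h' ⁻¹' {p})
    (he : ∀ x, h x = p → h =ᶠ[𝓝 x] h') :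
    IsGenericQuadruplePoint h p ↔ IsGenericQuadruplePoint h' p := by
  rw [IsGenericQuadruplePoint, IsGenericQuadruplePoint, sheetsInGeneralPosition_congr hp he, hp]

end

/-! ### Open conditions on planes and small perturbations of immersions. -/

section
-- Some `L a` lies outside the range of `M`, which means that `(t, b) ↦ t • L a - M b` is injective.
-- Injectivity is an open condition.
theorem eventually_range_ne {L M : E2 →L[ℝ] E3} (hL : Function.Injective L)
    (hM : Function.Injective M)
    (h : LinearMap.range L.toLinearMap ≠ LinearMap.range M.toLinearMap) :
    ∀ᶠ q : (E2 →L[ℝ] E3) × (E2 →L[ℝ] E3) in 𝓝 (L, M),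
      LinearMap.range q.1.toLinearMap ≠ LinearMap.range q.2.toLinearMap := by
  have hle : ¬ LinearMap.range L.toLinearMap ≤ LinearMap.range M.toLinearMap := by
    intro hle
    refine h (Submodule.eq_of_le_of_finrank_eq hle ?_)
    rw [LinearMap.finrank_range_of_inj hL, LinearMap.finrank_range_of_inj hM]
  obtain ⟨_, ⟨a, rfl⟩, ha⟩ := SetLike.not_le_iff_exists.1 hle
  let Ψ : (E2 →L[ℝ] E3) × (E2 →L[ℝ] E3) → (ℝ × E2 →L[ℝ] E3) := fun q =>
    ((ContinuousLinearMap.fst ℝ ℝ E2).smulRight (q.1 a)) -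
      q.2.comp (ContinuousLinearMap.snd ℝ ℝ E2)
  have hΨ : Continuous Ψ := by
    have h1 : Continuous fun q : (E2 →L[ℝ] E3) × (E2 →L[ℝ] E3) => q.1 a := by fun_prop
    have h2 : Continuous fun q : (E2 →L[ℝ] E3) × (E2 →L[ℝ] E3) =>
        (ContinuousLinearMap.fst ℝ ℝ E2).smulRight (q.1 a) :=
      ((ContinuousLinearMap.smulRightL ℝ (ℝ × E2) E3
        (ContinuousLinearMap.fst ℝ ℝ E2)).continuous.comp h1)
    fun_prop
  have hinj : Function.Injective (Ψ (L, M)) := by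
    rw [injective_iff_map_eq_zero]
    rintro ⟨t, b⟩ htb
    simp only [Ψ, sub_apply, ContinuousLinearMap.smulRight_apply,
      ContinuousLinearMap.coe_fst', ContinuousLinearMap.comp_apply,
      ContinuousLinearMap.coe_snd', sub_eq_zero] at htb
    have ht : t = 0 := by
      by_contra ht
      refine ha ⟨t⁻¹ • b, ?_⟩
      simp [← htb, smul_smul, ht]
    subst ht
    rw [zero_smul] at htb
    have : b = 0 := hM (by rw [← htb, map_zero])
    rw [this]; rfl
  have := hΨ.continuousAt.eventually (ContinuousLinearMap.isOpen_injective.mem_nhds hinj)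
  filter_upwards [this] with q hq heq
  have : q.1 a ∈ LinearMap.range q.2.toLinearMap := heq ▸ ⟨a, rfl⟩
  obtain ⟨b, hb⟩ := this
  have h0 : Ψ q (1, b) = Ψ q 0 := by
    simp only [map_zero]
    simp only [Ψ, sub_apply, ContinuousLinearMap.smulRight_apply,
      ContinuousLinearMap.coe_fst', ContinuousLinearMap.comp_apply,
      ContinuousLinearMap.coe_snd', sub_eq_zero, one_smul]
    exact hb.symm
  simpa using congrArg Prod.fst (hq h0)

/-- Trivial intersection means that `(a, b, c) ↦ (L a - M b, L a - N c)` is injective, which is an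
open condition. -/
theorem eventually_range_inf_eq_bot {L M N : E2 →L[ℝ] E3} (hL : Function.Injective L)
    (hM : Function.Injective M) (hN : Function.Injective N)
    (h : LinearMap.range L.toLinearMap ⊓ LinearMap.range M.toLinearMap ⊓
      LinearMap.range N.toLinearMap = ⊥) :
    ∀ᶠ q : (E2 →L[ℝ] E3) × (E2 →L[ℝ] E3) × (E2 →L[ℝ] E3) in 𝓝 (L, M, N),
      LinearMap.range q.1.toLinearMap ⊓ LinearMap.range q.2.1.toLinearMap ⊓
        LinearMap.range q.2.2.toLinearMap = ⊥ := by
  let Ψ : (E2 →L[ℝ] E3) × (E2 →L[ℝ] E3) × (E2 →L[ℝ] E3) → (E2 × E2 × E2 →L[ℝ] E3 × E3) :=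
    fun q =>
      (q.1.comp (.fst ℝ E2 (E2 × E2)) -
        q.2.1.comp ((ContinuousLinearMap.fst ℝ E2 E2).comp (.snd ℝ E2 (E2 × E2)))).prod
      (q.1.comp (.fst ℝ E2 (E2 × E2)) -
        q.2.2.comp ((ContinuousLinearMap.snd ℝ E2 E2).comp (.snd ℝ E2 (E2 × E2))))
  have hΨ : Continuous Ψ := by
    have h1 : Continuous fun q : (E2 →L[ℝ] E3) × (E2 →L[ℝ] E3) × (E2 →L[ℝ] E3) =>
      (q.1.comp (.fst ℝ E2 (E2 × E2)) -
        q.2.1.comp ((ContinuousLinearMap.fst ℝ E2 E2).comp (.snd ℝ E2 (E2 × E2)))) := by fun_prop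
    have h2 : Continuous fun q : (E2 →L[ℝ] E3) × (E2 →L[ℝ] E3) × (E2 →L[ℝ] E3) =>
      (q.1.comp (.fst ℝ E2 (E2 × E2)) -
        q.2.2.comp ((ContinuousLinearMap.snd ℝ E2 E2).comp (.snd ℝ E2 (E2 × E2)))) := by fun_prop
    exact (ContinuousLinearMap.prodₗᵢ (𝕜 := ℝ) ℝ).continuous.comp (h1.prodMk h2)
  have hinj : Function.Injective (Ψ (L, M, N)) := by
    rw [injective_iff_map_eq_zero]
    rintro ⟨a, b, c⟩ habc
    simp only [Ψ, ContinuousLinearMap.prod_apply, Prod.mk_eq_zero, sub_apply,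
      ContinuousLinearMap.comp_apply, ContinuousLinearMap.coe_fst', ContinuousLinearMap.coe_snd',
      sub_eq_zero] at habc
    have h0 : L a ∈ LinearMap.range L.toLinearMap ⊓ LinearMap.range M.toLinearMap ⊓
        LinearMap.range N.toLinearMap :=
      ⟨⟨⟨a, rfl⟩, ⟨b, habc.1.symm⟩⟩, ⟨c, habc.2.symm⟩⟩
    rw [h, Submodule.mem_bot] at h0
    have ha : a = 0 := hL (by rw [h0, map_zero])
    have hb : b = 0 := hM (by rw [← habc.1, h0, map_zero])
    have hc : c = 0 := hN (by rw [← habc.2, h0, map_zero])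
    rw [ha, hb, hc]; rfl
  have := hΨ.continuousAt.eventually (ContinuousLinearMap.isOpen_injective.mem_nhds hinj)
  filter_upwards [this] with q hq
  rw [Submodule.eq_bot_iff]
  rintro _ ⟨⟨⟨a, rfl⟩, ⟨b, hb⟩⟩, ⟨c, hc⟩⟩
  have h0 : Ψ q (a, b, c) = Ψ q 0 := by
    rw [map_zero]
    simp only [Ψ, ContinuousLinearMap.prod_apply, Prod.mk_eq_zero, sub_apply,
      ContinuousLinearMap.comp_apply, ContinuousLinearMap.coe_fst', ContinuousLinearMap.coe_snd',
      sub_eq_zero]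
    exact ⟨hb.symm, hc.symm⟩
  have ha : a = 0 := congrArg Prod.fst (hq h0)
  rw [ha]
  exact map_zero _

variable {F : Type*} [TopologicalSpace F] [ChartedSpace E2 F]

/-- A two-parameter perturbation of a map `i` of the surface, in the directions of the vector
fields `V₀` and `V₁`. -/
def perturb (i V₀ V₁ : F → E3) (q : ℝ × ℝ) : F → E3 := fun x => i x + q.1 • V₀ x + q.2 • V₁ x

section
variable [IsManifold (𝓡 2) ∞ F] {i V₀ V₁ : F → E3}
  (hi : ContMDiff (𝓡 2) 𝓘(ℝ, E3) ∞ i) (h₀ : ContMDiff (𝓡 2) 𝓘(ℝ, E3) ∞ V₀)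
  (h₁ : ContMDiff (𝓡 2) 𝓘(ℝ, E3) ∞ V₁)
include hi h₀ h₁

theorem contMDiff_perturb (q : ℝ × ℝ) : ContMDiff (𝓡 2) 𝓘(ℝ, E3) ∞ (perturb i V₀ V₁ q) := by
  have k₀ : ContMDiff (𝓡 2) 𝓘(ℝ, E3) ∞ (fun x => q.1 • V₀ x) := by
    have hc : ContMDiff (𝓡 2) 𝓘(ℝ, ℝ) ∞ (fun _ : F => q.1) := contMDiff_const
    exact hc.smul h₀
  have k₁ : ContMDiff (𝓡 2) 𝓘(ℝ, E3) ∞ (fun x => q.2 • V₁ x) := by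
    have hc : ContMDiff (𝓡 2) 𝓘(ℝ, ℝ) ∞ (fun _ : F => q.2) := contMDiff_const
    exact hc.smul h₁
  have k : ContMDiff (𝓡 2) 𝓘(ℝ, E3) ∞ (fun x => i x + q.1 • V₀ x) := hi.add k₀
  exact k.add k₁

theorem continuous_perturb : Continuous fun z : (ℝ × ℝ) × F => perturb i V₀ V₁ z.1 z.2 := by
  have := hi.continuous
  have := h₀.continuous
  have := h₁.continuous
  unfold perturb
  fun_prop

theorem chartDerivAt_perturb (q : ℝ × ℝ) {x₀ x : F} (hx : x ∈ (chartAt E2 x₀).source) :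
    chartDerivAt (perturb i V₀ V₁ q) x₀ x =
      chartDerivAt i x₀ x + q.1 • chartDerivAt V₀ x₀ x + q.2 • chartDerivAt V₁ x₀ x := by
  have d := (contDiffAt_chartRep hx hi.contMDiffAt).differentiableAt (by simp)
  have d₀ := (contDiffAt_chartRep hx h₀.contMDiffAt).differentiableAt (by simp)
  have d₁ := (contDiffAt_chartRep hx h₁.contMDiffAt).differentiableAt (by simp)
  have : chartRep (perturb i V₀ V₁ q) x₀ =
    chartRep i x₀ + q.1 • chartRep V₀ x₀ + q.2 • chartRep V₁ x₀ := rfl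
  unfold chartDerivAt
  rw [this]
  rw [fderiv_add (d.add (d₀.const_smul _)) (d₁.const_smul _), fderiv_add d (d₀.const_smul _),
    fderiv_const_smul d₀, fderiv_const_smul d₁]

theorem tendsto_chartDerivAt_perturb (x₀ : F) :
    Tendsto (fun z : (ℝ × ℝ) × F => chartDerivAt (perturb i V₀ V₁ z.1) x₀ z.2) (𝓝 (0, x₀))
      (𝓝 (chartDeriv i x₀)) := by
  have hs : ∀ᶠ z : (ℝ × ℝ) × F in 𝓝 (0, x₀), z.2 ∈ (chartAt E2 x₀).source :=
    continuousAt_snd.eventually ((chartAt E2 x₀).open_source.mem_nhds (mem_chart_source E2 x₀))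
  have hs' : (fun z : (ℝ × ℝ) × F => chartDerivAt i x₀ z.2 + z.1.1 • chartDerivAt V₀ x₀ z.2 +
      z.1.2 • chartDerivAt V₁ x₀ z.2) =ᶠ[𝓝 (0, x₀)]
      fun z : (ℝ × ℝ) × F => chartDerivAt (perturb i V₀ V₁ z.1) x₀ z.2 := by
    filter_upwards [hs] with z hz
    rw [chartDerivAt_perturb hi h₀ h₁ _ hz]
  refine Tendsto.congr' hs' ?_
  have c := continuousAt_chartDerivAt (mem_chart_source E2 x₀) hi.contMDiffAt
  have c₀ := continuousAt_chartDerivAt (mem_chart_source E2 x₀) h₀.contMDiffAt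
  have c₁ := continuousAt_chartDerivAt (mem_chart_source E2 x₀) h₁.contMDiffAt
  have hsnd : ContinuousAt (fun z : (ℝ × ℝ) × F => z.2) (0, x₀) := continuousAt_snd
  have e : ContinuousAt (fun z : (ℝ × ℝ) × F => chartDerivAt i x₀ z.2 +
      z.1.1 • chartDerivAt V₀ x₀ z.2 + z.1.2 • chartDerivAt V₁ x₀ z.2) (0, x₀) := by
    refine ContinuousAt.add (ContinuousAt.add ?_ ?_) ?_
    · exact ContinuousAt.comp (f := fun z : (ℝ × ℝ) × F => z.2) c hsnd
    · have k : ContinuousAt (fun z : (ℝ × ℝ) × F => z.1.1) (0, x₀) := by fun_prop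
      have k' : ContinuousAt (fun z : (ℝ × ℝ) × F => chartDerivAt V₀ x₀ z.2) (0, x₀) :=
        ContinuousAt.comp (g := chartDerivAt V₀ x₀) (f := fun z : (ℝ × ℝ) × F => z.2)
          (x := ((0 : ℝ × ℝ), x₀)) c₀ hsnd
      exact k.smul k'
    · have k : ContinuousAt (fun z : (ℝ × ℝ) × F => z.1.2) (0, x₀) := by fun_prop
      have k' : ContinuousAt (fun z : (ℝ × ℝ) × F => chartDerivAt V₁ x₀ z.2) (0, x₀) :=
        ContinuousAt.comp (g := chartDerivAt V₁ x₀) (f := fun z : (ℝ × ℝ) × F => z.2)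
          (x := ((0 : ℝ × ℝ), x₀)) c₁ hsnd
      exact k.smul k'
  have := e.tendsto
  rw [← chartDerivAt_self]
  simpa using this

theorem eventually_tangentPlane_perturb (x₀ : F) : ∀ᶠ z : (ℝ × ℝ) × F in 𝓝 (0, x₀),
    tangentPlane (perturb i V₀ V₁ z.1) z.2 =
      LinearMap.range (chartDerivAt (perturb i V₀ V₁ z.1) x₀ z.2).toLinearMap := by
  have hs : ∀ᶠ z : (ℝ × ℝ) × F in 𝓝 (0, x₀), z.2 ∈ (chartAt E2 x₀).source :=
    continuousAt_snd.eventually ((chartAt E2 x₀).open_source.mem_nhds (mem_chart_source E2 x₀))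
  filter_upwards [hs] with z hz
  exact tangentPlane_eq_range hz (contMDiff_perturb hi h₀ h₁ _).contMDiffAt

theorem eventually_chartDeriv_perturb_injective {x₀ : F}
    (hx : Function.Injective (chartDeriv i x₀)) : ∀ᶠ z : (ℝ × ℝ) × F in 𝓝 (0, x₀),
      Function.Injective (chartDeriv (perturb i V₀ V₁ z.1) z.2) := by
  have hs : ∀ᶠ z : (ℝ × ℝ) × F in 𝓝 (0, x₀), z.2 ∈ (chartAt E2 x₀).source :=
    continuousAt_snd.eventually ((chartAt E2 x₀).open_source.mem_nhds (mem_chart_source E2 x₀))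
  filter_upwards [hs, (tendsto_chartDerivAt_perturb hi h₀ h₁ x₀).eventually
    (ContinuousLinearMap.isOpen_injective.mem_nhds hx)] with z hz hz'
  exact (chartDeriv_injective_iff hz (contMDiff_perturb hi h₀ h₁ _).contMDiffAt).2 hz'

/-- Small perturbations of an immersion are locally injective, uniformly. -/
theorem eventually_perturb_injective {x₀ : F} (hx : Function.Injective (chartDeriv i x₀)) :
    ∀ᶠ z : (ℝ × ℝ) × F × F in 𝓝 (0, x₀, x₀),
      perturb i V₀ V₁ z.1 z.2.1 = perturb i V₀ V₁ z.1 z.2.2 → z.2.1 = z.2.2 := by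
  obtain ⟨K, hK, hant⟩ := ((chartDeriv i x₀).toLinearMap.injective_iff_antilipschitz).1 hx
  set u₀ := extChartAt (𝓡 2) x₀ x₀ with hu₀
  have hd := contDiffAt_chartRep (mem_chart_source E2 x₀) hi.contMDiffAt
  have hd₀ := contDiffAt_chartRep (mem_chart_source E2 x₀) h₀.contMDiffAt
  have hd₁ := contDiffAt_chartRep (mem_chart_source E2 x₀) h₁.contMDiffAt
  have hst := (hd.hasStrictFDerivAt (by simp)).isLittleO
  obtain ⟨C₀, s₀, hs₀, hL₀⟩ := (hd₀.of_le (m := 1) (by norm_num)).exists_lipschitzOnWith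
  obtain ⟨C₁, s₁, hs₁, hL₁⟩ := (hd₁.of_le (m := 1) (by norm_num)).exists_lipschitzOnWith
  have hK' : (0 : ℝ) < K := hK
  -- The differential shrinks lengths at most by the factor `1 / K`. The linearization error and the
  -- perturbing fields may each use up a quarter of this, so distinct nearby points keep distinct
  -- images.
  have hst' := hst.def (c := 1 / (4 * K)) (by positivity)
  have hcx : Tendsto (fun z : (ℝ × ℝ) × F × F => extChartAt (𝓡 2) x₀ z.2.1) (𝓝 (0, x₀, x₀))
      (𝓝 u₀) := by
    have h1 : ContinuousAt (fun z : (ℝ × ℝ) × F × F => z.2.1) (0, x₀, x₀) := by fun_prop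
    exact ContinuousAt.comp (g := extChartAt (𝓡 2) x₀) (x := ((0 : ℝ × ℝ), x₀, x₀))
      (continuousAt_extChartAt x₀) h1
  have hcy : Tendsto (fun z : (ℝ × ℝ) × F × F => extChartAt (𝓡 2) x₀ z.2.2) (𝓝 (0, x₀, x₀))
      (𝓝 u₀) := by
    have h1 : ContinuousAt (fun z : (ℝ × ℝ) × F × F => z.2.2) (0, x₀, x₀) := by fun_prop
    exact ContinuousAt.comp (g := extChartAt (𝓡 2) x₀) (x := ((0 : ℝ × ℝ), x₀, x₀))
      (continuousAt_extChartAt x₀) h1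
  have e1 : ∀ᶠ z : (ℝ × ℝ) × F × F in 𝓝 (0, x₀, x₀), z.2.1 ∈ (extChartAt (𝓡 2) x₀).source :=
    (show ContinuousAt (fun z : (ℝ × ℝ) × F × F => z.2.1) (0, x₀, x₀) by fun_prop).eventually
      (extChartAt_source_mem_nhds x₀)
  have e2 : ∀ᶠ z : (ℝ × ℝ) × F × F in 𝓝 (0, x₀, x₀), z.2.2 ∈ (extChartAt (𝓡 2) x₀).source :=
    (show ContinuousAt (fun z : (ℝ × ℝ) × F × F => z.2.2) (0, x₀, x₀) by fun_prop).eventually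
      (extChartAt_source_mem_nhds x₀)
  have e3 := (hcx.prodMk_nhds hcy).eventually hst'
  have e4 := hcx.eventually hs₀
  have e5 := hcy.eventually hs₀
  have e6 := hcx.eventually hs₁
  have e7 := hcy.eventually hs₁
  have e8 : ∀ᶠ z : (ℝ × ℝ) × F × F in 𝓝 (0, x₀, x₀), |z.1.1| * C₀ + |z.1.2| * C₁ < 1 / (4 * K) := by
    have hc : ContinuousAt (fun z : (ℝ × ℝ) × F × F => |z.1.1| * (C₀ : ℝ) + |z.1.2| * C₁)
      (0, x₀, x₀) := by fun_prop
    refine hc.eventually (gt_mem_nhds ?_)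
    simpa using hK'
  filter_upwards [e1, e2, e3, e4, e5, e6, e7, e8] with z m1 m2 m3 m4 m5 m6 m7 m8 heq
  have r1 := (extChartAt (𝓡 2) x₀).left_inv m1
  have r2 := (extChartAt (𝓡 2) x₀).left_inv m2
  set u := extChartAt (𝓡 2) x₀ z.2.1
  set v := extChartAt (𝓡 2) x₀ z.2.2
  suffices huv : u = v by rw [← r1, ← r2, huv]
  have b0 := hL₀.dist_le_mul u m4 v m5
  have b1 := hL₁.dist_le_mul u m6 v m7
  have ba := hant.le_mul_dist u v
  simp only [dist_eq_norm] at b0 b1 ba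
  have heq' : chartRep i x₀ u - chartRep i x₀ v =
      - (z.1.1 • (chartRep V₀ x₀ u - chartRep V₀ x₀ v)) -
        z.1.2 • (chartRep V₁ x₀ u - chartRep V₁ x₀ v) := by
    simp only [chartRep, Function.comp, r1, r2]
    simp only [perturb] at heq
    have : i z.2.1 = i z.2.2 + z.1.1 • V₀ z.2.2 + z.1.2 • V₁ z.2.2 - z.1.1 • V₀ z.2.1
      - z.1.2 • V₁ z.2.1 := by rw [← heq]; abel
    rw [this]; module
  have n1 : ‖chartRep i x₀ u - chartRep i x₀ v‖ ≤ (|z.1.1| * C₀ + |z.1.2| * C₁) * ‖u - v‖ := by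
    rw [heq']
    calc _ ≤ ‖z.1.1 • (chartRep V₀ x₀ u - chartRep V₀ x₀ v)‖ +
          ‖z.1.2 • (chartRep V₁ x₀ u - chartRep V₁ x₀ v)‖ := by
          refine (norm_sub_le _ _).trans ?_
          rw [norm_neg]
      _ ≤ |z.1.1| * (C₀ * ‖u - v‖) + |z.1.2| * (C₁ * ‖u - v‖) := by
          rw [norm_smul, norm_smul, Real.norm_eq_abs, Real.norm_eq_abs]
          gcongr
      _ = _ := by ring
  have n2 : ‖(chartDeriv i x₀) (u - v)‖ ≤ 1 / (4 * K) * ‖u - v‖ +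
      (|z.1.1| * C₀ + |z.1.2| * C₁) * ‖u - v‖ := by
    have : (chartDeriv i x₀) (u - v) = (chartRep i x₀ u - chartRep i x₀ v) -
      (chartRep i x₀ u - chartRep i x₀ v - fderiv ℝ (chartRep i x₀) u₀ (u - v)) := by
      rw [sub_sub_cancel]; rfl
    rw [this]
    refine (norm_sub_le _ _).trans ?_
    have := m3
    linarith
  have n3 : ‖u - v‖ ≤ K * ‖(chartDeriv i x₀) (u - v)‖ := by
    rw [map_sub]
    exact ba
  by_contra huv
  have hpos : 0 < ‖u - v‖ := norm_pos_iff.2 (sub_ne_zero.2 huv)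
  have n4 : ‖(chartDeriv i x₀) (u - v)‖ ≤ (1 / (4 * K) + 1 / (4 * K)) * ‖u - v‖ := by
    refine n2.trans ?_
    rw [add_mul]
    have := mul_le_mul_of_nonneg_right m8.le hpos.le
    linarith
  have n5 : K * ‖(chartDeriv i x₀) (u - v)‖ ≤ 1 / 2 * ‖u - v‖ := by
    calc _ ≤ (K : ℝ) * ((1 / (4 * K) + 1 / (4 * K)) * ‖u - v‖) := by gcongr
      _ = _ := by field_simp; norm_num
  linarith

end

end

/-! ### Genericity of small pushes. -/

section
theorem eventually_ne_of_tendsto {α X : Type*} [TopologicalSpace X] [T2Space X] {l : Filter α}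
    {f g : α → X} {a b : X} (hf : Tendsto f l (𝓝 a)) (hg : Tendsto g l (𝓝 b)) (h : a ≠ b) :
    ∀ᶠ z in l, f z ≠ g z :=
  (hf.prodMk_nhds hg).eventually (isClosed_diagonal.isOpen_compl.mem_nhds (by simpa using h))

variable {F : Type*} [TopologicalSpace F] [ChartedSpace E2 F]
variable [IsManifold (𝓡 2) ∞ F] {i V₀ V₁ : F → E3}
  (hi : ContMDiff (𝓡 2) 𝓘(ℝ, E3) ∞ i) (h₀ : ContMDiff (𝓡 2) 𝓘(ℝ, E3) ∞ V₀)
  (h₁ : ContMDiff (𝓡 2) 𝓘(ℝ, E3) ∞ V₁)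
include hi h₀ h₁

/-- Suppose four perturbed sheets met near `p`. Pairing with the conormal relation cancels the
common point and all tangential terms, so the push, of size at least `c * (α + β)`, would have to
equal the linearization remainders. These are small compared with the displacements of the points,
which transversality bounds by a multiple of `α + β`. -/
theorem eventually_image_ne_of_quadruple {x : Fin 4 → F} {p : E3} (hxp : ∀ k, i (x k) = p)
    (hinj : ∀ k, Function.Injective (chartDeriv i (x k)))
    (hgp : tangentPlane i (x 0) ⊓ tangentPlane i (x 1) ⊓ tangentPlane i (x 2) = ⊥)
    {μ : Fin 4 → E3} (hμ : ∀ k a, inner ℝ (μ k) (chartDeriv i (x k) a) = 0)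
    (hμs : ∑ k, μ k = 0) (hV₀ : 0 < ∑ k, inner ℝ (μ k) (V₀ (x k)))
    (hV₁ : 0 < ∑ k, inner ℝ (μ k) (V₁ (x k))) :
    ∀ᶠ z : (ℝ × ℝ) × (Fin 4 → F) in 𝓝 (0, x), 0 ≤ z.1.1 → 0 ≤ z.1.2 → 0 < z.1.1 + z.1.2 →
      ¬ ∀ k, perturb i V₀ V₁ z.1 (z.2 k) = perturb i V₀ V₁ z.1 (z.2 0) := by
  -- The linearized sheets relative to the sheet of index `0`; transversality of three of the sheets
  -- makes `Λ` injective, so displacements are controlled by mismatches.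
  let Λ : (Fin 4 → E2) →ₗ[ℝ] (Fin 4 → E3) := LinearMap.pi fun k =>
    (chartDeriv i (x k)).toLinearMap.comp (LinearMap.proj k) -
      (chartDeriv i (x 0)).toLinearMap.comp (LinearMap.proj 0)
  have hΛ : ∀ δ k, Λ δ k = chartDeriv i (x k) (δ k) - chartDeriv i (x 0) (δ 0) := fun δ k => rfl
  have hΛinj : Function.Injective Λ := by
    rw [injective_iff_map_eq_zero]
    intro δ hδ
    have h : ∀ k, chartDeriv i (x k) (δ k) = chartDeriv i (x 0) (δ 0) := fun k => by
      rw [← sub_eq_zero, ← hΛ, hδ]; rfl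
    have hm : chartDeriv i (x 0) (δ 0) ∈
        tangentPlane i (x 0) ⊓ tangentPlane i (x 1) ⊓ tangentPlane i (x 2) :=
      ⟨⟨⟨_, rfl⟩, ⟨δ 1, h 1⟩⟩, ⟨δ 2, h 2⟩⟩
    rw [hgp, Submodule.mem_bot] at hm
    funext k
    exact hinj k (by rw [h k, hm, Pi.zero_apply, map_zero])
  obtain ⟨K, hK, hant⟩ := (Λ.injective_iff_antilipschitz).1 hΛinj
  replace hK : (0 : ℝ) < K := hK
  obtain ⟨c, hc, hcc⟩ : ∃ c, 0 < c ∧ c < min (∑ k, inner ℝ (μ k) (V₀ (x k)))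
    (∑ k, inner ℝ (μ k) (V₁ (x k))) := exists_between (lt_min hV₀ hV₁)
  rw [lt_min_iff] at hcc
  obtain ⟨m, hm⟩ : ∃ m, m = ∑ k, ‖μ k‖ := ⟨_, rfl⟩
  have hm0 : 0 ≤ m := hm ▸ Finset.sum_nonneg fun _ _ => norm_nonneg _
  obtain ⟨M, hM⟩ : ∃ M, M = ∑ k, (‖V₀ (x k)‖ + ‖V₁ (x k)‖) + 1 := ⟨_, rfl⟩
  have hMb : ∀ k, ‖V₀ (x k)‖ + ‖V₁ (x k)‖ < M := fun k => by
    have := Finset.single_le_sum (f := fun k => ‖V₀ (x k)‖ + ‖V₁ (x k)‖)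
      (fun _ _ => by positivity) (Finset.mem_univ k)
    linarith
  have hM0 : 0 < M := lt_of_le_of_lt (by positivity) (hMb 0)
  have hd1 : 0 < 1 / (4 * (K : ℝ)) := by positivity
  have hd2 : 0 < 4 * m * K * M + 1 := by positivity
  -- The first bound absorbs the remainders into the estimate of the displacement; the second makes
  -- their pairing with `μ` smaller than that of the push.
  obtain ⟨η, hη, hη1, hη2⟩ : ∃ η : ℝ, 0 < η ∧ 4 * K * η ≤ 1 ∧ 4 * m * K * M * η < c := by
    refine ⟨min (1 / (4 * K)) (c / (4 * m * K * M + 1)), lt_min hd1 (div_pos hc hd2), ?_, ?_⟩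
    · calc 4 * K * _ ≤ 4 * K * (1 / (4 * K) : ℝ) := by gcongr; exact min_le_left _ _
        _ = 1 := by field_simp
    · calc 4 * m * K * M * _ ≤ 4 * m * K * M * (c / (4 * m * K * M + 1)) := by
            gcongr; exact min_le_right _ _
        _ < c := by
            rw [mul_div_assoc', div_lt_iff₀ hd2]
            nlinarith [show 0 ≤ 4 * m * K * M by positivity]
  have hz : ∀ k, Tendsto (fun z : (ℝ × ℝ) × (Fin 4 → F) => z.2 k) (𝓝 (0, x)) (𝓝 (x k)) :=
    fun k => (show ContinuousAt (fun z : (ℝ × ℝ) × (Fin 4 → F) => z.2 k) (0, x) by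
      fun_prop).tendsto
  have e1 : ∀ᶠ z : (ℝ × ℝ) × (Fin 4 → F) in 𝓝 (0, x), ∀ k,
      ‖i (z.2 k) - p - chartDeriv i (x k) (extChartAt (𝓡 2) (x k) (z.2 k) -
        extChartAt (𝓡 2) (x k) (x k))‖ ≤
        η * ‖extChartAt (𝓡 2) (x k) (z.2 k) - extChartAt (𝓡 2) (x k) (x k)‖ := by
    rw [eventually_all]
    intro k
    have hd := ((contDiffAt_chartRep (mem_chart_source E2 (x k)) hi.contMDiffAt).differentiableAt
      (by simp)).hasFDerivAt.isLittleO.def hη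
    have hd' := (hz k).eventually ((continuousAt_extChartAt (I := 𝓡 2) (x k)).eventually hd)
    filter_upwards [hd', (hz k).eventually (extChartAt_source_mem_nhds (I := 𝓡 2) (x k))]
      with z hz1 hz2
    have l1 := (extChartAt (𝓡 2) (x k)).left_inv hz2
    have l2 := (extChartAt (𝓡 2) (x k)).left_inv (mem_extChartAt_source (x k))
    simp only [chartRep, Function.comp, l1, l2, hxp k] at hz1
    exact hz1
  have e2 : ∀ᶠ z : (ℝ × ℝ) × (Fin 4 → F) in 𝓝 (0, x), ∀ k, ‖V₀ (z.2 k)‖ + ‖V₁ (z.2 k)‖ < M := by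
    rw [eventually_all]
    intro k
    exact (hz k).eventually ((h₀.continuous.norm.add h₁.continuous.norm).continuousAt.eventually
      (gt_mem_nhds (hMb k)))
  have e3 : ∀ᶠ z : (ℝ × ℝ) × (Fin 4 → F) in 𝓝 (0, x), c < ∑ k, inner ℝ (μ k) (V₀ (z.2 k)) := by
    have : Tendsto (fun z : (ℝ × ℝ) × (Fin 4 → F) => ∑ k, inner ℝ (μ k) (V₀ (z.2 k))) (𝓝 (0, x))
        (𝓝 (∑ k, inner ℝ (μ k) (V₀ (x k)))) :=
      tendsto_finsetSum _ fun k _ =>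
        tendsto_const_nhds.inner ((h₀.continuous.tendsto _).comp (hz k))
    exact this.eventually (lt_mem_nhds hcc.1)
  have e4 : ∀ᶠ z : (ℝ × ℝ) × (Fin 4 → F) in 𝓝 (0, x), c < ∑ k, inner ℝ (μ k) (V₁ (z.2 k)) := by
    have : Tendsto (fun z : (ℝ × ℝ) × (Fin 4 → F) => ∑ k, inner ℝ (μ k) (V₁ (z.2 k))) (𝓝 (0, x))
        (𝓝 (∑ k, inner ℝ (μ k) (V₁ (x k)))) :=
      tendsto_finsetSum _ fun k _ =>
        tendsto_const_nhds.inner ((h₁.continuous.tendsto _).comp (hz k))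
    exact this.eventually (lt_mem_nhds hcc.2)
  filter_upwards [e1, e2, e3, e4] with z m1 m2 m3 m4 hα hβ hq heq
  set α := z.1.1 with hα'
  set β := z.1.2 with hβ'
  set δ : Fin 4 → E2 := fun k => extChartAt (𝓡 2) (x k) (z.2 k) - extChartAt (𝓡 2) (x k) (x k)
    with hδ
  set r : Fin 4 → E3 := fun k => i (z.2 k) - p - chartDeriv i (x k) (δ k) with hr
  have hrb : ∀ k, ‖r k‖ ≤ η * ‖δ‖ := fun k =>
    (m1 k).trans (by gcongr; exact norm_le_pi_norm δ k)
  set y := perturb i V₀ V₁ z.1 (z.2 0) with hy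
  have hiz : ∀ k, i (z.2 k) = y - α • V₀ (z.2 k) - β • V₁ (z.2 k) := fun k => by
    rw [← heq k, perturb]; abel
  have hVb : ∀ k, ‖α • V₀ (z.2 k) + β • V₁ (z.2 k)‖ ≤ M * (α + β) := fun k => by
    refine (norm_add_le _ _).trans ?_
    rw [norm_smul, norm_smul, Real.norm_of_nonneg hα, Real.norm_of_nonneg hβ]
    have a1 : ‖V₀ (z.2 k)‖ ≤ M := by linarith [m2 k, norm_nonneg (V₁ (z.2 k))]
    have a2 : ‖V₁ (z.2 k)‖ ≤ M := by linarith [m2 k, norm_nonneg (V₀ (z.2 k))]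
    nlinarith
  have hΛb : ‖Λ δ‖ ≤ 2 * M * (α + β) + 2 * (η * ‖δ‖) := by
    rw [pi_norm_le_iff_of_nonneg (by positivity)]
    intro k
    have : Λ δ k = -(α • V₀ (z.2 k) + β • V₁ (z.2 k)) + (α • V₀ (z.2 0) + β • V₁ (z.2 0))
        - r k + r 0 := by
      rw [hΛ]
      simp only [hr, hiz]
      abel
    rw [this]
    calc _ ≤ ‖α • V₀ (z.2 k) + β • V₁ (z.2 k)‖ + ‖α • V₀ (z.2 0) + β • V₁ (z.2 0)‖ + ‖r k‖
          + ‖r 0‖ := by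
          refine (norm_add_le _ _).trans ?_
          gcongr
          refine (norm_sub_le _ _).trans ?_
          gcongr
          refine (norm_add_le _ _).trans ?_
          rw [norm_neg]
      _ ≤ _ := by linarith [hVb k, hVb 0, hrb k, hrb 0]
  have hδb : ‖δ‖ ≤ K * ‖Λ δ‖ := by
    have := hant.le_mul_dist δ 0
    simpa [dist_eq_norm] using this
  have hδb' : ‖δ‖ ≤ 4 * K * M * (α + β) := by
    have h1 : K * ‖Λ δ‖ ≤ K * (2 * M * (α + β) + 2 * (η * ‖δ‖)) := by gcongr
    have h2 : 4 * K * η * ‖δ‖ ≤ 1 * ‖δ‖ := by gcongr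
    nlinarith
  have hs1 : ∑ k, inner ℝ (μ k) (r k) = -(α * ∑ k, inner ℝ (μ k) (V₀ (z.2 k)) +
      β * ∑ k, inner ℝ (μ k) (V₁ (z.2 k))) := by
    have : ∀ k, (inner ℝ (μ k) (r k) : ℝ) = inner ℝ (μ k) (y - p) -
        α * inner ℝ (μ k) (V₀ (z.2 k)) - β * inner ℝ (μ k) (V₁ (z.2 k)) := fun k => by
      simp only [hr, hiz, inner_sub_right, hμ, real_inner_smul_right]
      ring
    simp only [this, Finset.sum_sub_distrib, ← Finset.mul_sum, ← sum_inner, hμs, inner_zero_left]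
    ring
  have hs2 : |∑ k, inner ℝ (μ k) (r k)| ≤ m * (η * ‖δ‖) := by
    rw [hm, Finset.sum_mul]
    refine (Finset.abs_sum_le_sum_abs _ _).trans (Finset.sum_le_sum fun k _ => ?_)
    exact (abs_real_inner_le_norm _ _).trans (by gcongr; exact hrb k)
  rw [hs1, abs_neg] at hs2
  have hs3 := (le_abs_self _).trans hs2
  have hs4 : m * (η * ‖δ‖) ≤ m * (η * (4 * K * M * (α + β))) := by gcongr
  have hs5 : c * (α + β) ≤ α * ∑ k, inner ℝ (μ k) (V₀ (z.2 k)) +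
      β * ∑ k, inner ℝ (μ k) (V₁ (z.2 k)) := by nlinarith
  have hs6 : c * (α + β) ≤ 4 * m * K * M * η * (α + β) := by nlinarith
  have := mul_lt_mul_of_pos_right hη2 hq
  linarith

/-- Let `i` be an immersion in `I`, and let `V₀` and `V₁` be vector fields along `i` that, to first
order, dissolve each of the quadruple points of `i` to the same side. Then all small perturbations
of `i` by nonnegative combinations of `V₀` and `V₁` are generic. -/
theorem eventually_isGenericImmersion_perturb [CompactSpace F] [T2Space F] (himm : IsImmersion i)
    (hst : ∀ p, IsStableAt i p ∨ IsGenericQuadruplePoint i p)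
    (hV : ∀ x : Fin 4 → F, Function.Injective x → (∀ k, i (x k) = i (x 0)) →
      ∃ μ : Fin 4 → E3, (∀ k a, inner ℝ (μ k) (chartDeriv i (x k) a) = 0) ∧ ∑ k, μ k = 0 ∧
        0 < ∑ k, inner ℝ (μ k) (V₀ (x k)) ∧ 0 < ∑ k, inner ℝ (μ k) (V₁ (x k))) :
    ∀ᶠ q : ℝ × ℝ in 𝓝 0, 0 ≤ q.1 → 0 ≤ q.2 → 0 < q.1 + q.2 →
      IsGenericImmersion (perturb i V₀ V₁ q) := by
  have himm' := (isImmersion_iff.1 himm).2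
  have hgp : ∀ p, SheetsInGeneralPosition i p := fun p => (hst p).elim And.right And.right
  have hcont := continuous_perturb hi h₀ h₁
  have h00 : perturb i V₀ V₁ 0 = i := by
    funext x; simp [perturb]
  -- The conditions on one to four points are obtained by compactness of the powers of `F`. Repeated
  -- points are excluded by uniform local injectivity, points with different images by continuity.
  -- At true coincidences transversality is open, and quadruple ones are dissolved by the push.
  have e1 : ∀ᶠ q : ℝ × ℝ in 𝓝 0, ∀ x ∈ (univ : Set F),
      Function.Injective (chartDeriv (perturb i V₀ V₁ q) x) :=
    isCompact_univ.eventually_forall_of_forall_eventually fun x _ =>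
      eventually_chartDeriv_perturb_injective hi h₀ h₁ (himm' x)
  have e2 : ∀ᶠ q : ℝ × ℝ in 𝓝 0, ∀ x ∈ (univ : Set (F × F)), x.1 ≠ x.2 →
      perturb i V₀ V₁ q x.1 = perturb i V₀ V₁ q x.2 →
      tangentPlane (perturb i V₀ V₁ q) x.1 ≠ tangentPlane (perturb i V₀ V₁ q) x.2 := by
    refine isCompact_univ.eventually_forall_of_forall_eventually fun x _ => ?_
    obtain ⟨x, y⟩ := x
    by_cases hxy : x = y
    · subst hxy
      filter_upwards [eventually_perturb_injective hi h₀ h₁ (himm' x)] with z hz h1 h2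
      exact absurd (hz h2) h1
    by_cases hixy : i x = i y
    · have ht1 : Tendsto (fun z : (ℝ × ℝ) × F × F => (z.1, z.2.1)) (𝓝 (0, x, y)) (𝓝 (0, x)) :=
        (show ContinuousAt (fun z : (ℝ × ℝ) × F × F => (z.1, z.2.1)) (0, x, y) by fun_prop).tendsto
      have ht2 : Tendsto (fun z : (ℝ × ℝ) × F × F => (z.1, z.2.2)) (𝓝 (0, x, y)) (𝓝 (0, y)) :=
        (show ContinuousAt (fun z : (ℝ × ℝ) × F × F => (z.1, z.2.2)) (0, x, y) by fun_prop).tendsto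
      have hT := ((sheetsInGeneralPosition_iff.1 (hgp (i y))).1 x y hixy rfl hxy)
      have hr := (((tendsto_chartDerivAt_perturb hi h₀ h₁ x).comp ht1).prodMk_nhds
        ((tendsto_chartDerivAt_perturb hi h₀ h₁ y).comp ht2)).eventually
          (eventually_range_ne (himm' x) (himm' y) hT)
      filter_upwards [hr, ht1.eventually (eventually_tangentPlane_perturb hi h₀ h₁ x),
        ht2.eventually (eventually_tangentPlane_perturb hi h₀ h₁ y)] with z h1 h2 h3 _ _
      rw [h2, h3]
      exact h1
    · have hc1 := (hcont.tendsto (0, x)).comp (show ContinuousAt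
        (fun z : (ℝ × ℝ) × F × F => (z.1, z.2.1)) (0, x, y) by fun_prop).tendsto
      have hc2 := (hcont.tendsto (0, y)).comp (show ContinuousAt
        (fun z : (ℝ × ℝ) × F × F => (z.1, z.2.2)) (0, x, y) by fun_prop).tendsto
      simp only [h00] at hc1 hc2
      filter_upwards [eventually_ne_of_tendsto hc1 hc2 hixy] with z h1 _ h2
      exact absurd h2 h1
  have e3 : ∀ᶠ q : ℝ × ℝ in 𝓝 0, ∀ x ∈ (univ : Set (F × F × F)), x.1 ≠ x.2.1 → x.1 ≠ x.2.2 →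
      x.2.1 ≠ x.2.2 → perturb i V₀ V₁ q x.1 = perturb i V₀ V₁ q x.2.1 →
      perturb i V₀ V₁ q x.1 = perturb i V₀ V₁ q x.2.2 →
      tangentPlane (perturb i V₀ V₁ q) x.1 ⊓ tangentPlane (perturb i V₀ V₁ q) x.2.1 ⊓
        tangentPlane (perturb i V₀ V₁ q) x.2.2 = ⊥ := by
    refine isCompact_univ.eventually_forall_of_forall_eventually fun x _ => ?_
    obtain ⟨x, y, w⟩ := x
    have ht1 : Tendsto (fun z : (ℝ × ℝ) × F × F × F => (z.1, z.2.1)) (𝓝 (0, x, y, w))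
        (𝓝 (0, x)) := (show ContinuousAt (fun z : (ℝ × ℝ) × F × F × F => (z.1, z.2.1))
          (0, x, y, w) by fun_prop).tendsto
    have ht2 : Tendsto (fun z : (ℝ × ℝ) × F × F × F => (z.1, z.2.2.1)) (𝓝 (0, x, y, w))
        (𝓝 (0, y)) := (show ContinuousAt (fun z : (ℝ × ℝ) × F × F × F => (z.1, z.2.2.1))
          (0, x, y, w) by fun_prop).tendsto
    have ht3 : Tendsto (fun z : (ℝ × ℝ) × F × F × F => (z.1, z.2.2.2)) (𝓝 (0, x, y, w))
        (𝓝 (0, w)) := (show ContinuousAt (fun z : (ℝ × ℝ) × F × F × F => (z.1, z.2.2.2))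
          (0, x, y, w) by fun_prop).tendsto
    have ht12 : Tendsto (fun z : (ℝ × ℝ) × F × F × F => (z.1, z.2.1, z.2.2.1)) (𝓝 (0, x, y, w))
        (𝓝 (0, x, y)) := (show ContinuousAt (fun z : (ℝ × ℝ) × F × F × F => (z.1, z.2.1, z.2.2.1))
          (0, x, y, w) by fun_prop).tendsto
    have ht13 : Tendsto (fun z : (ℝ × ℝ) × F × F × F => (z.1, z.2.1, z.2.2.2)) (𝓝 (0, x, y, w))
        (𝓝 (0, x, w)) := (show ContinuousAt (fun z : (ℝ × ℝ) × F × F × F => (z.1, z.2.1, z.2.2.2))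
          (0, x, y, w) by fun_prop).tendsto
    have ht23 : Tendsto (fun z : (ℝ × ℝ) × F × F × F => (z.1, z.2.2.1, z.2.2.2)) (𝓝 (0, x, y, w))
        (𝓝 (0, y, w)) := (show ContinuousAt (fun z : (ℝ × ℝ) × F × F × F =>
          (z.1, z.2.2.1, z.2.2.2)) (0, x, y, w) by fun_prop).tendsto
    by_cases hxy : x = y
    · subst hxy
      filter_upwards [ht12.eventually (eventually_perturb_injective hi h₀ h₁ (himm' x))]
        with z hz h1 h2 h3 h4 h5
      exact absurd (hz h4) h1
    by_cases hxw : x = w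
    · subst hxw
      filter_upwards [ht13.eventually (eventually_perturb_injective hi h₀ h₁ (himm' x))]
        with z hz h1 h2 h3 h4 h5
      exact absurd (hz h5) h2
    by_cases hyw : y = w
    · subst hyw
      filter_upwards [ht23.eventually (eventually_perturb_injective hi h₀ h₁ (himm' y))]
        with z hz h1 h2 h3 h4 h5
      exact absurd (hz (h4.symm.trans h5)) h3
    have hc1 := (hcont.tendsto (0, x)).comp ht1
    have hc2 := (hcont.tendsto (0, y)).comp ht2
    have hc3 := (hcont.tendsto (0, w)).comp ht3
    simp only [h00] at hc1 hc2 hc3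
    by_cases hixy : i x = i y
    · by_cases hixw : i x = i w
      · have hT := ((sheetsInGeneralPosition_iff.1 (hgp (i x))).2 x y w rfl hixy.symm hixw.symm
          hxy hxw hyw)
        have hr := (((tendsto_chartDerivAt_perturb hi h₀ h₁ x).comp ht1).prodMk_nhds
          (((tendsto_chartDerivAt_perturb hi h₀ h₁ y).comp ht2).prodMk_nhds
          ((tendsto_chartDerivAt_perturb hi h₀ h₁ w).comp ht3))).eventually
            (eventually_range_inf_eq_bot (himm' x) (himm' y) (himm' w) hT)
        filter_upwards [hr, ht1.eventually (eventually_tangentPlane_perturb hi h₀ h₁ x),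
          ht2.eventually (eventually_tangentPlane_perturb hi h₀ h₁ y),
          ht3.eventually (eventually_tangentPlane_perturb hi h₀ h₁ w)] with z h1 h2 h3 h4 _ _ _ _ _
        rw [h2, h3, h4]
        exact h1
      · filter_upwards [eventually_ne_of_tendsto hc1 hc3 hixw] with z h1 _ _ _ _ h2
        exact absurd h2 h1
    · filter_upwards [eventually_ne_of_tendsto hc1 hc2 hixy] with z h1 _ _ _ h2
      exact absurd h2 h1
  have e4 : ∀ᶠ q : ℝ × ℝ in 𝓝 0, ∀ x ∈ (univ : Set (Fin 4 → F)), 0 ≤ q.1 → 0 ≤ q.2 →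
      0 < q.1 + q.2 → Function.Injective x →
      ¬ ∀ k, perturb i V₀ V₁ q (x k) = perturb i V₀ V₁ q (x 0) := by
    refine isCompact_univ.eventually_forall_of_forall_eventually fun x _ => ?_
    have ht : ∀ k, Tendsto (fun z : (ℝ × ℝ) × (Fin 4 → F) => (z.1, z.2 k)) (𝓝 (0, x))
        (𝓝 (0, x k)) := fun k =>
      (show ContinuousAt (fun z : (ℝ × ℝ) × (Fin 4 → F) => (z.1, z.2 k)) (0, x) by
        fun_prop).tendsto
    by_cases hx : Function.Injective x
    · by_cases hix : ∀ k, i (x k) = i (x 0)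
      · obtain ⟨μ, m1, m2, m3, m4⟩ := hV x hx hix
        have := eventually_image_ne_of_quadruple hi h₀ h₁ hix (fun k => himm' (x k))
          ((sheetsInGeneralPosition_iff.1 (hgp (i (x 0)))).2 _ _ _ (hix 0) (hix 1) (hix 2)
            (hx.ne (by decide)) (hx.ne (by decide)) (hx.ne (by decide))) m1 m2 m3 m4
        filter_upwards [this] with z hz a b c _
        exact hz a b c
      · push Not at hix
        obtain ⟨k, hk⟩ := hix
        have hc1 := (hcont.tendsto (0, x k)).comp (ht k)
        have hc2 := (hcont.tendsto (0, x 0)).comp (ht 0)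
        simp only [h00] at hc1 hc2
        filter_upwards [eventually_ne_of_tendsto hc1 hc2 hk] with z h1 _ _ _ _ h2
        exact h1 (h2 k)
    · obtain ⟨k, l, hkl, hne⟩ : ∃ k l, x k = x l ∧ k ≠ l := by
        simpa [Function.Injective] using hx
      have ht' : Tendsto (fun z : (ℝ × ℝ) × (Fin 4 → F) => (z.1, z.2 k, z.2 l)) (𝓝 (0, x))
          (𝓝 (0, x k, x k)) := by
        have := (show ContinuousAt (fun z : (ℝ × ℝ) × (Fin 4 → F) => (z.1, z.2 k, z.2 l)) (0, x) by
          fun_prop).tendsto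
        simpa [hkl] using this
      filter_upwards [ht'.eventually (eventually_perturb_injective hi h₀ h₁ (himm' (x k)))]
        with z hz _ _ _ h1 h2
      exact hne (h1 (hz ((h2 k).trans (h2 l).symm)))
  filter_upwards [e1, e2, e3, e4] with q m1 m2 m3 m4 hq1 hq2 hq
  refine ⟨isImmersion_iff.2 ⟨contMDiff_perturb hi h₀ h₁ q, fun x => m1 x (mem_univ _)⟩,
    fun p => ⟨?_, ?_⟩⟩
  · by_contra hcard
    have h4 : 4 ≤ (perturb i V₀ V₁ q ⁻¹' {p}).encard := by
      have := not_le.1 hcard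
      exact Order.add_one_le_of_lt this
    obtain ⟨t, ht, ht4⟩ := Set.exists_subset_encard_eq h4
    have hfin : t.Finite := Set.finite_of_encard_eq_coe (k := 4) (by simpa using ht4)
    have hcard' : Nat.card t = 4 := by
      rw [Nat.card_coe_set_eq, Set.ncard, ht4]; rfl
    have := hfin.to_subtype
    let e := (Finite.equivFinOfCardEq hcard').symm
    refine m4 (fun k => (e k : F)) (mem_univ _) hq1 hq2 hq
      (Subtype.val_injective.comp e.injective) fun k => ?_
    have a1 : perturb i V₀ V₁ q (e k) = p := ht (e k).2
    have a2 : perturb i V₀ V₁ q (e 0) = p := ht (e 0).2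
    rw [a1, a2]
  · rw [sheetsInGeneralPosition_iff]
    exact ⟨fun x y hx hy hxy => m2 (x, y) (mem_univ _) hxy (hx.trans hy.symm),
      fun x y w hx hy hw hxy hxw hyw => m3 (x, y, w) (mem_univ _) hxy hxw hyw
        (hx.trans hy.symm) (hx.trans hw.symm)⟩

end

section
/-! ### Planes and their normals -/

theorem exists_normal {T : Submodule ℝ E3} (hT : Module.finrank ℝ T = 2) :
    ∃ n : E3, ‖n‖ = 1 ∧ ∀ v ∈ T, inner ℝ n v = 0 := by
  have h1 : Module.finrank ℝ Tᗮ = 1 := by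
    have := T.finrank_add_finrank_orthogonal
    simp only [hT, finrank_euclideanSpace, Fintype.card_fin] at this
    omega
  obtain ⟨n, hn, hn0⟩ := Submodule.exists_mem_ne_zero_of_ne_bot
    (show Tᗮ ≠ ⊥ by intro h; rw [h] at h1; simp at h1)
  refine ⟨‖n‖⁻¹ • n, by simp [norm_smul, hn0], fun v hv => ?_⟩
  rw [real_inner_smul_left, real_inner_comm, (Submodule.mem_orthogonal T n).1 hn v hv, mul_zero]

theorem mem_plane_iff {T : Submodule ℝ E3} (hT : Module.finrank ℝ T = 2) {n : E3} (hn0 : n ≠ 0)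
    (hn : ∀ v ∈ T, inner ℝ n v = 0) {v : E3} : v ∈ T ↔ inner ℝ n v = 0 := by
  have hle : T ≤ (ℝ ∙ n)ᗮ := fun v hv => by
    rw [Submodule.mem_orthogonal_singleton_iff_inner_right]; exact hn v hv
  have h1 : Module.finrank ℝ (ℝ ∙ n)ᗮ = 2 := by
    have : Fact (Module.finrank ℝ E3 = 2 + 1) := ⟨by simp⟩
    exact Submodule.finrank_orthogonal_span_singleton hn0
  have := Submodule.eq_of_le_of_finrank_eq hle (by rw [hT, h1])
  rw [this, Submodule.mem_orthogonal_singleton_iff_inner_right]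

theorem linearIndependent_of_orthogonal {n : Fin 3 → E3}
    (h : ∀ v : E3, (∀ k, inner ℝ (n k) v = 0) → v = 0) : LinearIndependent ℝ n := by
  refine linearIndependent_of_top_le_span_of_card_eq_finrank ?_ (by simp)
  rw [top_le_iff, ← Submodule.orthogonal_eq_bot_iff, Submodule.eq_bot_iff]
  intro v hv
  refine h v fun k => (Submodule.mem_orthogonal _ v).1 hv _ (Submodule.subset_span ⟨k, rfl⟩)

/-- Four planes in general position satisfy a conormal relation in which all of them take part. -/
theorem exists_conormal_relation {T : Fin 4 → Submodule ℝ E3}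
    (hT : ∀ k, Module.finrank ℝ (T k) = 2)
    (hgp : ∀ a b c, a ≠ b → a ≠ c → b ≠ c → T a ⊓ T b ⊓ T c = ⊥) :
    ∃ μ : Fin 4 → E3, (∀ k, ∀ v ∈ T k, inner ℝ (μ k) v = 0) ∧ ∑ k, μ k = 0 ∧ ∀ k, μ k ≠ 0 := by
  choose n hn1 hn using fun k => exists_normal (hT k)
  have hn0 : ∀ k, n k ≠ 0 := fun k h => by simpa [h] using hn1 k
  have hdep : ¬ LinearIndependent ℝ n := fun h => by
    have := h.fintype_card_le_finrank
    simp at this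
  obtain ⟨g, hg, j, hj⟩ := Fintype.not_linearIndependent_iff.1 hdep
  refine ⟨fun k => g k • n k, fun k v hv => ?_, hg, fun k hk => ?_⟩
  · rw [real_inner_smul_left, hn k v hv, mul_zero]
  -- A vanishing coefficient would leave a dependence among three of the normals, which are
  -- independent.
  · rw [smul_eq_zero, or_iff_left (hn0 k)] at hk
    rw [Fin.sum_univ_succAbove _ k, hk, zero_smul, zero_add] at hg
    have hli : LinearIndependent ℝ fun m : Fin 3 => n (k.succAbove m) := by
      refine linearIndependent_of_orthogonal fun v hv => ?_
      have h3 : v ∈ T (k.succAbove 0) ⊓ T (k.succAbove 1) ⊓ T (k.succAbove 2) :=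
        ⟨⟨(mem_plane_iff (hT _) (hn0 _) (hn _)).2 (hv 0),
          (mem_plane_iff (hT _) (hn0 _) (hn _)).2 (hv 1)⟩,
          (mem_plane_iff (hT _) (hn0 _) (hn _)).2 (hv 2)⟩
      rw [hgp _ _ _ (by simp) (by simp) (by simp)] at h3
      exact h3
    have h0 := Fintype.linearIndependent_iff.1 hli (fun m => g (k.succAbove m)) hg
    rcases Fin.eq_self_or_eq_succAbove k j with rfl | ⟨m, rfl⟩
    · exact hj hk
    · exact hj (h0 m)

variable {F : Type*} [TopologicalSpace F] [ChartedSpace E2 F]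

theorem IsQInvariant.eq_of_homotopy {f : GenericImm F → ZMod 2} (hf : IsQInvariant f)
    {H : ℝ → F → E3} (hH : IsGenericRegularHomotopy H) (hN : NoQuadruplePoints H) {h₀ h₁ : F → E3}
    (e₀ : H 0 = h₀) (e₁ : H 1 = h₁) (g₀ : IsGenericImmersion h₀) (g₁ : IsGenericImmersion h₁) :
    f ⟨h₀, g₀⟩ = f ⟨h₁, g₁⟩ := by
  subst e₀ e₁
  exact hf H hH hN

/-- A segment of generic immersions has no unstable self intersection, so the conditions on events
are void and there are no quadruple points. -/
theorem IsQInvariant.eq_of_affine [IsManifold (𝓡 2) ∞ F] {f : GenericImm F → ZMod 2}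
    (hf : IsQInvariant f)
    {h₀ h₁ : F → E3} (g₀ : IsGenericImmersion h₀) (g₁ : IsGenericImmersion h₁)
    (hg : ∀ t ∈ Icc (0 : ℝ) 1, IsGenericImmersion fun x => (1 - t) • h₀ x + t • h₁ x) :
    f ⟨h₀, g₀⟩ = f ⟨h₁, g₁⟩ := by
  have s₀ := g₀.1.1
  have s₁ := g₁.1.1
  refine hf.eq_of_homotopy (H := fun t x => (1 - t) • h₀ x + t • h₁ x) ⟨⟨?_, fun t ht => (hg t ht).1⟩,
    hg 0 (by simp), hg 1 (by simp), fun t ht p hp => ?_, fun t ht p hp => ?_⟩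
    (fun t ht p => ?_) (by simp) (by simp) g₀ g₁
  · refine ContMDiff.contMDiffOn ?_
    have k₀ : ContMDiff ((𝓘(ℝ, ℝ)).prod (𝓡 2)) 𝓘(ℝ, ℝ) ∞ (fun q : ℝ × F => 1 - q.1) :=
      contMDiff_const.sub contMDiff_fst
    have k₁ : ContMDiff ((𝓘(ℝ, ℝ)).prod (𝓡 2)) 𝓘(ℝ, ℝ) ∞ (fun q : ℝ × F => q.1) :=
      contMDiff_fst
    have l₀ : ContMDiff ((𝓘(ℝ, ℝ)).prod (𝓡 2)) 𝓘(ℝ, E3) ∞ (fun q : ℝ × F => h₀ q.2) :=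
      s₀.comp contMDiff_snd
    have l₁ : ContMDiff ((𝓘(ℝ, ℝ)).prod (𝓡 2)) 𝓘(ℝ, E3) ∞ (fun q : ℝ × F => h₁ q.2) :=
      s₁.comp contMDiff_snd
    have m₀ := k₀.smul l₀
    have m₁ := k₁.smul l₁
    exact m₀.add m₁
  · exact absurd ((hg t ⟨ht.1.le, ht.2.le⟩).2 p) hp
  · exact absurd ((hg t ⟨ht.1.le, ht.2.le⟩).2 p) hp
  · have := ((hg t ht).2 p).1
    exact lt_of_le_of_lt this (by norm_num)

/-! ### Quadruple points and their conormal relations. -/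

section Quadruple
variable {i : F → E3} {n : ℕ}

theorem MemI.isGenericQuadruplePoint (hi : MemI n i) {x : Fin 4 → F} (hx : Function.Injective x)
    {p : E3} (hxp : ∀ k, i (x k) = p) : p ∈ quadruplePoints i := by
  rcases hi.2.1 p with h | h
  · exfalso
    have h4 : (range x).encard = 4 := by
      rw [← image_univ, hx.encard_image, encard_univ]; simp
    have hsub : range x ⊆ i ⁻¹' {p} := by rintro _ ⟨k, rfl⟩; exact hxp k
    have := (encard_le_encard hsub).trans h.1
    rw [h4] at this
    exact absurd this (by norm_num)
  · exact h

theorem IsGenericQuadruplePoint.preimage_eq_range {p : E3} (hp : IsGenericQuadruplePoint i p)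
    {x : Fin 4 → F} (hx : Function.Injective x) (hxp : ∀ k, i (x k) = p) :
    i ⁻¹' {p} = range x := by
  have h4 : (range x).encard = 4 := by
    rw [← image_univ, hx.encard_image, encard_univ]; simp
  have hsub : range x ⊆ i ⁻¹' {p} := by rintro _ ⟨k, rfl⟩; exact hxp k
  exact ((finite_range x).eq_of_subset_of_encard_le hsub (by rw [hp.1, h4])).symm

theorem IsGenericQuadruplePoint.exists_enumeration {p : E3} (hp : IsGenericQuadruplePoint i p) :
    ∃ x : Fin 4 → F, Function.Injective x ∧ ∀ k, i (x k) = p := by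
  have hfin : (i ⁻¹' {p}).Finite := Set.finite_of_encard_eq_coe (k := 4) (by simpa using hp.1)
  have hcard' : Nat.card (i ⁻¹' {p}) = 4 := by
    rw [Nat.card_coe_set_eq, Set.ncard, hp.1]; rfl
  have := hfin.to_subtype
  let e := (Finite.equivFinOfCardEq hcard').symm
  exact ⟨fun k => (e k : F), Subtype.val_injective.comp e.injective, fun k => (e k).2⟩

/-- Conormal relations at all the quadruple points. -/
theorem MemI.exists_conormals (hi : MemI n i) : ∃ μ : F → E3, ∀ x : Fin 4 → F,
    Function.Injective x → (∀ k, i (x k) = i (x 0)) →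
      (∀ k, ∀ v ∈ tangentPlane i (x k), inner ℝ (μ (x k)) v = 0) ∧ ∑ k, μ (x k) = 0 ∧
      ∀ k, μ (x k) ≠ 0 := by
  classical
  have himm := (isImmersion_iff.1 hi.1).2
  have key : ∀ p : E3, ∃ μ : F → E3, ∀ x : Fin 4 → F,
    Function.Injective x → (∀ k, i (x k) = p) →
      (∀ k, ∀ v ∈ tangentPlane i (x k), inner ℝ (μ (x k)) v = 0) ∧ ∑ k, μ (x k) = 0 ∧
      ∀ k, μ (x k) ≠ 0 := by
    intro p
    by_cases hp : p ∈ quadruplePoints i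
    · obtain ⟨y, hy, hyp⟩ := IsGenericQuadruplePoint.exists_enumeration hp
      have hgp := (sheetsInGeneralPosition_iff.1 hp.2).2
      obtain ⟨μ, m1, m2, m3⟩ := exists_conormal_relation
        (T := fun k => tangentPlane i (y k)) (fun k => finrank_tangentPlane (himm _))
        (fun a b c hab hac hbc => hgp _ _ _ (hyp a) (hyp b) (hyp c) (hy.ne hab) (hy.ne hac)
          (hy.ne hbc))
      -- Attaching the conormals to points of the surface instead of labels makes the relation
      -- independent of the enumeration of the sheets.
      refine ⟨fun z => ∑ k, if y k = z then μ k else 0, fun x hx hxp => ?_⟩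
      have hrange : range x = range y := by
        rw [← IsGenericQuadruplePoint.preimage_eq_range hp hx hxp,
          IsGenericQuadruplePoint.preimage_eq_range hp hy hyp]
      have hμ : ∀ k, (∑ l, if y l = y k then μ l else 0) = μ k := fun k => by
        simp [hy.eq_iff]
      have hxy : ∀ k, ∃ l, y l = x k := fun k => by
        have : x k ∈ range y := hrange ▸ ⟨k, rfl⟩
        exact this
      choose π hπ using hxy
      have hπi : Function.Injective π := fun a b hab => hx (by rw [← hπ, ← hπ, hab])
      have hπb : Function.Bijective π := Finite.injective_iff_bijective.1 hπi
      refine ⟨fun k v hv => ?_, ?_, fun k => ?_⟩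
      · show inner ℝ (∑ l, if y l = x k then μ l else 0) v = 0
        rw [← hπ k, hμ]; rw [← hπ k] at hv; exact m1 _ v hv
      · have : ∀ k, (∑ l, if y l = x k then μ l else 0) = μ (π k) := fun k => by
          rw [← hπ k, hμ]
        simp only [this]
        rw [← m2]
        exact hπb.sum_comp μ
      · show (∑ l, if y l = x k then μ l else 0) ≠ 0
        rw [← hπ k, hμ]; exact m3 _
    · exact ⟨0, fun x hx hxp => absurd (hi.isGenericQuadruplePoint hx hxp) hp⟩
  choose μ hμ using key
  refine ⟨fun x => μ (i x) x, fun x hx hxp => ?_⟩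
  have := hμ (i (x 0)) x hx hxp
  have h2 : ∀ k, μ (i (x k)) (x k) = μ (i (x 0)) (x k) := fun k => by rw [hxp k]
  simp only [h2]
  exact this

/-- The combined push field for given sides. -/
def pushField {n : ℕ} (V : Fin n → F → E3) (s : Fin n → ℤˣ) : F → E3 :=
  fun y => ∑ k, (((s k : ℤˣ) : ℤ) : ℝ) • V k y

theorem pushed_eq_perturb {n : ℕ} (i : F → E3) (V : Fin n → F → E3) (W : F → E3) (ε : ℝ)
    (s : Fin n → ℤˣ) : pushed i V ε s = perturb i (pushField V s) W (ε, 0) := by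
  funext y; simp [pushed, perturb, pushField]

theorem pushed_eq_perturb' {n : ℕ} (i : F → E3) (V : Fin n → F → E3) (W : F → E3) (ε : ℝ)
    (s : Fin n → ℤˣ) : pushed i V ε s = perturb i W (pushField V s) (0, ε) := by
  funext y; simp [pushed, perturb, pushField]

theorem IsPushSystem.contMDiff_pushField {x : Fin n → F} {V : Fin n → F → E3}
    (hV : IsPushSystem i x V) (s : Fin n → ℤˣ) :
    ContMDiff (𝓡 2) 𝓘(ℝ, E3) ∞ (pushField V s) := by
  have h : ∀ k ∈ (Finset.univ : Finset (Fin n)),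
      ContMDiff (𝓡 2) 𝓘(ℝ, E3) ∞ (fun y => (((s k : ℤˣ) : ℤ) : ℝ) • V k y) := fun k _ => by
    have hc : ContMDiff (𝓡 2) 𝓘(ℝ, ℝ) ∞ (fun _ : F => (((s k : ℤˣ) : ℤ) : ℝ)) := contMDiff_const
    exact hc.smul (hV.smooth k)
  exact contMDiff_finsetSum h

/-- At a quadruple point, the push field satisfies the conormal relation up to the contribution of
the selected sheet. -/
theorem IsPushSystem.sum_inner_pushField {x : Fin n → F} {V : Fin n → F → E3}
    (hV : IsPushSystem i x V) (s : Fin n → ℤˣ) (μ : F → E3) {y : Fin 4 → F}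
    (hy : Function.Injective y) {l : Fin n} (hyp : ∀ k, i (y k) = i (x l))
    (hq : i (x l) ∈ quadruplePoints i) :
    ∑ k, inner ℝ (μ (y k)) (pushField V s (y k)) =
      (((s l : ℤˣ) : ℤ) : ℝ) * inner ℝ (μ (x l)) (V l (x l)) := by
  classical
  have hrange := IsGenericQuadruplePoint.preimage_eq_range hq hy hyp
  obtain ⟨a, ha⟩ : ∃ a, y a = x l := by
    have : x l ∈ range y := hrange ▸ rfl
    exact this
  have h0 : ∀ m k, y k ≠ x m → V m (y k) = 0 := fun m k hne =>
    (hV.local_support m (y k) (by rw [hyp k]; exact hq) hne).self_of_nhds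
  have hne : ∀ m k, m ≠ l → y k ≠ x m := fun m k hm h =>
    hm (hV.bijOn.injOn (mem_univ _) (mem_univ _) (by show i (x m) = i (x l); rw [← h, hyp]))
  have h1 : ∀ k, pushField V s (y k) = (((s l : ℤˣ) : ℤ) : ℝ) • V l (y k) := fun k => by
    unfold pushField
    rw [Finset.sum_eq_single l (fun m _ hm => by rw [h0 m k (hne m k hm), smul_zero]) (by simp)]
  simp only [h1]
  rw [Finset.sum_eq_single a (fun k _ hk => by
    rw [h0 l k (fun h => hk (hy (h.trans ha.symm))), smul_zero, inner_zero_right]) (by simp), ha,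
    real_inner_smul_right]

end Quadruple

end

/-! ### Comparison of pushes and the extension of q-invariants. -/

section
/-- The sign of a real number, as a unit of `ℤ`. -/
def signUnit (c : ℝ) : ℤˣ := if 0 < c then 1 else -1

theorem signUnit_mul_pos {c : ℝ} (hc : c ≠ 0) : 0 < (((signUnit c : ℤˣ) : ℤ) : ℝ) * c := by
  unfold signUnit
  split_ifs with h
  · simpa using h
  · have := lt_of_le_of_ne (not_lt.1 h) hc
    simpa using this

theorem unit_mul_self_real (s : ℤˣ) : (((s : ℤˣ) : ℤ) : ℝ) * (((s : ℤˣ) : ℤ) : ℝ) = 1 := by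
  have h : (s : ℤ) * (s : ℤ) = 1 := by
    rw [← Units.val_mul, Int.units_mul_self]; rfl
  exact_mod_cast h

variable {F : Type*} [TopologicalSpace F] [ChartedSpace E2 F] [IsManifold (𝓡 2) ∞ F]
  [CompactSpace F] [T2Space F] {i : F → E3} {n : ℕ}

/-- At the selected sheet `μ` is a nonzero normal, and the push is transverse to that sheet. -/
theorem IsPushSystem.inner_ne_zero {x : Fin n → F} {V : Fin n → F → E3} (hi : MemI n i)
    (hV : IsPushSystem i x V) {μ : F → E3}
    (hμ : ∀ x : Fin 4 → F, Function.Injective x → (∀ k, i (x k) = i (x 0)) →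
      (∀ k, ∀ v ∈ tangentPlane i (x k), inner ℝ (μ (x k)) v = 0) ∧ ∑ k, μ (x k) = 0 ∧
      ∀ k, μ (x k) ≠ 0) (l : Fin n) : inner ℝ (μ (x l)) (V l (x l)) ≠ 0 := by
  have himm := (isImmersion_iff.1 hi.1).2
  have hq : i (x l) ∈ quadruplePoints i := hV.bijOn.mapsTo (mem_univ l)
  obtain ⟨y, hy, hyp⟩ := IsGenericQuadruplePoint.exists_enumeration hq
  obtain ⟨m1, m2, m3⟩ := hμ y hy (fun k => (hyp k).trans (hyp 0).symm)
  obtain ⟨a, ha⟩ : ∃ a, y a = x l := by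
    have : x l ∈ range y := IsGenericQuadruplePoint.preimage_eq_range hq hy hyp ▸ rfl
    exact this
  rw [← ha]
  intro h
  have := (mem_plane_iff (finrank_tangentPlane (himm (y a))) (m3 a) (m1 a)).2 h
  rw [ha] at this
  exact hV.transverse l this

/-- The condition `hs` says that at each quadruple point both systems push to the same side, as
measured by the conormal relation, even though they may move different sheets. -/
theorem MemI.eventually_isGeneric_pushes {x x' : Fin n → F} {V V' : Fin n → F → E3}
    (hi : MemI n i) (hV : IsPushSystem i x V) (hV' : IsPushSystem i x' V') {μ : F → E3}
    (hμ : ∀ x : Fin 4 → F, Function.Injective x → (∀ k, i (x k) = i (x 0)) →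
      (∀ k, ∀ v ∈ tangentPlane i (x k), inner ℝ (μ (x k)) v = 0) ∧ ∑ k, μ (x k) = 0 ∧
      ∀ k, μ (x k) ≠ 0) {s s' : Fin n → ℤˣ}
    (hs : ∀ l l', i (x l) = i (x' l') →
      0 < ((((s l : ℤˣ) : ℤ) : ℝ) * inner ℝ (μ (x l)) (V l (x l))) *
        ((((s' l' : ℤˣ) : ℤ) : ℝ) * inner ℝ (μ (x' l')) (V' l' (x' l')))) :
    ∀ᶠ q : ℝ × ℝ in 𝓝 0, 0 ≤ q.1 → 0 ≤ q.2 → 0 < q.1 + q.2 →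
      IsGenericImmersion (perturb i (pushField V s) (pushField V' s') q) := by
  refine eventually_isGenericImmersion_perturb hi.1.1 (hV.contMDiff_pushField s)
    (hV'.contMDiff_pushField s') hi.1 hi.2.1 fun y hy hyp => ?_
  have hq := hi.isGenericQuadruplePoint hy hyp
  obtain ⟨l, -, hl⟩ := hV.bijOn.surjOn hq
  obtain ⟨l', -, hl'⟩ := hV'.bijOn.surjOn hq
  simp only at hl hl'
  obtain ⟨m1, m2, m3⟩ := hμ y hy hyp
  have e := hV.sum_inner_pushField s μ hy (l := l) (fun k => (hyp k).trans hl.symm) (by rwa [hl])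
  have e' := hV'.sum_inner_pushField s' μ hy (l := l') (fun k => (hyp k).trans hl'.symm)
    (by rwa [hl'])
  have hpos := hs l l' (hl.trans hl'.symm)
  rw [← e, ← e'] at hpos
  rcases mul_pos_iff.1 hpos with ⟨p1, p2⟩ | ⟨p1, p2⟩
  · exact ⟨fun k => μ (y k), fun k a => m1 k _ ⟨a, rfl⟩, m2, p1, p2⟩
  -- If both pairings are negative, the opposite relation is used.
  · refine ⟨fun k => -μ (y k), fun k a => ?_, ?_, ?_, ?_⟩
    · have := m1 k (chartDeriv i (y k) a) ⟨a, rfl⟩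
      rw [inner_neg_left, this, neg_zero]
    · rw [Finset.sum_neg_distrib, m2, neg_zero]
    · simpa only [inner_neg_left, Finset.sum_neg_distrib, neg_pos] using p1
    · simpa only [inner_neg_left, Finset.sum_neg_distrib, neg_pos] using p2

/-- The sides of two push systems can be matched in such a way that the corresponding pushes are
joined by generic immersions. -/
theorem MemI.exists_matching {x x' : Fin n → F} {V V' : Fin n → F → E3}
    (hi : MemI n i) (hV : IsPushSystem i x V) (hV' : IsPushSystem i x' V') :
    ∃ φ : (Fin n → ℤˣ) ≃ (Fin n → ℤˣ), ∀ᶠ q : ℝ × ℝ in 𝓝 0, 0 ≤ q.1 → 0 ≤ q.2 → 0 < q.1 + q.2 →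
      ∀ s, IsGenericImmersion (perturb i (pushField V s) (pushField V' (φ s)) q) := by
  obtain ⟨μ, hμ⟩ := hi.exists_conormals
  have hex : ∀ l', ∃ l, i (x l) = i (x' l') := fun l' => by
    obtain ⟨l, -, hl⟩ := hV.bijOn.surjOn (hV'.bijOn.mapsTo (mem_univ l'))
    exact ⟨l, hl⟩
  choose π hπ using hex
  have hπi : Function.Injective π := fun a b hab => hV'.bijOn.injOn (mem_univ _) (mem_univ _)
    (by show i (x' a) = i (x' b); rw [← hπ, ← hπ, hab])
  have hπs : Function.Surjective π := (Finite.injective_iff_bijective.1 hπi).2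
  let c : Fin n → ℝ := fun l => inner ℝ (μ (x l)) (V l (x l))
  let c' : Fin n → ℝ := fun l => inner ℝ (μ (x' l)) (V' l (x' l))
  -- The side is flipped exactly when the two fields pair with `μ` with opposite signs, so that
  -- matched pushes dissolve the quadruple point to the same side.
  let ψ : (Fin n → ℤˣ) → (Fin n → ℤˣ) := fun s l' =>
    s (π l') * (signUnit (c (π l')) * signUnit (c' l'))
  have hψ : Function.Injective ψ := fun s t hst => by
    funext l
    obtain ⟨l', rfl⟩ := hπs l
    exact mul_right_cancel (congrFun hst l')
  refine ⟨Equiv.ofBijective ψ (Finite.injective_iff_bijective.1 hψ), ?_⟩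
  have : ∀ s, ∀ᶠ q : ℝ × ℝ in 𝓝 0, 0 ≤ q.1 → 0 ≤ q.2 → 0 < q.1 + q.2 →
      IsGenericImmersion (perturb i (pushField V s) (pushField V' (ψ s)) q) := fun s => by
    refine hi.eventually_isGeneric_pushes hV hV' hμ fun l l' hll' => ?_
    obtain rfl : π l' = l := hV.bijOn.injOn (mem_univ _) (mem_univ _) ((hπ l').trans hll'.symm)
    have p1 := signUnit_mul_pos (hV.inner_ne_zero hi hμ (π l'))
    have p2 := signUnit_mul_pos (hV'.inner_ne_zero hi hμ l')
    have p3 := unit_mul_self_real (s (π l'))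
    have := mul_pos p1 p2
    simp only [ψ, Units.val_mul, Int.cast_mul]
    calc (0 : ℝ) < _ := this
      _ = 1 * _ := (one_mul _).symm
      _ = _ := by rw [← p3]; simp only [c, c']; ring
  filter_upwards [eventually_all.2 this] with q hq h1 h2 h3 s
  exact hq s h1 h2 h3

/-- Push systems exist, with selected sheets, directions and supports at will. -/
theorem MemI.exists_isPushSystem (hi : MemI n i) {x : Fin n → F}
    (hx : BijOn (fun k => i (x k)) univ (quadruplePoints i)) {v : Fin n → E3}
    (hv : ∀ k, v k ∉ tangentPlane i (x k)) {U : Fin n → Set F} (hU : ∀ k, U k ∈ 𝓝 (x k)) :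
    ∃ V : Fin n → F → E3, IsPushSystem i x V ∧ ∀ k, tsupport (V k) ⊆ U k := by
  have hQ : (i ⁻¹' quadruplePoints i).Finite := by
    have h1 : (quadruplePoints i).Finite := Set.finite_of_encard_eq_coe hi.2.2
    rw [← biUnion_preimage_singleton]
    refine h1.biUnion fun p hp => Set.finite_of_encard_eq_coe (k := 4) (by simpa using hp.1)
  -- Quadruple points have finitely many preimages in all, so the bump can be kept away from those
  -- other than `x k`.
  have hb : ∀ k, ∃ β : SmoothBumpFunction (𝓡 2) (x k),
      tsupport β ⊆ U k ∩ (i ⁻¹' quadruplePoints i \ {x k})ᶜ := fun k => by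
    have hmem : U k ∩ (i ⁻¹' quadruplePoints i \ {x k})ᶜ ∈ 𝓝 (x k) :=
      inter_mem (hU k) ((hQ.subset sdiff_subset).isClosed.isOpen_compl.mem_nhds (by simp))
    obtain ⟨β, -, hβ⟩ := (SmoothBumpFunction.nhds_basis_tsupport (I := 𝓡 2) (x k)).mem_iff.1 hmem
    exact ⟨β, hβ⟩
  choose β hβ using hb
  have hts : ∀ k, tsupport (fun y => β k y • v k) ⊆ tsupport (β k) := fun k =>
    closure_mono fun y hy => by
      rw [Function.mem_support] at hy ⊢
      exact fun h => hy (by rw [h, zero_smul])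
  refine ⟨fun k y => β k y • v k, ⟨hx, fun k => ?_, fun k => ?_, fun k y hy hne => ?_⟩,
    fun k => (hts k).trans ((hβ k).trans inter_subset_left)⟩
  · have hc : ContMDiff (𝓡 2) 𝓘(ℝ, E3) ∞ (fun _ : F => v k) := contMDiff_const
    exact (β k).contMDiff.smul hc
  · simpa [(β k).eq_one] using hv k
  · have : y ∉ tsupport (β k) := fun h => (hβ k h).2 ⟨hy, hne⟩
    have h2 : y ∉ tsupport (fun y => β k y • v k) := fun h => this (hts k h)
    exact notMem_tsupport_iff_eventuallyEq.1 h2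

theorem exists_notMem_tangentPlane (himm : IsImmersion i) (x : F) : ∃ v, v ∉ tangentPlane i x := by
  by_contra! h
  have h1 := finrank_tangentPlane ((isImmersion_iff.1 himm).2 x)
  rw [(Submodule.eq_top_iff'.2 h), finrank_top] at h1
  simp at h1

theorem MemI.exists_sheets (hi : MemI n i) :
    ∃ x : Fin n → F, BijOn (fun k => i (x k)) univ (quadruplePoints i) := by
  have h1 : (quadruplePoints i).Finite := Set.finite_of_encard_eq_coe hi.2.2
  have hcard : Nat.card (quadruplePoints i) = n := by
    rw [Nat.card_coe_set_eq, Set.ncard, hi.2.2]; rfl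
  have := h1.to_subtype
  let e := (Finite.equivFinOfCardEq hcard).symm
  have hex : ∀ k, ∃ x, i x = e k := fun k => by
    obtain ⟨y, -, hyp⟩ := IsGenericQuadruplePoint.exists_enumeration (e k).2
    exact ⟨y 0, hyp 0⟩
  choose x hx using hex
  refine ⟨x, fun k _ => ?_, fun k _ l _ hkl => ?_, fun p hp => ⟨e.symm ⟨p, hp⟩, mem_univ _, ?_⟩⟩
  · show i (x k) ∈ _
    rw [hx]; exact (e k).2
  · refine e.injective (Subtype.ext ?_)
    rw [← hx, ← hx]; exact hkl
  · simp [hx]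

/-- The extension of a q-invariant is well defined on `I`. -/
theorem IsQInvariant.exists_hasValue {f : GenericImm F → ZMod 2} (hf : IsQInvariant f)
    (hi : MemI n i) : ∃ v, HasValue f i v := by
  obtain ⟨x, hx⟩ := hi.exists_sheets
  choose v hv using fun k => exists_notMem_tangentPlane hi.1 (x k)
  obtain ⟨V, hV, -⟩ := hi.exists_isPushSystem hx hv (U := fun _ => univ) fun _ => univ_mem
  -- Comparing the system with itself, with second coordinate `0`, shows that all its small pushes
  -- are generic.
  obtain ⟨φ₀, h₀⟩ := hi.exists_matching hV hV
  obtain ⟨δ₀, hδ₀, hb₀⟩ := Metric.eventually_nhds_iff.1 h₀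
  have hnorm : ∀ a b δ : ℝ, 0 ≤ a → 0 ≤ b → a < δ → b < δ → dist ((a, b) : ℝ × ℝ) 0 < δ :=
    fun a b δ ha hb had hbd => by
      rw [dist_zero_right, Prod.norm_def, Real.norm_of_nonneg ha, Real.norm_of_nonneg hb]
      exact max_lt had hbd
  have hgen : ∀ ε, 0 < ε → ε < δ₀ → ∀ s, IsGenericImmersion (pushed i V ε s) := fun ε h1 h2 s => by
    rw [pushed_eq_perturb i V (pushField V (φ₀ s))]
    exact hb₀ (hnorm ε 0 δ₀ h1.le le_rfl h2 hδ₀) h1.le le_rfl (by simpa using h1) s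
  have hconst : ∀ ε ε' (h1 : 0 < ε) (h2 : ε < δ₀) (h1' : 0 < ε') (h2' : ε' < δ₀) (s),
      f ⟨pushed i V ε s, hgen ε h1 h2 s⟩ = f ⟨pushed i V ε' s, hgen ε' h1' h2' s⟩ := by
    intro ε ε' h1 h2 h1' h2' s
    refine hf.eq_of_affine _ _ fun t ht => ?_
    have e : (fun x => (1 - t) • pushed i V ε s x + t • pushed i V ε' s x) =
        pushed i V ((1 - t) * ε + t * ε') s := by
      funext x; simp only [pushed]; module
    rw [e]
    refine hgen _ ?_ ?_ s
    · rcases ht.1.eq_or_lt with h | h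
      · rw [← h]; simpa using h1
      · have := mul_pos h h1'
        have := mul_nonneg (sub_nonneg.2 ht.2) h1.le
        linarith
    · have a1 := mul_le_mul_of_nonneg_left (le_max_left ε ε') (sub_nonneg.2 ht.2)
      have a2 := mul_le_mul_of_nonneg_left (le_max_right ε ε') ht.1
      have := max_lt h2 h2'
      linarith
  have hδ2 : 0 < δ₀ / 2 := by positivity
  have hδ2' : δ₀ / 2 < δ₀ := by linarith
  refine ⟨∑ s, f ⟨pushed i V (δ₀ / 2) s, hgen _ hδ2 hδ2' s⟩, n, hi, ⟨x, V, hV⟩,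
    fun x' V' hV' => ?_⟩
  obtain ⟨φ, h⟩ := hi.exists_matching hV hV'
  obtain ⟨δ, hδ, hb⟩ := Metric.eventually_nhds_iff.1 h
  have hmem : Ioo 0 (min δ δ₀) ∈ 𝓝[>] (0 : ℝ) := Ioo_mem_nhdsGT (lt_min hδ hδ₀)
  filter_upwards [hmem] with ε hε
  have hε1 : ε < δ := hε.2.trans_le (min_le_left _ _)
  have hε2 : ε < δ₀ := hε.2.trans_le (min_le_right _ _)
  have hgen' : ∀ s, IsGenericImmersion (pushed i V' ε (φ s)) := fun s => by
    rw [pushed_eq_perturb' i V' (pushField V s)]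
    exact hb (hnorm 0 ε δ le_rfl hε.1.le hδ hε1) le_rfl hε.1.le (by simpa using hε.1) s
  have hgen'' : ∀ s, IsGenericImmersion (pushed i V' ε s) := fun s => by
    simpa using hgen' (φ.symm s)
  refine ⟨hgen'', ?_⟩
  rw [← φ.sum_comp]
  refine Finset.sum_congr rfl fun s _ => ?_
  rw [hconst (δ₀ / 2) ε hδ2 hδ2' hε.1 hε2]
  refine hf.eq_of_affine _ _ fun t ht => ?_
  -- The segment between two matched pushes consists of perturbations by nonnegative combinations of
  -- the two fields, with total size `ε`.
  have e : (fun x => (1 - t) • pushed i V' ε (φ s) x + t • pushed i V ε s x) =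
      perturb i (pushField V s) (pushField V' (φ s)) (t * ε, (1 - t) * ε) := by
    funext x; simp only [pushed, perturb, pushField]; module
  rw [e]
  have a1 : 0 ≤ t * ε := mul_nonneg ht.1 hε.1.le
  have a2 : 0 ≤ (1 - t) * ε := mul_nonneg (sub_nonneg.2 ht.2) hε.1.le
  refine hb (hnorm _ _ δ a1 a2 ?_ ?_) a1 a2 (by have := hε.1; simp only; linarith) s <;>
    nlinarith [ht.1, ht.2, hε.1]

end

section
/-! ### A smooth ramp function -/

/-- The density of the ramp function. -/
def rampDensity (t : ℝ) : ℝ := expNegInvGlue t * expNegInvGlue (1 - t)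

theorem contDiff_rampDensity : ContDiff ℝ ∞ rampDensity :=
  expNegInvGlue.contDiff.mul (expNegInvGlue.contDiff.comp (contDiff_const.sub contDiff_id))

theorem rampDensity_pos {t : ℝ} (h0 : 0 < t) (h1 : t < 1) : 0 < rampDensity t :=
  mul_pos (expNegInvGlue.pos_of_pos h0) (expNegInvGlue.pos_of_pos (by linarith))

theorem rampDensity_of_nonpos {t : ℝ} (h : t ≤ 0) : rampDensity t = 0 := by
  rw [rampDensity, expNegInvGlue.zero_of_nonpos h, zero_mul]

theorem rampDensity_of_one_le {t : ℝ} (h : 1 ≤ t) : rampDensity t = 0 := by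
  rw [rampDensity, expNegInvGlue.zero_of_nonpos (x := 1 - t) (by linarith), mul_zero]

/-- A smooth function that vanishes on the negative half line, equals `1` from `1` on, and is
strictly increasing in between. -/
def ramp (x : ℝ) : ℝ := (∫ t in (0 : ℝ)..x, rampDensity t) / ∫ t in (0 : ℝ)..1, rampDensity t

theorem rampMass_pos : 0 < ∫ t in (0 : ℝ)..1, rampDensity t :=
  intervalIntegral.intervalIntegral_pos_of_pos_on
    (contDiff_rampDensity.continuous.intervalIntegrable _ _)
    (fun _ ht => rampDensity_pos ht.1 ht.2) one_pos

theorem hasDerivAt_ramp (x : ℝ) :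
    HasDerivAt ramp (rampDensity x / ∫ t in (0 : ℝ)..1, rampDensity t) x :=
  (intervalIntegral.integral_hasDerivAt_right
    (contDiff_rampDensity.continuous.intervalIntegrable _ _)
    (contDiff_rampDensity.continuous.stronglyMeasurableAtFilter _ _)
    contDiff_rampDensity.continuous.continuousAt).div_const _

theorem contDiff_ramp : ContDiff ℝ ∞ ramp := by
  rw [contDiff_infty_iff_deriv]
  refine ⟨fun x => (hasDerivAt_ramp x).differentiableAt, ?_⟩
  rw [show deriv ramp = fun x => rampDensity x / ∫ t in (0 : ℝ)..1, rampDensity t from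
    funext fun x => (hasDerivAt_ramp x).deriv]
  exact contDiff_rampDensity.div_const _

theorem ramp_of_nonpos {x : ℝ} (hx : x ≤ 0) : ramp x = 0 := by
  rw [ramp, intervalIntegral.integral_congr (g := fun _ => (0 : ℝ)), intervalIntegral.integral_zero,
    zero_div]
  intro t ht
  rw [uIcc_of_ge hx] at ht
  exact rampDensity_of_nonpos ht.2

theorem ramp_of_one_le {x : ℝ} (hx : 1 ≤ x) : ramp x = 1 := by
  have h0 : ∫ t in (1 : ℝ)..x, rampDensity t = 0 := by
    rw [intervalIntegral.integral_congr (g := fun _ => (0 : ℝ)), intervalIntegral.integral_zero]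
    intro t ht
    rw [uIcc_of_le hx] at ht
    exact rampDensity_of_one_le ht.1
  rw [ramp, ← intervalIntegral.integral_add_adjacent_intervals
    (contDiff_rampDensity.continuous.intervalIntegrable 0 1)
    (contDiff_rampDensity.continuous.intervalIntegrable 1 x), h0, add_zero,
    div_self rampMass_pos.ne']

/-- This is why the ramp is the integral of a positive density: the angle must have nonzero
derivative whenever the rotating normal becomes orthogonal to one of the intersection lines. -/
theorem deriv_ramp_pos {x : ℝ} (h0 : 0 < x) (h1 : x < 1) : 0 < deriv ramp x := by
  rw [(hasDerivAt_ramp x).deriv]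
  exact div_pos (rampDensity_pos h0 h1) rampMass_pos

/-! ### Rotations -/

/-- The rotation by the angle `α` in the plane spanned by the orthonormal vectors `m₁`, `m₂`. -/
def rot (m₁ m₂ : E3) (α : ℝ) (y : E3) : E3 :=
  y + ((Real.cos α - 1) * inner ℝ m₁ y - Real.sin α * inner ℝ m₂ y) • m₁ +
    (Real.sin α * inner ℝ m₁ y + (Real.cos α - 1) * inner ℝ m₂ y) • m₂

theorem rot_zero (m₁ m₂ y : E3) : rot m₁ m₂ 0 y = y := by simp [rot]

theorem rot_smul (m₁ m₂ : E3) (α t : ℝ) (y : E3) : rot m₁ m₂ α (t • y) = t • rot m₁ m₂ α y := by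
  simp only [rot, real_inner_smul_right]; module

theorem rot_add_right (m₁ m₂ : E3) (α : ℝ) (y z : E3) :
    rot m₁ m₂ α (y + z) = rot m₁ m₂ α y + rot m₁ m₂ α z := by
  simp only [rot, inner_add_right]; module

theorem contDiff_rot (m₁ m₂ : E3) : ContDiff ℝ ∞ fun q : ℝ × E3 => rot m₁ m₂ q.1 q.2 := by
  unfold rot
  have hc : ContDiff ℝ ∞ fun q : ℝ × E3 => Real.cos q.1 := Real.contDiff_cos.comp contDiff_fst
  have hs : ContDiff ℝ ∞ fun q : ℝ × E3 => Real.sin q.1 := Real.contDiff_sin.comp contDiff_fst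
  have h₁ : ContDiff ℝ ∞ fun q : ℝ × E3 => (inner ℝ m₁ q.2 : ℝ) := contDiff_const.inner ℝ contDiff_snd
  have h₂ : ContDiff ℝ ∞ fun q : ℝ × E3 => (inner ℝ m₂ q.2 : ℝ) := contDiff_const.inner ℝ contDiff_snd
  exact (contDiff_snd.add ((((hc.sub contDiff_const).mul h₁).sub (hs.mul h₂)).smul
    contDiff_const)).add (((hs.mul h₁).add ((hc.sub contDiff_const).mul h₂)).smul contDiff_const)

/-- A pair of orthonormal vectors. -/
structure IsOrthonormalPair (m₁ m₂ : E3) : Prop where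
  norm_left : ‖m₁‖ = 1
  norm_right : ‖m₂‖ = 1
  inner_eq : inner ℝ m₁ m₂ = 0

namespace IsOrthonormalPair
variable {m₁ m₂ : E3} (h : IsOrthonormalPair m₁ m₂)
include h

theorem inner_left : inner ℝ m₁ m₁ = 1 := by rw [real_inner_self_eq_norm_sq, h.norm_left]; norm_num
theorem inner_right : inner ℝ m₂ m₂ = 1 := by rw [real_inner_self_eq_norm_sq, h.norm_right]; norm_num
theorem inner_eq' : inner ℝ m₂ m₁ = 0 := by rw [real_inner_comm]; exact h.inner_eq

theorem inner_left_rot (α : ℝ) (y : E3) :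
    inner ℝ m₁ (rot m₁ m₂ α y) = Real.cos α * inner ℝ m₁ y - Real.sin α * inner ℝ m₂ y := by
  simp only [rot, inner_add_right, real_inner_smul_right, h.inner_left, h.inner_eq]; ring

theorem inner_right_rot (α : ℝ) (y : E3) :
    inner ℝ m₂ (rot m₁ m₂ α y) = Real.sin α * inner ℝ m₁ y + Real.cos α * inner ℝ m₂ y := by
  simp only [rot, inner_add_right, real_inner_smul_right, h.inner_right, h.inner_eq']; ring

theorem rot_rot (α β : ℝ) (y : E3) :
    rot m₁ m₂ α (rot m₁ m₂ β y) = rot m₁ m₂ (α + β) y := by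
  rw [rot, h.inner_left_rot, h.inner_right_rot]
  simp only [rot, Real.cos_add, Real.sin_add]
  module

theorem rot_neg_rot (α : ℝ) (y : E3) : rot m₁ m₂ (-α) (rot m₁ m₂ α y) = y := by
  rw [h.rot_rot, neg_add_cancel, rot_zero]

theorem rot_rot_neg (α : ℝ) (y : E3) : rot m₁ m₂ α (rot m₁ m₂ (-α) y) = y := by
  rw [h.rot_rot, add_neg_cancel, rot_zero]

theorem inner_rot_left (α : ℝ) (y z : E3) :
    inner ℝ (rot m₁ m₂ α y) z = inner ℝ y (rot m₁ m₂ (-α) z) := by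
  simp only [rot, inner_add_left, inner_add_right, real_inner_smul_left, real_inner_smul_right,
    Real.cos_neg, Real.sin_neg, real_inner_comm m₁ y, real_inner_comm m₂ y]
  ring

theorem inner_rot_rot (α : ℝ) (y z : E3) :
    inner ℝ (rot m₁ m₂ α y) (rot m₁ m₂ α z) = inner ℝ y z := by
  rw [h.inner_rot_left, h.rot_neg_rot]

theorem norm_rot (α : ℝ) (y : E3) : ‖rot m₁ m₂ α y‖ = ‖y‖ := by
  rw [← sq_eq_sq₀ (norm_nonneg _) (norm_nonneg _), ← real_inner_self_eq_norm_sq, h.inner_rot_rot,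
    real_inner_self_eq_norm_sq]

theorem rot_left (α : ℝ) : rot m₁ m₂ α m₁ = Real.cos α • m₁ + Real.sin α • m₂ := by
  simp only [rot, h.inner_left, h.inner_eq']; module

theorem rot_right (α : ℝ) : rot m₁ m₂ α m₂ = Real.cos α • m₂ - Real.sin α • m₁ := by
  simp only [rot, h.inner_right, h.inner_eq]; module

theorem rot_of_orthogonal (α : ℝ) {y : E3} (h₁ : inner ℝ m₁ y = 0) (h₂ : inner ℝ m₂ y = 0) :
    rot m₁ m₂ α y = y := by
  simp [rot, h₁, h₂]

/-- A rotation as a linear isometry. -/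
def rotIsometry (α : ℝ) : E3 →ₗᵢ[ℝ] E3 where
  toFun := rot m₁ m₂ α
  map_add' := rot_add_right m₁ m₂ α
  map_smul' t y := rot_smul m₁ m₂ α t y
  norm_map' := h.norm_rot α

end IsOrthonormalPair

/-! ### Twists -/

/-- Parameters of a twist of 3-space: rotations in the plane of `m₁`, `m₂` that grow up to the angle
`θ`, in the course of time, starting from the origin. -/
structure Twist where
  m₁ : E3
  m₂ : E3
  pair : IsOrthonormalPair m₁ m₂
  θ : ℝ
  K : ℝ
  K_pos : 0 < K
  ρ : ℝ
  ρ_pos : 0 < ρ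

namespace Twist
variable (T : Twist)

/-- The phase of the twist at time `s` on the sphere of squared radius `t`. -/
def phase (s t : ℝ) : ℝ := T.K * (T.ρ * s - t)

/-- The angle of rotation as a function of the phase. -/
def angle (x : ℝ) : ℝ := T.θ * ramp x

/-- The twist at time `s`. -/
def map (s : ℝ) (y : E3) : E3 := rot T.m₁ T.m₂ (T.angle (T.phase s (‖y‖ ^ 2))) y

/-- The inverse of the twist at time `s`. -/
def inv (s : ℝ) (y : E3) : E3 := rot T.m₁ T.m₂ (-T.angle (T.phase s (‖y‖ ^ 2))) y

theorem norm_map (s : ℝ) (y : E3) : ‖T.map s y‖ = ‖y‖ := T.pair.norm_rot _ _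
theorem norm_inv (s : ℝ) (y : E3) : ‖T.inv s y‖ = ‖y‖ := T.pair.norm_rot _ _

theorem inv_map (s : ℝ) (y : E3) : T.inv s (T.map s y) = y := by
  rw [inv, norm_map]; exact T.pair.rot_neg_rot _ _

theorem map_inv (s : ℝ) (y : E3) : T.map s (T.inv s y) = y := by
  rw [map, norm_inv]; exact T.pair.rot_rot_neg _ _

theorem contDiff_angle : ContDiff ℝ ∞ T.angle := contDiff_const.mul contDiff_ramp

/-- The phase uses the squared radius in order to be smooth at the origin. -/
theorem contDiff_phase : ContDiff ℝ ∞ fun q : ℝ × E3 => T.phase q.1 (‖q.2‖ ^ 2) :=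
  contDiff_const.mul ((contDiff_const.mul contDiff_fst).sub (contDiff_snd.norm_sq ℝ))

theorem contDiff_map : ContDiff ℝ ∞ fun q : ℝ × E3 => T.map q.1 q.2 :=
  have h := (T.contDiff_angle.comp T.contDiff_phase).prodMk contDiff_snd
  have h2 := (contDiff_rot T.m₁ T.m₂).comp h
  h2

theorem contDiff_inv : ContDiff ℝ ∞ fun q : ℝ × E3 => T.inv q.1 q.2 :=
  have h := (T.contDiff_angle.comp T.contDiff_phase).neg.prodMk contDiff_snd
  have h2 := (contDiff_rot T.m₁ T.m₂).comp h
  h2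

theorem contDiff_map_right (s : ℝ) : ContDiff ℝ ∞ (T.map s) :=
  have h : ContDiff ℝ ∞ fun y : E3 => (s, y) := contDiff_prodMk_right s
  have h2 := T.contDiff_map.comp h
  h2

theorem contDiff_inv_right (s : ℝ) : ContDiff ℝ ∞ (T.inv s) :=
  have h : ContDiff ℝ ∞ fun y : E3 => (s, y) := contDiff_prodMk_right s
  have h2 := T.contDiff_inv.comp h
  h2

theorem map_of_le {s : ℝ} {y : E3} (h : T.ρ * s ≤ ‖y‖ ^ 2) : T.map s y = y := by
  have : T.phase s (‖y‖ ^ 2) ≤ 0 := mul_nonpos_of_nonneg_of_nonpos T.K_pos.le (by linarith)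
  rw [map, angle, ramp_of_nonpos this, mul_zero, rot_zero]

theorem map_of_one_le_phase {s : ℝ} {y : E3} (h : 1 ≤ T.phase s (‖y‖ ^ 2)) :
    T.map s y = rot T.m₁ T.m₂ T.θ y := by
  rw [map, angle, ramp_of_one_le h, mul_one]

theorem map_zero_time (y : E3) : T.map 0 y = y := T.map_of_le (by simp)

/-- The twist has a smooth inverse, because it preserves the norm, on which its angle depends. -/
theorem fderiv_map_injective (s : ℝ) (y : E3) : Function.Injective (fderiv ℝ (T.map s) y) := by
  have h1 : HasFDerivAt (T.map s) (fderiv ℝ (T.map s) y) y :=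
    ((T.contDiff_map_right s).differentiable (by simp) y).hasFDerivAt
  have h2 : HasFDerivAt (T.inv s) (fderiv ℝ (T.inv s) (T.map s y)) (T.map s y) :=
    ((T.contDiff_inv_right s).differentiable (by simp) _).hasFDerivAt
  have h3 := h2.comp y h1
  have h4 : T.inv s ∘ T.map s = id := funext (T.inv_map s)
  rw [h4] at h3
  have h5 := h3.unique (hasFDerivAt_id y)
  intro a b hab
  have := congrArg (fun L : E3 →L[ℝ] E3 => L a) h5
  have h6 := congrArg (fun L : E3 →L[ℝ] E3 => L b) h5
  simp only [ContinuousLinearMap.comp_apply, hab] at this h6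
  rw [h6] at this
  simpa using this.symm

end Twist

end

section
/-! ### Isometric planes -/

/-- The orthogonal projection onto the plane parametrized by `A`, in this parametrization. -/
def planeProj (A : E2 →ₗᵢ[ℝ] E3) : E3 →L[ℝ] E2 :=
  ContinuousLinearMap.adjoint A.toContinuousLinearMap

theorem planeProj_apply (A : E2 →ₗᵢ[ℝ] E3) (u : E2) : planeProj A (A u) = u := by
  refine ext_inner_right ℝ fun v => ?_
  have := ContinuousLinearMap.adjoint_inner_left A.toContinuousLinearMap v (A u)
  rw [planeProj, this]
  exact A.inner_map_map u v

/-- The data of a unit normal to the plane parametrized by `A`. -/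
structure IsUnitNormal (A : E2 →ₗᵢ[ℝ] E3) (n : E3) : Prop where
  norm_eq : ‖n‖ = 1
  inner_eq : ∀ u, inner ℝ n (A u) = 0

theorem finrank_range_linearIsometry (A : E2 →ₗᵢ[ℝ] E3) :
    Module.finrank ℝ (LinearMap.range A.toLinearMap) = 2 := by
  rw [LinearMap.finrank_range_of_inj A.injective]; simp

namespace IsUnitNormal
variable {A : E2 →ₗᵢ[ℝ] E3} {n : E3} (hn : IsUnitNormal A n)
include hn

theorem inner_self : inner ℝ n n = 1 := by rw [real_inner_self_eq_norm_sq, hn.norm_eq]; norm_num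

theorem ne_zero : n ≠ 0 := fun h => by simpa [h] using hn.norm_eq

theorem planeProj_normal : planeProj A n = 0 := by
  refine ext_inner_right ℝ fun v => ?_
  have := ContinuousLinearMap.adjoint_inner_left A.toContinuousLinearMap v n
  rw [planeProj, this, inner_zero_left]
  exact hn.inner_eq v

theorem mem_range_iff {y : E3} : y ∈ LinearMap.range A.toLinearMap ↔ inner ℝ n y = 0 :=
  mem_plane_iff (finrank_range_linearIsometry A) hn.ne_zero (by
    rintro _ ⟨u, rfl⟩; exact hn.inner_eq u)

theorem decompose (y : E3) : A (planeProj A y) + (inner ℝ n y : ℝ) • n = y := by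
  have h : y - (inner ℝ n y : ℝ) • n ∈ LinearMap.range A.toLinearMap := by
    rw [hn.mem_range_iff, inner_sub_right, real_inner_smul_right, hn.inner_self, mul_one, sub_self]
  obtain ⟨u, hu⟩ := h
  have hu' : A u = y - (inner ℝ n y : ℝ) • n := hu
  have h2 : planeProj A y = u := by
    have := congrArg (planeProj A) hu'
    rw [planeProj_apply, map_sub, map_smul, hn.planeProj_normal, smul_zero, sub_zero] at this
    exact this.symm
  rw [h2, hu', sub_add_cancel]

theorem norm_sq_decompose (u : E2) (t : ℝ) : ‖A u + t • n‖ ^ 2 = ‖u‖ ^ 2 + t ^ 2 := by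
  rw [norm_add_sq_real, A.norm_map, norm_smul, hn.norm_eq, real_inner_smul_right,
    real_inner_comm, hn.inner_eq]
  simp

theorem norm_planeProj_le (y : E3) : ‖planeProj A y‖ ^ 2 ≤ ‖y‖ ^ 2 := by
  conv_rhs => rw [← hn.decompose y]
  rw [hn.norm_sq_decompose]
  nlinarith [sq_nonneg (inner ℝ n y : ℝ)]

end IsUnitNormal

/-! ### A pushed plane -/

/-- A cutoff function: `1` where `C * t ≤ 1` and `0` where `C * t ≥ 2`. -/
def cut (C t : ℝ) : ℝ := Real.smoothTransition (2 - C * t)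

theorem cut_of_le {C t : ℝ} (h : C * t ≤ 1) : cut C t = 1 :=
  Real.smoothTransition.one_of_one_le (by linarith)

theorem cut_of_ge {C t : ℝ} (h : 2 ≤ C * t) : cut C t = 0 :=
  Real.smoothTransition.zero_of_nonpos (by linarith)

theorem contDiff_cut (C : ℝ) : ContDiff ℝ ∞ (cut C) :=
  Real.smoothTransition.contDiff.comp (contDiff_const.sub (contDiff_const.mul contDiff_id))

theorem cut_nonneg (C t : ℝ) : 0 ≤ cut C t := Real.smoothTransition.nonneg _
theorem cut_le_one (C t : ℝ) : cut C t ≤ 1 := Real.smoothTransition.le_one _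

/-- The plane parametrized by `A`, pushed off the origin in the direction `n`. -/
def pushedPlane (A : E2 →ₗᵢ[ℝ] E3) (n : E3) (C ε : ℝ) (u : E2) : E3 :=
  A u + (ε * cut C (‖u‖ ^ 2)) • n

/-- A defining function of the twisted pushed plane. -/
def level (T : Twist) (A : E2 →ₗᵢ[ℝ] E3) (n : E3) (C ε s : ℝ) (y : E3) : ℝ :=
  inner ℝ n (T.inv s y) - ε * cut C (‖planeProj A (T.inv s y)‖ ^ 2)

section Level
variable (T : Twist) {A : E2 →ₗᵢ[ℝ] E3} {n : E3} (hn : IsUnitNormal A n) (C : ℝ)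

theorem planeProj_pushedPlane (hn : IsUnitNormal A n) (ε : ℝ) (u : E2) :
    planeProj A (pushedPlane A n C ε u) = u := by
  rw [pushedPlane, map_add, map_smul, planeProj_apply, hn.planeProj_normal, smul_zero, add_zero]

theorem level_map_pushedPlane (hn : IsUnitNormal A n) (ε s : ℝ) (u : E2) :
    level T A n C ε s (T.map s (pushedPlane A n C ε u)) = 0 := by
  rw [level, T.inv_map, planeProj_pushedPlane C hn]
  rw [pushedPlane, inner_add_right, hn.inner_eq, real_inner_smul_right, hn.inner_self]
  ring

theorem map_pushedPlane_of_level (hn : IsUnitNormal A n) {ε s : ℝ} {y : E3}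
    (h : level T A n C ε s y = 0) :
    T.map s (pushedPlane A n C ε (planeProj A (T.inv s y))) = y := by
  have : pushedPlane A n C ε (planeProj A (T.inv s y)) = T.inv s y := by
    rw [pushedPlane, ← sub_eq_zero.1 h, hn.decompose]
  rw [this, T.map_inv]

theorem contDiff_level (A : E2 →ₗᵢ[ℝ] E3) (n : E3) :
    ContDiff ℝ ∞ fun q : ℝ × ℝ × E3 => level T A n C q.1 q.2.1 q.2.2 := by
  have h1 : ContDiff ℝ ∞ fun q : ℝ × ℝ × E3 => T.inv q.2.1 q.2.2 := T.contDiff_inv.comp contDiff_snd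
  have h2 : ContDiff ℝ ∞ fun q : ℝ × ℝ × E3 => (inner ℝ n (T.inv q.2.1 q.2.2) : ℝ) :=
    contDiff_const.inner ℝ h1
  have h3 : ContDiff ℝ ∞ fun q : ℝ × ℝ × E3 => planeProj A (T.inv q.2.1 q.2.2) :=
    (planeProj A).contDiff.comp h1
  exact h2.sub (contDiff_fst.mul ((contDiff_cut C).comp (h3.norm_sq ℝ)))

theorem contDiff_level_right (A : E2 →ₗᵢ[ℝ] E3) (n : E3) (ε s : ℝ) :
    ContDiff ℝ ∞ (level T A n C ε s) := by
  have h : ContDiff ℝ ∞ fun y : E3 => (ε, s, y) :=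
    contDiff_const.prodMk (contDiff_const.prodMk contDiff_id)
  have h2 := (contDiff_level T C A n).comp h
  exact h2

theorem continuous_level (A : E2 →ₗᵢ[ℝ] E3) (n : E3) :
    Continuous fun q : ℝ × ℝ × E3 => level T A n C q.1 q.2.1 q.2.2 :=
  (contDiff_level T C A n).continuous

theorem continuous_fderiv_level (A : E2 →ₗᵢ[ℝ] E3) (n : E3) :
    Continuous fun q : ℝ × ℝ × E3 => fderiv ℝ (level T A n C q.1 q.2.1) q.2.2 := by
  have h : ContDiff ℝ ∞ (Function.uncurry fun (q : ℝ × ℝ × E3) (y : E3) =>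
      level T A n C q.1 q.2.1 y) := by
    have h1 : ContDiff ℝ ∞ fun z : (ℝ × ℝ × E3) × E3 => (z.1.1, z.1.2.1, z.2) :=
      (contDiff_fst.comp contDiff_fst).prodMk
        ((contDiff_fst.comp (contDiff_snd.comp contDiff_fst)).prodMk contDiff_snd)
    have h3 := (contDiff_level T C A n).comp h1
    exact h3
  have h2 : ContDiff ℝ 0 fun q : ℝ × ℝ × E3 => q.2.2 := contDiff_snd.comp contDiff_snd
  exact (ContDiff.fderiv (n := 0) (m := ∞) h h2 (by norm_num)).continuous

/-- The normal of the twisted plane, as a function of the phase. -/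
def Twist.normal (n : E3) (x : ℝ) : E3 := rot T.m₁ T.m₂ (T.angle x) n

theorem level_zero (s : ℝ) (y : E3) :
    level T A n C 0 s y = inner ℝ (T.normal n (T.phase s (‖y‖ ^ 2))) y := by
  rw [level, zero_mul, sub_zero, Twist.normal, T.pair.inner_rot_left, Twist.inv]

/-- Neither the inverse twist nor the projection increases norms, so the cutoff equals `1` here and
the push is a mere translation. -/
theorem level_of_lt (hn : IsUnitNormal A n) (hC : 0 < C) {ε s : ℝ} {y : E3}
    (hy : C * ‖y‖ ^ 2 ≤ 1) : level T A n C ε s y = level T A n C 0 s y - ε := by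
  have h : C * ‖planeProj A (T.inv s y)‖ ^ 2 ≤ 1 := by
    refine le_trans ?_ hy
    have := hn.norm_planeProj_le (T.inv s y)
    rw [T.norm_inv] at this
    gcongr
  simp only [level, cut_of_le h]
  ring

theorem contDiff_inner_normal (n e : E3) : ContDiff ℝ ∞ fun x => (inner ℝ (T.normal n x) e : ℝ) := by
  have h : ContDiff ℝ ∞ fun x : ℝ => (T.angle x, n) := T.contDiff_angle.prodMk contDiff_const
  have h1 : ContDiff ℝ ∞ fun x : ℝ => T.normal n x := (contDiff_rot T.m₁ T.m₂).comp h
  exact h1.inner ℝ contDiff_const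

theorem norm_normal (hn : ‖n‖ = 1) (x : ℝ) : ‖T.normal n x‖ = 1 := by
  rw [Twist.normal, T.pair.norm_rot, hn]

/-- In a direction orthogonal to `p` the squared radius is stationary, hence so is the angle of the
twist. To first order the twist acts there as a fixed rotation. -/
theorem fderiv_level_zero_tangential (A : E2 →ₗᵢ[ℝ] E3) (n : E3) (s : ℝ) {p v : E3}
    (hpv : inner ℝ p v = 0) :
    fderiv ℝ (level T A n C 0 s) p v = inner ℝ (T.normal n (T.phase s (‖p‖ ^ 2))) v := by
  have hline : HasDerivAt (fun t : ℝ => p + t • v) v 0 := by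
    simpa using ((hasDerivAt_id (0 : ℝ)).smul_const v).const_add p
  have hd : HasFDerivAt (level T A n C 0 s) (fderiv ℝ (level T A n C 0 s) p) (p + (0 : ℝ) • v) := by
    rw [zero_smul, add_zero]
    exact ((contDiff_level_right T C A n 0 s).differentiable (by simp) p).hasFDerivAt
  have h1 := hd.comp_hasDerivAt (0 : ℝ) hline
  have hn2 : ∀ t : ℝ, ‖p + t • v‖ ^ 2 = ‖p‖ ^ 2 + t ^ 2 * ‖v‖ ^ 2 := fun t => by
    rw [norm_add_sq_real, real_inner_smul_right, hpv, norm_smul, mul_pow, Real.norm_eq_abs, sq_abs]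
    ring
  have hx : HasDerivAt (fun t : ℝ => T.phase s (‖p‖ ^ 2 + t ^ 2 * ‖v‖ ^ 2)) 0 0 := by
    have : HasDerivAt (fun t : ℝ => T.K * (T.ρ * s - (‖p‖ ^ 2 + t ^ 2 * ‖v‖ ^ 2)))
        (T.K * (-(((2 : ℕ) : ℝ) * (0 : ℝ) ^ (2 - 1) * ‖v‖ ^ 2))) 0 :=
      ((((hasDerivAt_pow 2 (0 : ℝ)).mul_const _).const_add _).const_sub _).const_mul _
    simpa [Twist.phase] using this
  have hcomp : ∀ w : E3, HasDerivAt (fun t : ℝ =>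
      (inner ℝ (T.normal n (T.phase s (‖p‖ ^ 2 + t ^ 2 * ‖v‖ ^ 2))) w : ℝ)) 0 0 := fun w => by
    have hd := ((contDiff_inner_normal T n w).differentiable (by simp)
      (T.phase s (‖p‖ ^ 2 + (0 : ℝ) ^ 2 * ‖v‖ ^ 2))).hasDerivAt
    have := hd.comp (0 : ℝ) hx
    simpa [Function.comp_def] using this
  have h2 : HasDerivAt (fun t : ℝ => level T A n C 0 s (p + t • v))
      (inner ℝ (T.normal n (T.phase s (‖p‖ ^ 2))) v) 0 := by
    have e : (fun t : ℝ => level T A n C 0 s (p + t • v)) = fun t : ℝ =>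
        (inner ℝ (T.normal n (T.phase s (‖p‖ ^ 2 + t ^ 2 * ‖v‖ ^ 2))) p : ℝ) +
        t * (inner ℝ (T.normal n (T.phase s (‖p‖ ^ 2 + t ^ 2 * ‖v‖ ^ 2))) v : ℝ) := by
      funext t
      rw [level_zero, hn2, inner_add_right, real_inner_smul_right]
    rw [e]
    have := (hcomp p).fun_add ((hasDerivAt_id (0 : ℝ)).fun_mul (hcomp v))
    simpa using this
  exact h1.unique h2

/-- Under small pushes, the twisted plane stays transverse to a plane that its linear normals never
are normal to. -/
theorem eventually_transverse (A : E2 →ₗᵢ[ℝ] E3) (n : E3) {m : E3} (hm : ‖m‖ = 1)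
    (hN : ‖n‖ = 1) (hP : ∀ x, (inner ℝ (T.normal n x) m : ℝ) ^ 2 ≠ 1) (R : ℝ) :
    ∀ᶠ ε in 𝓝 (0 : ℝ), ∀ z ∈ Icc (0 : ℝ) 1 ×ˢ Metric.closedBall (0 : E3) R,
      level T A n C ε z.1 z.2 = 0 → (inner ℝ m z.2 : ℝ) = 0 →
      ∃ v, (inner ℝ m v : ℝ) = 0 ∧ fderiv ℝ (level T A n C ε z.1) z.2 v ≠ 0 := by
  refine (isCompact_Icc.prod (isCompact_closedBall _ _)).eventually_forall_of_forall_eventually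
    fun z _ => ?_
  obtain ⟨s, p⟩ := z
  have hc := (continuous_level T C A n).tendsto (0, s, p)
  by_cases h0 : level T A n C 0 s p = 0
  swap
  · filter_upwards [hc.eventually_ne h0] with w hw h
    exact absurd h hw
  by_cases h1 : (inner ℝ m p : ℝ) = 0
  swap
  · have : Continuous fun w : ℝ × ℝ × E3 => (inner ℝ m w.2.2 : ℝ) := by fun_prop
    filter_upwards [(this.tendsto (0, s, p)).eventually_ne h1] with w hw _ h
    exact absurd h hw
  set N := T.normal n (T.phase s (‖p‖ ^ 2)) with hNdef
  have hNN : (inner ℝ N N : ℝ) = 1 := by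
    rw [real_inner_self_eq_norm_sq, norm_normal T hN]; norm_num
  have hmm : (inner ℝ m m : ℝ) = 1 := by rw [real_inner_self_eq_norm_sq, hm]; norm_num
  have hNp : (inner ℝ N p : ℝ) = 0 := by rw [← h0, level_zero]
  -- Both `N` and `m` are orthogonal to `p`, so `v` is tangential, and the derivative along it is `1
  -- - ⟪N, m⟫ ^ 2`, which is nonzero by `hP`.
  let v := N - (inner ℝ N m : ℝ) • m
  have hmv : (inner ℝ m v : ℝ) = 0 := by
    simp only [v, inner_sub_right, real_inner_smul_right, hmm, real_inner_comm N m]; ring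
  have hpv : (inner ℝ p v : ℝ) = 0 := by
    simp only [v, inner_sub_right, real_inner_smul_right, real_inner_comm N p,
      real_inner_comm m p, hNp, h1]; ring
  have hd : fderiv ℝ (level T A n C 0 s) p v ≠ 0 := by
    rw [fderiv_level_zero_tangential T C A n s hpv, ← hNdef]
    simp only [v, inner_sub_right, real_inner_smul_right, hNN]
    intro h
    refine hP (T.phase s (‖p‖ ^ 2)) ?_
    rw [← hNdef]; linarith
  have hcd : Continuous fun q : ℝ × ℝ × E3 => fderiv ℝ (level T A n C q.1 q.2.1) q.2.2 v :=
    (continuous_fderiv_level T C A n).clm_apply continuous_const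
  filter_upwards [(hcd.tendsto (0, s, p)).eventually_ne hd] with w hw _ _
  exact ⟨v, hmv, hw⟩

end Level

end

section
/-! ### The twisted plane along a line -/

theorem hasDerivAt_comp_line {g : E3 → ℝ} (hg : ContDiff ℝ ∞ g) (e : E3) (z : ℝ) :
    HasDerivAt (fun z : ℝ => g (z • e)) (fderiv ℝ g (z • e) e) z := by
  have hline : HasDerivAt (fun t : ℝ => t • e) e z := by
    simpa using (hasDerivAt_id z).smul_const e
  exact (hg.differentiable (by simp) (z • e)).hasFDerivAt.comp_hasDerivAt z hline

theorem hasDerivAt_fderiv_comp_line {g : E3 → ℝ} (hg : ContDiff ℝ ∞ g) (e : E3) (z : ℝ) :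
    HasDerivAt (fun z : ℝ => fderiv ℝ g (z • e) e) (fderiv ℝ (fderiv ℝ g) (z • e) e e) z := by
  have hline : HasDerivAt (fun t : ℝ => t • e) e z := by
    simpa using (hasDerivAt_id z).smul_const e
  have hg' : ContDiff ℝ ∞ (fderiv ℝ g) := hg.fderiv_right (by norm_num)
  have h1 := (hg'.differentiable (by simp) (z • e)).hasFDerivAt.comp_hasDerivAt z hline
  have h2 := h1.clm_apply (hasDerivAt_const z e)
  simpa using h2

section Line
variable (T : Twist) {A : E2 →ₗᵢ[ℝ] E3} {n : E3} (C : ℝ) {e : E3}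

/-- The height of the twisted normal over the direction `e`. -/
def Twist.height (n e : E3) (x : ℝ) : ℝ := inner ℝ (T.normal n x) e

theorem contDiff_height (n e : E3) : ContDiff ℝ ∞ (T.height n e) := contDiff_inner_normal T n e

theorem hasDerivAt_height (n e : E3) (x : ℝ) :
    HasDerivAt (T.height n e) (deriv (T.height n e) x) x :=
  ((contDiff_height T n e).differentiable (by simp) x).hasDerivAt

theorem contDiff_deriv_height (n e : E3) : ContDiff ℝ ∞ (deriv (T.height n e)) :=
  (contDiff_infty_iff_deriv.1 (contDiff_height T n e)).2

theorem hasDerivAt_deriv_height (n e : E3) (x : ℝ) :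
    HasDerivAt (deriv (T.height n e)) (deriv (deriv (T.height n e)) x) x :=
  ((contDiff_deriv_height T n e).differentiable (by simp) x).hasDerivAt

/-- On the line the squared radius is `z ^ 2`, and the twisted normal enters only through its height
over `e`. -/
theorem level_line (he : ‖e‖ = 1) (s z : ℝ) :
    level T A n C 0 s (z • e) = z * T.height n e (T.phase s (z ^ 2)) := by
  rw [level_zero, real_inner_smul_right, norm_smul, he, mul_one, Real.norm_eq_abs, sq_abs,
    Twist.height]

theorem hasDerivAt_phase (s z : ℝ) :
    HasDerivAt (fun z : ℝ => T.phase s (z ^ 2)) (-(2 * T.K * z)) z := by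
  have : HasDerivAt (fun z : ℝ => T.K * (T.ρ * s - z ^ 2))
      (T.K * (-(((2 : ℕ) : ℝ) * z ^ (2 - 1)))) z :=
    ((hasDerivAt_pow 2 z).const_sub _).const_mul _
  refine this.congr_deriv ?_
  push_cast
  ring

/-- The derivative of the level function along the line. -/
def Twist.slope (n e : E3) (s z : ℝ) : ℝ :=
  T.height n e (T.phase s (z ^ 2)) - 2 * T.K * z ^ 2 * deriv (T.height n e) (T.phase s (z ^ 2))

theorem fderiv_level_line (he : ‖e‖ = 1) (s z : ℝ) :
    fderiv ℝ (level T A n C 0 s) (z • e) e = T.slope n e s z := by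
  have h1 := hasDerivAt_comp_line (contDiff_level_right T C A n 0 s) e z
  have h2 : HasDerivAt (fun z : ℝ => level T A n C 0 s (z • e)) (T.slope n e s z) z := by
    simp only [level_line T C he]
    have := (hasDerivAt_id z).fun_mul ((hasDerivAt_height T n e (T.phase s (z ^ 2))).comp z
      (hasDerivAt_phase T s z))
    refine this.congr_deriv ?_
    simp only [Twist.slope, Function.comp, id]
    ring
  exact h1.unique h2

/-- The factor that governs the second derivative of the level function along the line. -/
def Twist.bend (n e : E3) (s z : ℝ) : ℝ :=
  3 * deriv (T.height n e) (T.phase s (z ^ 2)) -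
    2 * T.K * z ^ 2 * deriv (deriv (T.height n e)) (T.phase s (z ^ 2))

theorem hasDerivAt_slope (n e : E3) (s z : ℝ) :
    HasDerivAt (T.slope n e s) (-(2 * T.K * z) * T.bend n e s z) z := by
  have h1 := (hasDerivAt_height T n e (T.phase s (z ^ 2))).comp z (hasDerivAt_phase T s z)
  have h2 := (hasDerivAt_deriv_height T n e (T.phase s (z ^ 2))).comp z (hasDerivAt_phase T s z)
  have h3 := h1.fun_sub (((hasDerivAt_pow 2 z).const_mul (2 * T.K)).fun_mul h2)
  refine h3.congr_deriv ?_
  simp only [Twist.bend, Function.comp]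
  push_cast
  ring

theorem continuous_bend (n e : E3) : Continuous fun q : ℝ × ℝ => T.bend n e q.1 q.2 := by
  have h2 := (contDiff_deriv_height T n e).continuous
  have h3 : Continuous (deriv (deriv (T.height n e))) :=
    (contDiff_infty_iff_deriv.1 (contDiff_deriv_height T n e)).2.continuous
  unfold Twist.bend Twist.phase
  fun_prop

/-- Near the origin the push only subtracts the constant `ε`, which drops out of all derivatives. -/
theorem fderiv_level_line_of_lt (hn : IsUnitNormal A n) (hC : 0 < C) (he : ‖e‖ = 1) {ε s z : ℝ}
    (hz : C * z ^ 2 < 1) : fderiv ℝ (level T A n C ε s) (z • e) e = T.slope n e s z := by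
  rw [← fderiv_level_line T C he]
  have hev : level T A n C ε s =ᶠ[𝓝 (z • e)] fun y => level T A n C 0 s y - ε := by
    have hc : Continuous fun y : E3 => C * ‖y‖ ^ 2 := by fun_prop
    have : ∀ᶠ y in 𝓝 (z • e), C * ‖y‖ ^ 2 < 1 := hc.continuousAt.eventually (gt_mem_nhds (by
      show C * ‖z • e‖ ^ 2 < 1
      rw [norm_smul, he, mul_one, Real.norm_eq_abs, sq_abs]; exact hz))
    filter_upwards [this] with y hy
    exact level_of_lt T C hn hC hy.le
  rw [hev.fderiv_eq, fderiv_sub_const]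

theorem fderiv_fderiv_level_line_of_lt (hn : IsUnitNormal A n) (hC : 0 < C) (he : ‖e‖ = 1)
    {ε s z : ℝ} (hz : C * z ^ 2 < 1) :
    fderiv ℝ (fderiv ℝ (level T A n C ε s)) (z • e) e e = -(2 * T.K * z) * T.bend n e s z := by
  have h1 := hasDerivAt_fderiv_comp_line (contDiff_level_right T C A n ε s) e z
  have hc : Continuous fun z : ℝ => C * z ^ 2 := by fun_prop
  have hev : (fun z : ℝ => fderiv ℝ (level T A n C ε s) (z • e) e) =ᶠ[𝓝 z] T.slope n e s := by
    filter_upwards [hc.continuousAt.eventually (gt_mem_nhds hz)] with w hw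
    exact fderiv_level_line_of_lt T C hn hC he hw
  exact (h1.congr_of_eventuallyEq hev.symm).unique (hasDerivAt_slope T n e s z)

theorem level_line_of_lt (hn : IsUnitNormal A n) (hC : 0 < C) (he : ‖e‖ = 1) {ε s z : ℝ}
    (hz : C * z ^ 2 < 1) : level T A n C ε s (z • e) = z * T.height n e (T.phase s (z ^ 2)) - ε := by
  rw [level_of_lt T C hn hC, level_line T C he]
  rw [norm_smul, he, mul_one, Real.norm_eq_abs, sq_abs]; exact hz.le

theorem deriv_level_line_of_lt (hn : IsUnitNormal A n) (hC : 0 < C) (he : ‖e‖ = 1) {ε s z : ℝ}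
    (hz : C * z ^ 2 < 1) : deriv (fun s => level T A n C ε s (z • e)) s =
      T.K * T.ρ * z * deriv (T.height n e) (T.phase s (z ^ 2)) := by
  simp only [level_line_of_lt T C hn hC he hz]
  have hp : HasDerivAt (fun s : ℝ => T.phase s (z ^ 2)) (T.K * T.ρ) s := by
    have : HasDerivAt (fun s : ℝ => T.K * (T.ρ * s - z ^ 2)) (T.K * (T.ρ * 1)) s :=
      (((hasDerivAt_id s).const_mul _).sub_const _).const_mul _
    simpa [Twist.phase] using this
  have := (((hasDerivAt_height T n e (T.phase s (z ^ 2))).comp s hp).const_mul z).sub_const ε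
  rw [show (fun s => z * T.height n e (T.phase s (z ^ 2)) - ε) = fun s =>
    z * (T.height n e ∘ fun s => T.phase s (z ^ 2)) s - ε from rfl, this.deriv]
  ring

/-- The twisted pushed plane is tangent to the line spanned by `e` at the point with coordinate
`z`. -/
def IsLineTangency (A : E2 →ₗᵢ[ℝ] E3) (n e : E3) (ε s z : ℝ) : Prop :=
  level T A n C ε s (z • e) = 0 ∧ fderiv ℝ (level T A n C ε s) (z • e) e = 0

/-- Tangencies of the slightly pushed plane with the line are near the origin, and near the times
at which the twisted plane contains the line. -/
theorem eventually_not_isLineTangency (he : ‖e‖ = 1)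
    (hs : ∀ x, T.height n e x = 0 → deriv (T.height n e) x ≠ 0) {s z : ℝ}
    (hsz : ¬ (z = 0 ∧ T.height n e (T.phase s 0) = 0)) :
    ∀ᶠ w : ℝ × ℝ × ℝ in 𝓝 (0, s, z), ¬ IsLineTangency T C A n e w.1 w.2.1 w.2.2 := by
  have hcl : Continuous fun w : ℝ × ℝ × ℝ => (w.1, w.2.1, w.2.2 • e) := by fun_prop
  have hc1 := (continuous_level T C A n).comp hcl
  have hc2 := ((continuous_fderiv_level T C A n).comp hcl).clm_apply (continuous_const (y := e))
  by_cases h1 : level T A n C 0 s (z • e) = 0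
  swap
  · filter_upwards [(hc1.tendsto (0, s, z)).eventually_ne h1] with w hw h
    exact hw h.1
  by_cases h2 : fderiv ℝ (level T A n C 0 s) (z • e) e = 0
  swap
  · filter_upwards [(hc2.tendsto (0, s, z)).eventually_ne h2] with w hw h
    exact hw h.2
  -- For `ε = 0` a tangency means `z * h = 0` and `h = 2 * K * z ^ 2 * h'`; as zeros of `h` are
  -- simple, this forces `z = 0` and `h = 0`.
  exfalso
  rw [level_line T C he] at h1
  rw [fderiv_level_line T C he, Twist.slope] at h2
  have hz : z = 0 := by
    by_contra hz
    have h3 := (mul_eq_zero.1 h1).resolve_left hz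
    rw [h3, zero_sub, neg_eq_zero] at h2
    have := mul_ne_zero (mul_ne_zero (mul_ne_zero two_ne_zero T.K_pos.ne') (pow_ne_zero 2 hz))
      (hs _ h3)
    exact this h2
  subst hz
  refine hsz ⟨rfl, ?_⟩
  simpa using h2

/-- The sign conditions that hold near an instant at which the twisted plane contains the line. -/
theorem eventually_line_signs
    {s : ℝ} (hd : deriv (T.height n e) (T.phase s 0) ≠ 0) :
    ∃ δ > 0, ∀ s' z, |s' - s| < δ → |z| < δ → C * z ^ 2 < 1 ∧
      0 < deriv (T.height n e) (T.phase s 0) * deriv (T.height n e) (T.phase s' (z ^ 2)) ∧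
      T.bend n e s' z ≠ 0 := by
  have hc1 : Continuous fun w : ℝ × ℝ => C * w.2 ^ 2 := by fun_prop
  have hc2 : Continuous fun w : ℝ × ℝ =>
      deriv (T.height n e) (T.phase s 0) * deriv (T.height n e) (T.phase w.1 (w.2 ^ 2)) := by
    have h2 := (contDiff_deriv_height T n e).continuous
    unfold Twist.phase
    fun_prop
  have e1 : ∀ᶠ w : ℝ × ℝ in 𝓝 (s, 0), C * w.2 ^ 2 < 1 :=
    hc1.continuousAt.eventually (gt_mem_nhds (by simp))
  have e2 : ∀ᶠ w : ℝ × ℝ in 𝓝 (s, 0),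
      0 < deriv (T.height n e) (T.phase s 0) * deriv (T.height n e) (T.phase w.1 (w.2 ^ 2)) :=
    hc2.continuousAt.eventually (lt_mem_nhds (by
      simpa using mul_self_pos.2 hd))
  -- At `z = 0` the bend is three times the derivative of the height.
  have e3 : ∀ᶠ w : ℝ × ℝ in 𝓝 (s, 0), T.bend n e w.1 w.2 ≠ 0 :=
    ((continuous_bend T n e).tendsto (s, 0)).eventually_ne (by
      simpa [Twist.bend] using hd)
  obtain ⟨δ, hδ, h⟩ := Metric.eventually_nhds_iff.1 (e1.and (e2.and e3))
  refine ⟨δ, hδ, fun s' z h1 h2 => h (y := (s', z)) ?_⟩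
  rw [Prod.dist_eq, Real.dist_eq, Real.dist_eq, sub_zero]
  exact max_lt h1 h2

/-- By compactness it suffices to look near the origin and near a zero of the height `h`. There `z *
h = ε ≠ 0` gives `z ≠ 0`, so the speed `K * ρ * z * h'` and the second derivative `-2 * K * z *
bend` do not vanish. -/
theorem eventually_isLineTangency_nondegenerate (hn : IsUnitNormal A n) (hC : 0 < C) (he : ‖e‖ = 1)
    (hs : ∀ x, T.height n e x = 0 → deriv (T.height n e) x ≠ 0) (R : ℝ) :
    ∀ᶠ ε in 𝓝 (0 : ℝ), ∀ w ∈ Icc (0 : ℝ) 1 ×ˢ Icc (-R) R, ε ≠ 0 →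
      IsLineTangency T C A n e ε w.1 w.2 →
      deriv (fun s => level T A n C ε s (w.2 • e)) w.1 ≠ 0 ∧
      fderiv ℝ (fderiv ℝ (level T A n C ε w.1)) (w.2 • e) e e ≠ 0 := by
  refine (isCompact_Icc.prod isCompact_Icc).eventually_forall_of_forall_eventually fun w _ => ?_
  obtain ⟨s, z⟩ := w
  by_cases hsz : z = 0 ∧ T.height n e (T.phase s 0) = 0
  swap
  · filter_upwards [eventually_not_isLineTangency T C he hs hsz] with w hw _ h
    exact absurd h hw
  obtain ⟨rfl, h0⟩ := hsz
  obtain ⟨δ, hδ, h⟩ := eventually_line_signs T C (hs _ h0)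
  have e1 : ∀ᶠ w : ℝ × ℝ × ℝ in 𝓝 (0, s, 0), |w.2.1 - s| < δ :=
    (by fun_prop : Continuous fun w : ℝ × ℝ × ℝ => |w.2.1 - s|).continuousAt.eventually
      (gt_mem_nhds (by simpa using hδ))
  have e2 : ∀ᶠ w : ℝ × ℝ × ℝ in 𝓝 (0, s, 0), |w.2.2| < δ :=
    (by fun_prop : Continuous fun w : ℝ × ℝ × ℝ => |w.2.2|).continuousAt.eventually
      (gt_mem_nhds (by simpa using hδ))
  filter_upwards [e1, e2] with w h1 h2 hε htan
  obtain ⟨k1, k2, k3⟩ := h w.2.1 w.2.2 h1 h2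
  have hlev := htan.1
  rw [level_line_of_lt T C hn hC he k1, sub_eq_zero] at hlev
  have hz : w.2.2 ≠ 0 := fun hz => hε (by rw [← hlev, hz, zero_mul])
  rw [deriv_level_line_of_lt T C hn hC he k1, fderiv_fderiv_level_line_of_lt T C hn hC he k1]
  have hd : deriv (T.height n e) (T.phase w.2.1 (w.2.2 ^ 2)) ≠ 0 := right_ne_zero_of_mul k2.ne'
  exact ⟨mul_ne_zero (mul_ne_zero (mul_ne_zero T.K_pos.ne' T.ρ_pos.ne') hz) hd,
    mul_ne_zero (neg_ne_zero.2 (mul_ne_zero (mul_ne_zero two_ne_zero T.K_pos.ne') hz)) k3⟩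

/-- Near a simple zero of the height, the sign of `ε` determines on which side of the origin
tangencies lie. On one side the slope is strictly monotone in `z`, so it vanishes at most once. -/
theorem eventually_isLineTangency_unique (hn : IsUnitNormal A n) (hC : 0 < C) (he : ‖e‖ = 1)
    (hs : ∀ x, T.height n e x = 0 → deriv (T.height n e) x ≠ 0) (R : ℝ) :
    ∀ᶠ ε in 𝓝 (0 : ℝ), ∀ w ∈ Icc (0 : ℝ) 1 ×ˢ Icc (-R) R ×ˢ Icc (-R) R, ε ≠ 0 →
      IsLineTangency T C A n e ε w.1 w.2.1 → IsLineTangency T C A n e ε w.1 w.2.2 →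
      w.2.1 = w.2.2 := by
  refine (isCompact_Icc.prod
    (isCompact_Icc.prod isCompact_Icc)).eventually_forall_of_forall_eventually fun w _ => ?_
  obtain ⟨s, z, z'⟩ := w
  have t1 : Tendsto (fun w : ℝ × ℝ × ℝ × ℝ => (w.1, w.2.1, w.2.2.1)) (𝓝 (0, s, z, z'))
    (𝓝 (0, s, z)) := (by fun_prop : Continuous fun w : ℝ × ℝ × ℝ × ℝ =>
      (w.1, w.2.1, w.2.2.1)).tendsto (0, s, z, z')
  have t2 : Tendsto (fun w : ℝ × ℝ × ℝ × ℝ => (w.1, w.2.1, w.2.2.2)) (𝓝 (0, s, z, z'))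
    (𝓝 (0, s, z')) := (by fun_prop : Continuous fun w : ℝ × ℝ × ℝ × ℝ =>
      (w.1, w.2.1, w.2.2.2)).tendsto (0, s, z, z')
  by_cases hsz : z = 0 ∧ T.height n e (T.phase s 0) = 0
  swap
  · filter_upwards [t1.eventually (eventually_not_isLineTangency T C he hs hsz)] with w hw _ h
    exact absurd h hw
  by_cases hsz' : z' = 0 ∧ T.height n e (T.phase s 0) = 0
  swap
  · filter_upwards [t2.eventually (eventually_not_isLineTangency T C he hs hsz')] with w hw _ _ h
    exact absurd h hw
  obtain ⟨rfl, h0⟩ := hsz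
  obtain ⟨rfl, -⟩ := hsz'
  obtain ⟨δ, hδ, h⟩ := eventually_line_signs T C (hs _ h0)
  have e1 : ∀ᶠ w : ℝ × ℝ × ℝ × ℝ in 𝓝 (0, s, 0, 0), |w.2.1 - s| < δ :=
    (by fun_prop : Continuous fun w : ℝ × ℝ × ℝ × ℝ => |w.2.1 - s|).continuousAt.eventually
      (gt_mem_nhds (by simpa using hδ))
  have e2 : ∀ᶠ w : ℝ × ℝ × ℝ × ℝ in 𝓝 (0, s, 0, 0), |w.2.2.1| < δ :=
    (by fun_prop : Continuous fun w : ℝ × ℝ × ℝ × ℝ => |w.2.2.1|).continuousAt.eventually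
      (gt_mem_nhds (by simpa using hδ))
  have e3 : ∀ᶠ w : ℝ × ℝ × ℝ × ℝ in 𝓝 (0, s, 0, 0), |w.2.2.2| < δ :=
    (by fun_prop : Continuous fun w : ℝ × ℝ × ℝ × ℝ => |w.2.2.2|).continuousAt.eventually
      (gt_mem_nhds (by simpa using hδ))
  filter_upwards [e1, e2, e3] with w h1 h2 h3 hε htan htan'
  obtain ⟨ε, s', z, z'⟩ := w
  simp only at h1 h2 h3 hε htan htan' ⊢
  set d := deriv (T.height n e) (T.phase s 0)
  -- Inserting `h = 2 * K * z ^ 2 * h'` into `ε = z * h` gives `ε = 2 * K * z ^ 3 * h'`, and `h'`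
  -- has the sign of `d`.
  have key : ∀ z, |z| < δ → IsLineTangency T C A n e ε s' z → 0 < (ε * d) * z := by
    intro z hz ht
    obtain ⟨k1, k2, k3⟩ := h s' z h1 hz
    have hlev := ht.1
    have hslope := ht.2
    rw [level_line_of_lt T C hn hC he k1, sub_eq_zero] at hlev
    rw [fderiv_level_line_of_lt T C hn hC he k1, Twist.slope, sub_eq_zero] at hslope
    rw [hslope] at hlev
    have hz0 : z ≠ 0 := fun hz => hε (by rw [← hlev, hz, zero_mul])
    have : (ε * d) * z = 2 * T.K * (z ^ 2) ^ 2 *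
        (d * deriv (T.height n e) (T.phase s' (z ^ 2))) := by rw [← hlev]; ring
    rw [this]
    have := T.K_pos
    have := pow_pos (sq_pos_of_ne_zero hz0) 2
    positivity
  have p1 := key z h2 htan
  have p2 := key z' h3 htan'
  have main : ∀ a b, a < b → |a| < δ → |b| < δ → IsLineTangency T C A n e ε s' a →
      IsLineTangency T C A n e ε s' b → 0 < (ε * d) * a → 0 < (ε * d) * b → False := by
    intro a b hab ha hb hta htb pa pb
    have fa := hta.2
    have fb := htb.2
    rw [fderiv_level_line_of_lt T C hn hC he (h s' a h1 ha).1] at fa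
    rw [fderiv_level_line_of_lt T C hn hC he (h s' b h1 hb).1] at fb
    -- Rolle's theorem for the slope. Its derivative `-2 * K * z * bend` vanishes only at the
    -- origin, which does not lie between two numbers of equal sign.
    obtain ⟨c, hc, hc0⟩ := exists_hasDerivAt_eq_zero hab
      (fun x _ => (hasDerivAt_slope T n e s' x).continuousAt.continuousWithinAt)
      (fa.trans fb.symm) (fun x _ => hasDerivAt_slope T n e s' x)
    have hcδ : |c| < δ := by
      rw [abs_lt] at ha hb ⊢
      exact ⟨ha.1.trans hc.1, hc.2.trans hb.2⟩
    have hbend := (h s' c h1 hcδ).2.2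
    have hc' : c ≠ 0 := by
      rintro rfl
      have h3 : a < 0 := hc.1
      have h4 : 0 < b := hc.2
      rcases mul_pos_iff.1 pa with ⟨q1, q2⟩ | ⟨q1, q2⟩
      · linarith
      · rcases mul_pos_iff.1 pb with ⟨r1, r2⟩ | ⟨r1, r2⟩ <;> linarith
    exact mul_ne_zero (neg_ne_zero.2 (mul_ne_zero (mul_ne_zero two_ne_zero T.K_pos.ne') hc')) hbend
      hc0
  rcases lt_trichotomy z z' with hlt | heq | hgt
  · exact (main z z' hlt h2 h3 htan htan' p1 p2).elim
  · exact heq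
  · exact (main z' z hgt h3 h2 htan' htan p2 p1).elim

/-- As `ε` tends to `0`, tangencies accumulate only at times where the height over the respective
line vanishes, and the two heights have no common zero. -/
theorem eventually_isLineTangency_disjoint {e' : E3} (he : ‖e‖ = 1) (he' : ‖e'‖ = 1)
    (hs : ∀ x, T.height n e x = 0 → deriv (T.height n e) x ≠ 0)
    (hs' : ∀ x, T.height n e' x = 0 → deriv (T.height n e') x ≠ 0)
    (hdisj : ∀ x, T.height n e x = 0 → T.height n e' x ≠ 0) (R : ℝ) :
    ∀ᶠ ε in 𝓝 (0 : ℝ), ∀ w ∈ Icc (0 : ℝ) 1 ×ˢ Icc (-R) R ×ˢ Icc (-R) R,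
      IsLineTangency T C A n e ε w.1 w.2.1 → ¬ IsLineTangency T C A n e' ε w.1 w.2.2 := by
  refine (isCompact_Icc.prod
    (isCompact_Icc.prod isCompact_Icc)).eventually_forall_of_forall_eventually fun w _ => ?_
  obtain ⟨s, z, z'⟩ := w
  have t1 : Tendsto (fun w : ℝ × ℝ × ℝ × ℝ => (w.1, w.2.1, w.2.2.1)) (𝓝 (0, s, z, z'))
    (𝓝 (0, s, z)) := (by fun_prop : Continuous fun w : ℝ × ℝ × ℝ × ℝ =>
      (w.1, w.2.1, w.2.2.1)).tendsto (0, s, z, z')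
  have t2 : Tendsto (fun w : ℝ × ℝ × ℝ × ℝ => (w.1, w.2.1, w.2.2.2)) (𝓝 (0, s, z, z'))
    (𝓝 (0, s, z')) := (by fun_prop : Continuous fun w : ℝ × ℝ × ℝ × ℝ =>
      (w.1, w.2.1, w.2.2.2)).tendsto (0, s, z, z')
  by_cases hsz : z = 0 ∧ T.height n e (T.phase s 0) = 0
  swap
  · filter_upwards [t1.eventually (eventually_not_isLineTangency T C he hs hsz)] with w hw h
    exact absurd h hw
  have hsz' : ¬ (z' = 0 ∧ T.height n e' (T.phase s 0) = 0) := fun h => hdisj _ hsz.2 h.2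
  filter_upwards [t2.eventually (eventually_not_isLineTangency T C he' hs' hsz')] with w hw _
  exact hw

end Line

end

section
/-! ### Sheets described by defining functions -/

theorem fderiv_fderiv_comp_apply {g : E3 → ℝ} {ψ : E2 → E3} {u : E2} (hg : ContDiff ℝ ∞ g)
    (hψ : ContDiffAt ℝ ∞ ψ u) (a b : E2) :
    fderiv ℝ (fderiv ℝ (g ∘ ψ)) u a b =
      fderiv ℝ (fderiv ℝ g) (ψ u) (fderiv ℝ ψ u a) (fderiv ℝ ψ u b) +
        fderiv ℝ g (ψ u) (fderiv ℝ (fderiv ℝ ψ) u a b) := by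
  have hg1 : Differentiable ℝ (fderiv ℝ g) :=
    (hg.fderiv_right (m := 1) (by norm_cast)).differentiable (by simp)
  have hd2 : DifferentiableAt ℝ (fderiv ℝ ψ) u :=
    (hψ.fderiv_right (m := 1) (by norm_cast)).differentiableAt (by simp)
  have hev : ∀ᶠ v in 𝓝 u, ContDiffAt ℝ 1 ψ v :=
    (hψ.of_le (m := 1) (mod_cast le_top)).eventually (by decide)
  have hev' : fderiv ℝ (g ∘ ψ) =ᶠ[𝓝 u] fun v => (fderiv ℝ g (ψ v)).comp (fderiv ℝ ψ v) := by
    filter_upwards [hev] with v hv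
    have h1 : DifferentiableAt ℝ g (ψ v) := hg.differentiable (by simp) _
    have h2 : DifferentiableAt ℝ ψ v := hv.differentiableAt (by simp)
    exact fderiv_comp v h1 h2
  have hd : DifferentiableAt ℝ ψ u := hψ.differentiableAt (by simp)
  have h1 : DifferentiableAt ℝ (fun v => fderiv ℝ g (ψ v)) u := (hg1 (ψ u)).comp u hd
  have h1' : fderiv ℝ (fun v => fderiv ℝ g (ψ v)) u =
      (fderiv ℝ (fderiv ℝ g) (ψ u)).comp (fderiv ℝ ψ u) := fderiv_comp u (hg1 (ψ u)) hd
  rw [hev'.fderiv_eq, fderiv_clm_comp h1 hd2, h1']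
  simp [add_comm]

variable {F : Type*} [TopologicalSpace F] [ChartedSpace E2 F]

theorem chartRep_self_apply (h : F → E3) (x : F) :
    chartRep h x (extChartAt (𝓡 2) x x) = h x := by
  simp only [chartRep, Function.comp, (extChartAt (𝓡 2) x).left_inv (mem_extChartAt_source x)]

theorem tendsto_extChartAt_symm (x : F) :
    Tendsto (extChartAt (𝓡 2) x).symm (𝓝 (extChartAt (𝓡 2) x x)) (𝓝 x) := by
  have := continuousAt_extChartAt_symm (I := 𝓡 2) x
  unfold ContinuousAt at this
  rwa [extChartAt_to_inv] at this

section
variable [IsManifold (𝓡 2) ∞ F]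

theorem fderiv_level_chartDeriv {h : F → E3} (hh : ContMDiff (𝓡 2) 𝓘(ℝ, E3) ∞ h) {x : F}
    {g : E3 → ℝ} (hg : ContDiff ℝ ∞ g) (hz : ∀ᶠ y in 𝓝 x, g (h y) = 0) (a : E2) :
    fderiv ℝ g (h x) (chartDeriv h x a) = 0 := by
  have hd : ContDiffAt ℝ ∞ (chartRep h x) (extChartAt (𝓡 2) x x) :=
    contDiffAt_chartRep (mem_chart_source E2 x) (hh.contMDiffAt (x := x))
  have hev : g ∘ chartRep h x =ᶠ[𝓝 (extChartAt (𝓡 2) x x)] fun _ => (0 : ℝ) :=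
    (tendsto_extChartAt_symm x).eventually hz
  have h1 := hev.fderiv_eq (𝕜 := ℝ)
  have hg' : DifferentiableAt ℝ g (chartRep h x (extChartAt (𝓡 2) x x)) :=
    hg.differentiable (by simp) _
  have hd' : DifferentiableAt ℝ (chartRep h x) (extChartAt (𝓡 2) x x) :=
    hd.differentiableAt (by simp)
  rw [fderiv_comp _ hg' hd', chartRep_self_apply, fderiv_fun_const] at h1
  exact congrArg (fun L : E2 →L[ℝ] ℝ => L a) h1

/-- Differentiating `g ∘ h = 0` twice trades the second derivative of the sheet in its normal
direction for the Hessian of the defining function. -/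
theorem fderiv_level_chartDeriv₂ {h : F → E3} (hh : ContMDiff (𝓡 2) 𝓘(ℝ, E3) ∞ h) {x : F}
    {g : E3 → ℝ} (hg : ContDiff ℝ ∞ g) (hz : ∀ᶠ y in 𝓝 x, g (h y) = 0) (a b : E2) :
    fderiv ℝ g (h x) (chartDeriv₂ h x a b) =
      -fderiv ℝ (fderiv ℝ g) (h x) (chartDeriv h x a) (chartDeriv h x b) := by
  have hd : ContDiffAt ℝ ∞ (chartRep h x) (extChartAt (𝓡 2) x x) :=
    contDiffAt_chartRep (mem_chart_source E2 x) (hh.contMDiffAt (x := x))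
  have hev : g ∘ chartRep h x =ᶠ[𝓝 (extChartAt (𝓡 2) x x)] fun _ => (0 : ℝ) :=
    (tendsto_extChartAt_symm x).eventually hz
  have h1 := hev.fderiv (𝕜 := ℝ)
  have h2 := h1.fderiv_eq (𝕜 := ℝ)
  have h3 := fderiv_fderiv_comp_apply hg hd a b
  rw [h2, chartRep_self_apply] at h3
  have h4 : fderiv ℝ (fderiv ℝ fun _ : E2 => (0 : ℝ)) (extChartAt (𝓡 2) x x) = 0 := by
    have : (fderiv ℝ fun _ : E2 => (0 : ℝ)) = fun _ => 0 := by
      funext v; simp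
    rw [this]; simp
  rw [h4] at h3
  have h5 : (0 : ℝ) = fderiv ℝ (fderiv ℝ g) (h x) (chartDeriv h x a) (chartDeriv h x b) +
      fderiv ℝ g (h x) (chartDeriv₂ h x a b) := h3
  linarith

/-- The gradient of a function. -/
def grad (g : E3 → ℝ) (p : E3) : E3 := (InnerProductSpace.toDual ℝ E3).symm (fderiv ℝ g p)

theorem inner_grad (g : E3 → ℝ) (p v : E3) : inner ℝ (grad g p) v = fderiv ℝ g p v := by
  rw [grad, InnerProductSpace.toDual_symm_apply]

theorem mem_tangentPlane_iff_of_level {h : F → E3} (hh : IsImmersion h) {x : F}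
    {g : E3 → ℝ} (hg : ContDiff ℝ ∞ g) (hz : ∀ᶠ y in 𝓝 x, g (h y) = 0)
    (hgrad : grad g (h x) ≠ 0) {v : E3} : v ∈ tangentPlane h x ↔ inner ℝ (grad g (h x)) v = 0 := by
  refine mem_plane_iff (finrank_tangentPlane ((isImmersion_iff.1 hh).2 x)) hgrad ?_
  rintro _ ⟨a, rfl⟩
  rw [inner_grad]
  exact fderiv_level_chartDeriv hh.1 hg hz a

/-- In the ball of radius `R`, the map `h` consists of four embedded sheets on the disjoint open
sets `U a`, which are described by the functions `G a`. -/
structure LocalPicture (U : Fin 4 → Set F) (G : Fin 4 → E3 → ℝ) (h : F → E3) (R : ℝ) : Prop where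
  imm : IsImmersion h
  isOpen : ∀ a, IsOpen (U a)
  disj : ∀ a b x, x ∈ U a → x ∈ U b → a = b
  norm_lt : ∀ x, ‖h x‖ < R ↔ ∃ a, x ∈ U a
  inj : ∀ a, InjOn h (U a)
  smooth : ∀ a, ContDiff ℝ ∞ (G a)
  zero : ∀ a, ∀ x ∈ U a, G a (h x) = 0
  surj : ∀ a p, ‖p‖ < R → G a p = 0 → ∃ x ∈ U a, h x = p

namespace LocalPicture
variable {U : Fin 4 → Set F} {G : Fin 4 → E3 → ℝ} {h : F → E3} {R : ℝ} (P : LocalPicture U G h R)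
include P

theorem eventually_zero {a : Fin 4} {x : F} (hx : x ∈ U a) : ∀ᶠ y in 𝓝 x, G a (h y) = 0 := by
  filter_upwards [(P.isOpen a).mem_nhds hx] with y hy
  exact P.zero a y hy

theorem mem_tangentPlane_iff {a : Fin 4} {x : F} (hx : x ∈ U a) (hgrad : grad (G a) (h x) ≠ 0)
    {v : E3} : v ∈ tangentPlane h x ↔ inner ℝ (grad (G a) (h x)) v = 0 :=
  mem_tangentPlane_iff_of_level P.imm (P.smooth a) (P.eventually_zero hx) hgrad

/-- Each sheet is embedded, so distinct preimages of `p` carry distinct labels. Transversality then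
becomes a condition on the gradients of the corresponding functions. -/
theorem sheetsInGeneralPosition {p : E3} (hp : ‖p‖ < R)
    (hpair : ∀ a b, a ≠ b → G a p = 0 → G b p = 0 →
      ∀ s t : ℝ, s • grad (G a) p + t • grad (G b) p = 0 → s = 0 ∧ t = 0)
    (htriple : ∀ l, (∀ a, a ≠ l → G a p = 0) → ∀ v, (∀ a, a ≠ l → inner ℝ (grad (G a) p) v = 0) →
      v = 0) : SheetsInGeneralPosition h p := by
  have hlab : ∀ x, h x = p → ∃ a, x ∈ U a ∧ G a p = 0 := fun x hx => by
    obtain ⟨a, ha⟩ := (P.norm_lt x).1 (by rwa [hx])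
    exact ⟨a, ha, hx ▸ P.zero a x ha⟩
  have hlne : ∀ {a b : Fin 4} {x y : F}, x ∈ U a → y ∈ U b → h x = p → h y = p → x ≠ y → a ≠ b := by
    rintro a b x y hx hy hxp hyp hxy rfl
    exact hxy (P.inj a hx hy (hxp.trans hyp.symm))
  have hg : ∀ a b, a ≠ b → G a p = 0 → G b p = 0 → grad (G a) p ≠ 0 := fun a b hab ha hb h0 => by
    have := (hpair a b hab ha hb 1 0 (by simp [h0])).1
    norm_num at this
  rw [sheetsInGeneralPosition_iff]
  refine ⟨fun x y hx hy hxy hT => ?_, fun x y z hx hy hz hxy hxz hyz => ?_⟩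
  · obtain ⟨a, ha, ha0⟩ := hlab x hx
    obtain ⟨b, hb, hb0⟩ := hlab y hy
    have hab := hlne ha hb hx hy hxy
    have ga := hg a b hab ha0 hb0
    have gb := hg b a hab.symm hb0 ha0
    have m1 := fun v => P.mem_tangentPlane_iff ha (v := v) (by rwa [hx])
    have m2 := fun v => P.mem_tangentPlane_iff hb (v := v) (by rwa [hy])
    rw [hx] at m1
    rw [hy] at m2
    set α := grad (G a) p
    set β := grad (G b) p
    have hαα : (inner ℝ α α : ℝ) ≠ 0 := inner_self_ne_zero.2 ga
    -- The part of `β` orthogonal to `α`. If the tangent planes coincide it is also orthogonal to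
    -- `β`, hence zero.
    let w := β - ((inner ℝ α β : ℝ) / inner ℝ α α) • α
    have hw : (inner ℝ α w : ℝ) = 0 := by
      simp only [w, inner_sub_right, real_inner_smul_right]
      field_simp
      ring
    have hw2 : (inner ℝ β w : ℝ) = 0 := (m2 w).1 (hT ▸ (m1 w).2 hw)
    have hw0 : w = 0 := by
      rw [← inner_self_eq_zero (𝕜 := ℝ)]
      conv_lhs => rw [show w = β - ((inner ℝ α β : ℝ) / inner ℝ α α) • α from rfl]
      rw [inner_sub_left, real_inner_smul_left, hw2, hw]; ring
    have := (hpair a b hab ha0 hb0 (-((inner ℝ α β : ℝ) / inner ℝ α α)) 1 (by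
      rw [← hw0]; simp only [w]; module)).2
    norm_num at this
  · obtain ⟨a, ha, ha0⟩ := hlab x hx
    obtain ⟨b, hb, hb0⟩ := hlab y hy
    obtain ⟨d, hd, hd0⟩ := hlab z hz
    have hab := hlne ha hb hx hy hxy
    have had := hlne ha hd hx hz hxz
    have hbd := hlne hb hd hy hz hyz
    have m1 := fun v => P.mem_tangentPlane_iff ha (v := v) (by rw [hx]; exact hg a b hab ha0 hb0)
    have m2 := fun v => P.mem_tangentPlane_iff hb (v := v)
      (by rw [hy]; exact hg b a hab.symm hb0 ha0)
    have m3 := fun v => P.mem_tangentPlane_iff hd (v := v)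
      (by rw [hz]; exact hg d a had.symm hd0 ha0)
    rw [hx] at m1
    rw [hy] at m2
    rw [hz] at m3
    obtain ⟨l, hl⟩ : ∃ l : Fin 4, ∀ e, e ≠ l → e = a ∨ e = b ∨ e = d := by
      clear * - hab had hbd
      revert a b d; decide
    rw [Submodule.eq_bot_iff]
    rintro v ⟨⟨v1, v2⟩, v3⟩
    refine htriple l (fun e he => ?_) v fun e he => ?_
    · rcases hl e he with rfl | rfl | rfl <;> assumption
    · rcases hl e he with rfl | rfl | rfl
      · exact (m1 v).1 v1
      · exact (m2 v).1 v2
      · exact (m3 v).1 v3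

/-- The label of a preimage determines it, and at least one of the four labels is not taken. -/
theorem encard_preimage_le {p : E3} (hp : ‖p‖ < R) (hquad : ∃ a, G a p ≠ 0) :
    (h ⁻¹' {p}).encard ≤ 3 := by
  have hlab : ∀ x : h ⁻¹' {p}, ∃ a, (x : F) ∈ U a := fun x => by
    have hx : h x = p := x.2
    exact (P.norm_lt x).1 (by rwa [hx])
  choose lab hlabU using hlab
  have hinj : Function.Injective lab := fun x y hxy => by
    have hx : h x = p := x.2
    have hy : h y = p := y.2
    exact Subtype.ext (P.inj _ (hlabU x) (hxy ▸ hlabU y) (hx.trans hy.symm))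
  obtain ⟨l, hl⟩ := hquad
  have hsub : range lab ⊆ {l}ᶜ := by
    rintro _ ⟨x, rfl⟩ hx
    have hx' : lab x = l := hx
    refine hl ?_
    have h1 := P.zero _ _ (hlabU x)
    have h2 : h x = p := x.2
    rwa [hx', h2] at h1
  calc (h ⁻¹' {p}).encard = (univ : Set (h ⁻¹' {p})).encard := by
        rw [Set.encard_univ]; rfl
    _ = (range lab).encard := by rw [← image_univ, hinj.encard_image]
    _ ≤ ({l}ᶜ : Set (Fin 4)).encard := encard_le_encard hsub
    _ = ((3 : ℕ) : ℕ∞) := by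
        rw [← Finset.coe_singleton, ← Finset.coe_compl, Set.encard_coe_eq_coe_finsetCard,
          Finset.card_compl]
        simp
    _ ≤ 3 := le_rfl

theorem isStableAt {p : E3} (hp : ‖p‖ < R)
    (hpair : ∀ a b, a ≠ b → G a p = 0 → G b p = 0 →
      ∀ s t : ℝ, s • grad (G a) p + t • grad (G b) p = 0 → s = 0 ∧ t = 0)
    (htriple : ∀ l, (∀ a, a ≠ l → G a p = 0) → ∀ v, (∀ a, a ≠ l → inner ℝ (grad (G a) p) v = 0) →
      v = 0) (hquad : ∃ a, G a p ≠ 0) : IsStableAt h p := by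
  exact ⟨P.encard_preimage_le hp hquad, P.sheetsInGeneralPosition hp hpair htriple⟩

theorem isGenericQuadruplePoint {p : E3} (hp : ‖p‖ < R)
    (hpair : ∀ a b, a ≠ b → G a p = 0 → G b p = 0 →
      ∀ s t : ℝ, s • grad (G a) p + t • grad (G b) p = 0 → s = 0 ∧ t = 0)
    (htriple : ∀ l, (∀ a, a ≠ l → G a p = 0) → ∀ v, (∀ a, a ≠ l → inner ℝ (grad (G a) p) v = 0) →
      v = 0) (hquad : ∀ a, G a p = 0) : IsGenericQuadruplePoint h p := by
  refine ⟨?_, P.sheetsInGeneralPosition hp hpair htriple⟩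
  choose x hx hxp using fun a => P.surj a p hp (hquad a)
  have hinj : Function.Injective x := fun a b hab => P.disj a b (x a) (hx a) (hab ▸ hx b)
  have : h ⁻¹' {p} = range x := by
    ext y
    constructor
    · intro hy
      have hy' : h y = p := hy
      obtain ⟨a, ha⟩ := (P.norm_lt y).1 (by rwa [hy'])
      exact ⟨a, P.inj a (hx a) ha ((hxp a).trans hy'.symm)⟩
    · rintro ⟨a, rfl⟩; exact hxp a
  rw [this, ← image_univ, hinj.encard_image, encard_univ]
  simp

end LocalPicture

/-! ### The codimension one event of three sheets -/

/-- The three vectors lie in the plane orthogonal to `e`, so they are dependent. Pairwise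
independence forces a relation with one zero coefficient to vanish, which gives both nonzero
coefficients and uniqueness up to scaling. -/
theorem exists_relation_of_pairwise {ν : Fin 3 → E3} {e : E3} (he : e ≠ 0)
    (hνe : ∀ m, inner ℝ (ν m) e = 0)
    (hpair : ∀ a b, a ≠ b → ∀ s t : ℝ, s • ν a + t • ν b = 0 → s = 0 ∧ t = 0) :
    ∃ c : Fin 3 → ℝ, (∀ m, c m ≠ 0) ∧ ∑ m, c m • ν m = 0 ∧
      ∀ t : Fin 3 → ℝ, ∑ m, t m • ν m = 0 → ∃ r : ℝ, ∀ m, t m = r * c m := by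
  have hzero : ∀ t : Fin 3 → ℝ, ∑ m, t m • ν m = 0 → ∀ m, t m = 0 → ∀ m', t m' = 0 := by
    intro t ht m hm
    have h01 := hpair 0 1 (by decide)
    have h02 := hpair 0 2 (by decide)
    have h12 := hpair 1 2 (by decide)
    rw [Fin.sum_univ_three] at ht
    fin_cases m
    · simp only [Fin.zero_eta] at hm
      rw [hm, zero_smul, zero_add] at ht
      obtain ⟨k1, k2⟩ := h12 _ _ ht
      intro m'; fin_cases m' <;> assumption
    · simp only [Fin.mk_one] at hm
      rw [hm, zero_smul, add_zero] at ht
      obtain ⟨k1, k2⟩ := h02 _ _ ht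
      intro m'; fin_cases m' <;> assumption
    · simp only [Fin.reduceFinMk] at hm
      rw [hm, zero_smul, add_zero] at ht
      obtain ⟨k1, k2⟩ := h01 _ _ ht
      intro m'; fin_cases m' <;> assumption
  have hdep : ¬ LinearIndependent ℝ ν := fun hli => by
    have hspan : Submodule.span ℝ (range ν) = ⊤ := hli.span_eq_top_of_card_eq_finrank (by simp)
    have hemem : e ∈ (Submodule.span ℝ (range ν))ᗮ := by
      rw [Submodule.mem_orthogonal]
      intro u hu
      induction hu using Submodule.span_induction with
      | mem x hx => obtain ⟨m, rfl⟩ := hx; exact hνe m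
      | zero => simp
      | add x y _ _ hx hy => rw [inner_add_left, hx, hy, add_zero]
      | smul a x _ hx => rw [real_inner_smul_left, hx, mul_zero]
    rw [hspan, Submodule.top_orthogonal_eq_bot] at hemem
    exact he hemem
  obtain ⟨c, hc, j, hj⟩ := Fintype.not_linearIndependent_iff.1 hdep
  have hc0 : ∀ m, c m ≠ 0 := fun m hm => hj (hzero c hc m hm j)
  refine ⟨c, hc0, hc, fun t ht => ⟨t 0 / c 0, fun m => ?_⟩⟩
  have h1 : ∑ m, (t m - t 0 / c 0 * c m) • ν m = 0 := by
    simp only [sub_smul, Finset.sum_sub_distrib, ht, mul_smul, ← Finset.smul_sum, hc, smul_zero,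
      sub_zero]
  have := hzero _ h1 0 (by field_simp [hc0 0]; ring) m
  linarith

theorem exists_smul_of_orthogonal {ν w : E3} (hν : ν ≠ 0)
    (h : ∀ v, inner ℝ ν v = 0 → inner ℝ w v = 0) : ∃ t : ℝ, w = t • ν := by
  have hνν : (inner ℝ ν ν : ℝ) ≠ 0 := inner_self_ne_zero.2 hν
  refine ⟨(inner ℝ ν w : ℝ) / inner ℝ ν ν, ?_⟩
  set v := w - ((inner ℝ ν w : ℝ) / inner ℝ ν ν) • ν with hv
  have h1 : (inner ℝ ν v : ℝ) = 0 := by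
    simp only [hv, inner_sub_right, real_inner_smul_right]
    field_simp; ring
  have h2 := h v h1
  have : (inner ℝ v v : ℝ) = 0 := by
    conv_lhs => rw [hv, inner_sub_left, real_inner_smul_left, ← hv]
    rw [h1, h2]; ring
  exact sub_eq_zero.1 (inner_self_eq_zero.1 this)

/-- Three sheets, all but `l`, meet at `p` with common tangent `e`. Only the function of sheet `k`
has nonzero time derivative at `p` or nonzero second derivative along `e`. The sums over sheets in
the speed and nondegeneracy conditions thus reduce to their `k`-th terms. -/
theorem LocalPicture.isCodimOneEvent {U : Fin 4 → Set F} {G : Fin 4 → ℝ → E3 → ℝ}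
    {H : ℝ → F → E3} {R t : ℝ} {p e : E3} (P : LocalPicture U (fun a => G a t) (H t) R)
    (hp : ‖p‖ < R) {k l : Fin 4} (hkl : k ≠ l) (he : e ≠ 0)
    (hzero : ∀ a, G a t p = 0 ↔ a ≠ l)
    (hpair : ∀ a b, a ≠ b → a ≠ l → b ≠ l →
      ∀ s t' : ℝ, s • grad (G a t) p + t' • grad (G b t) p = 0 → s = 0 ∧ t' = 0)
    (hline : ∀ a, a ≠ l → inner ℝ (grad (G a t) p) e = 0)
    (hspan : ∀ v, (∀ a, a ≠ l → a ≠ k → inner ℝ (grad (G a t) p) v = 0) → ∃ z : ℝ, v = z • e)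
    (hGs : ∀ a, ContDiff ℝ ∞ fun q : ℝ × E3 => G a q.1 q.2)
    (hHs : ∀ x, DifferentiableAt ℝ (fun s => H s x) t)
    (hGH : ∀ a, ∀ x ∈ U a, ∀ s, G a s (H s x) = 0)
    (hvel0 : ∀ a, a ≠ l → a ≠ k → deriv (fun s => G a s p) t = 0)
    (hvel : deriv (fun s => G k s p) t ≠ 0)
    (hsec0 : ∀ a, a ≠ l → a ≠ k → fderiv ℝ (fderiv ℝ (G a t)) p e e = 0)
    (hsec : fderiv ℝ (fderiv ℝ (G k t)) p e e ≠ 0) :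
    IsCodimOneEvent H t p := by
  classical
  choose y hyU hyp using fun m : Fin 3 =>
    P.surj (l.succAbove m) p hp ((hzero _).2 (Fin.succAbove_ne l m))
  let ν : Fin 3 → E3 := fun m => grad (G (l.succAbove m) t) p
  have hne : ∀ m, l.succAbove m ≠ l := fun m => Fin.succAbove_ne l m
  have hyinj : Function.Injective y := fun m m' hmm => by
    have := P.disj _ _ (y m) (hyU m) (hmm ▸ hyU m')
    exact Fin.succAbove_right_injective this
  have hνpair : ∀ a b, a ≠ b → ∀ s t : ℝ, s • ν a + t • ν b = 0 → s = 0 ∧ t = 0 :=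
    fun a b hab => hpair _ _ (fun h => hab (Fin.succAbove_right_injective h)) (hne a) (hne b)
  have hν0 : ∀ m, ν m ≠ 0 := fun m hm => by
    obtain ⟨m', hm'⟩ : ∃ m' : Fin 3, m ≠ m' := by clear * -; revert m; decide
    have := (hνpair m m' hm' 1 0 (by simp [hm])).1
    norm_num at this
  obtain ⟨c, hc0, hc, hcu⟩ := exists_relation_of_pairwise (ν := ν) he
    (fun m => hline _ (hne m)) hνpair
  have hperp : ∀ m a, inner ℝ (ν m) (chartDeriv (H t) (y m) a) = 0 := fun m a => by
    have := fderiv_level_chartDeriv P.imm.1 (P.smooth (l.succAbove m))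
      (P.eventually_zero (hyU m)) a
    rw [hyp m] at this
    simp only [ν, inner_grad]
    exact this
  have hmemT : ∀ m v, inner ℝ (ν m) v = 0 → v ∈ tangentPlane (H t) (y m) := fun m v hv => by
    refine (P.mem_tangentPlane_iff (hyU m) ?_).2 ?_
    · rw [hyp m]; exact hν0 m
    · rw [hyp m]; exact hv
  let μ : F → E3 := fun z => ∑ m, if y m = z then c m • ν m else 0
  have hμ : ∀ m, μ (y m) = c m • ν m := fun m => by simp [μ, hyinj.eq_iff]
  let S : Finset F := Finset.univ.image y
  have hsum : ∀ φ : F → E3, ∑ z ∈ S, φ z = ∑ m, φ (y m) := fun φ =>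
    Finset.sum_image fun a _ b _ hab => hyinj hab
  have hsum' : ∀ φ : F → ℝ, ∑ z ∈ S, φ z = ∑ m, φ (y m) := fun φ =>
    Finset.sum_image fun a _ b _ hab => hyinj hab
  have hS : ∀ Q : F → Prop, (∀ z ∈ S, Q z) ↔ ∀ m, Q (y m) := by
    intro Q
    simp [S]
  obtain ⟨mk, hmk⟩ : ∃ m, l.succAbove m = k := Fin.exists_succAbove_eq hkl
  have hother : ∀ m, m ≠ mk → l.succAbove m ≠ k := fun m hm h =>
    hm (Fin.succAbove_right_injective (h.trans hmk.symm))
  refine ⟨S, μ, ?_, ⟨(hS _).2 fun m a => ?_, ?_⟩, (hS _).2 fun m => ?_, fun μ' hμ' => ?_, ?_,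
    fun a w haw hnull => ?_⟩
  · ext z
    simp only [S, Finset.coe_image, Finset.coe_univ, image_univ, mem_range, mem_preimage,
      mem_singleton_iff]
    constructor
    · rintro ⟨m, rfl⟩; exact hyp m
    · intro hz
      obtain ⟨a, ha⟩ := (P.norm_lt z).1 (by rwa [hz])
      have hal : a ≠ l := (hzero a).1 (by have := P.zero a z ha; rwa [hz] at this)
      obtain ⟨m, rfl⟩ := Fin.exists_succAbove_eq hal
      exact ⟨m, P.inj _ (hyU m) ha ((hyp m).trans hz.symm)⟩
  · rw [hμ, real_inner_smul_left, hperp, mul_zero]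
  · rw [hsum]; simp only [hμ]; exact hc
  · rw [hμ]; exact smul_ne_zero (hc0 m) (hν0 m)
  · obtain ⟨h1, h2⟩ := hμ'
    rw [hS] at h1
    have h3 : ∀ m, ∃ r : ℝ, μ' (y m) = r • ν m := fun m =>
      exists_smul_of_orthogonal (hν0 m) fun v hv => by
        obtain ⟨a, rfl⟩ := hmemT m v hv
        exact h1 m a
    choose r hr using h3
    rw [hsum] at h2
    simp only [hr] at h2
    obtain ⟨q, hq⟩ := hcu r h2
    exact ⟨q, (hS _).2 fun m => by rw [hr, hμ, hq, mul_smul]⟩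
  -- Differentiation of `G s (H s y) = 0` in `s` expresses the normal velocity of a sheet by the
  -- time derivative of its defining function.
  · have hv : ∀ m, inner ℝ (ν m) (deriv (fun s => H s (y m)) t) =
        -deriv (fun s => G (l.succAbove m) s p) t := fun m => by
      set g : ℝ × E3 → ℝ := fun q => G (l.succAbove m) q.1 q.2
      have hg : HasFDerivAt g (fderiv ℝ g (t, p)) (t, p) :=
        ((hGs (l.succAbove m)).differentiable (by simp) (t, p)).hasFDerivAt
      have d1 : HasDerivAt (fun s => (s, H s (y m))) (1, deriv (fun s => H s (y m)) t) t :=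
        (hasDerivAt_id t).prodMk (hHs (y m)).hasDerivAt
      have hg' : HasFDerivAt g (fderiv ℝ g (t, p)) (t, H t (y m)) := by rw [hyp m]; exact hg
      have d2 : HasDerivAt (fun s => g (s, H s (y m)))
          (fderiv ℝ g (t, p) (1, deriv (fun s => H s (y m)) t)) t := by
        have := hg'.comp_hasDerivAt t d1
        exact this
      have d3 : (fun s => g (s, H s (y m))) = fun _ => 0 := funext fun s => hGH _ _ (hyU m) s
      rw [d3] at d2
      have d4 := d2.unique (hasDerivAt_const t (0 : ℝ))
      have d5 : HasDerivAt (fun s => G (l.succAbove m) s p) (fderiv ℝ g (t, p) (1, 0)) t :=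
        by
          have d0 : HasDerivAt (fun s => (s, p)) ((1 : ℝ), (0 : E3)) t :=
            (hasDerivAt_id t).prodMk (hasDerivAt_const t p)
          have := hg.comp_hasDerivAt t d0
          exact this
      have d6 : HasFDerivAt (G (l.succAbove m) t)
          ((fderiv ℝ g (t, p)).comp (ContinuousLinearMap.inr ℝ ℝ E3)) p :=
        hg.comp p (hasFDerivAt_prodMk_right t p)
      simp only [ν]
      rw [inner_grad, d5.deriv, d6.fderiv, ContinuousLinearMap.comp_apply,
        ContinuousLinearMap.inr_apply]
      have d7 : ((1 : ℝ), deriv (fun s => H s (y m)) t) =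
        (1, 0) + (0, deriv (fun s => H s (y m)) t) := by simp
      rw [d7, map_add] at d4
      linarith
    rw [hsum']
    simp only [hμ, real_inner_smul_left, hv]
    rw [Finset.sum_eq_single mk (fun m _ hm => by rw [hvel0 _ (hne m) (hother m hm)]; simp)
      (by simp), hmk]
    exact mul_ne_zero (hc0 mk) (neg_ne_zero.2 hvel)
  -- A null vector is in particular isotropic. As the common tangent vectors are multiples `z • e`,
  -- the form is a nonzero multiple of `z ^ 2`.
  · have hQ := hnull a w haw
    rw [hS] at haw
    have hsecond : ∀ m, inner ℝ (ν m) (chartDeriv₂ (H t) (y m) (a (y m)) (a (y m))) =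
        -fderiv ℝ (fderiv ℝ (G (l.succAbove m) t)) p w w := fun m => by
      have := fderiv_level_chartDeriv₂ P.imm.1 (P.smooth (l.succAbove m))
        (P.eventually_zero (hyU m)) (a (y m)) (a (y m))
      rw [hyp m, haw m] at this
      simp only [ν, inner_grad]
      exact this
    obtain ⟨z, rfl⟩ := hspan w fun b hbl hbk => by
      obtain ⟨m, rfl⟩ := Fin.exists_succAbove_eq hbl
      have := hperp m (a (y m))
      rw [haw m] at this
      exact this
    rw [hsum'] at hQ
    simp only [hμ, real_inner_smul_left, hsecond, map_smul, smul_apply, smul_eq_mul] at hQ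
    rw [Finset.sum_eq_single mk (fun m _ hm => by rw [hsec0 _ (hne m) (hother m hm)]; simp)
      (by simp), hmk] at hQ
    have hz : z = 0 := by
      by_contra hz
      exact mul_ne_zero (hc0 mk) (neg_ne_zero.2 (mul_ne_zero hz (mul_ne_zero hz hsec))) hQ
    rw [hz, zero_smul]

end

end

section
/-! ### Twisting one of four flat discs -/

variable {F : Type*} [TopologicalSpace F]

open Classical in
/-- The twist of the part of `h` on `D`. -/
def twistOn (T : Twist) (D : Set F) (h : F → E3) (s : ℝ) (x : F) : E3 :=
  if x ∈ D then T.map s (h x) else h x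

theorem twistOn_of_mem (T : Twist) {D : Set F} (h : F → E3) (s : ℝ) {x : F} (hx : x ∈ D) :
    twistOn T D h s x = T.map s (h x) := if_pos hx

theorem twistOn_of_notMem (T : Twist) {D : Set F} (h : F → E3) (s : ℝ) {x : F} (hx : x ∉ D) :
    twistOn T D h s x = h x := if_neg hx

theorem norm_twistOn (T : Twist) (D : Set F) (h : F → E3) (s : ℝ) (x : F) :
    ‖twistOn T D h s x‖ = ‖h x‖ := by
  unfold twistOn
  split_ifs
  · exact T.norm_map _ _
  · rfl

theorem twistOn_zero (T : Twist) (D : Set F) (h : F → E3) : twistOn T D h 0 = h := by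
  funext x
  unfold twistOn
  split_ifs
  · exact T.map_zero_time _
  · rfl

theorem twistOn_of_le (T : Twist) (D : Set F) (h : F → E3) {s : ℝ} {x : F}
    (hx : T.ρ * s ≤ ‖h x‖ ^ 2) : twistOn T D h s x = h x := by
  unfold twistOn
  split_ifs
  · exact T.map_of_le hx
  · rfl

/-- The part of `h` over the ball of radius `R` consists of four disjoint discs, all of which are
flat except for a push of the `k`-th one in the normal direction near its centre. -/
structure PushedDiscs (c : Fin 4 → E2 → F) (A : Fin 4 → E2 →ₗᵢ[ℝ] E3) (k : Fin 4) (n : E3)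
    (C ε R : ℝ) (h : F → E3) : Prop where
  continuousOn : ∀ a, ContinuousOn (c a) (Metric.closedBall 0 R)
  disjoint : ∀ a b, a ≠ b →
    Disjoint (c a '' Metric.closedBall 0 R) (c b '' Metric.closedBall 0 R)
  preimage : h ⁻¹' Metric.closedBall 0 R = discs c R
  linear : ∀ a, a ≠ k → ∀ u ∈ Metric.closedBall (0 : E2) R, h (c a u) = A a u
  pushed : ∀ u ∈ Metric.closedBall (0 : E2) R, h (c k u) = pushedPlane (A k) n C ε u
  normal : IsUnitNormal (A k) n
  R_pos : 0 < R
  C_pos : 0 < C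
  four_le : 4 ≤ C * R ^ 2
  ε_lt : 2 * ε ^ 2 < R ^ 2

theorem norm_pushedPlane_of_le {A : E2 →ₗᵢ[ℝ] E3} {n : E3} {C ε : ℝ} {u : E2}
    (h : 2 ≤ C * ‖u‖ ^ 2) : ‖pushedPlane A n C ε u‖ = ‖u‖ := by
  rw [pushedPlane, cut_of_ge h, mul_zero, zero_smul, add_zero, A.norm_map]

/-- Where the push is active, both `‖u‖ ^ 2` and `ε ^ 2` are below `R ^ 2 / 2`, by `4 ≤ C * R ^ 2`
and the bound on `ε`. -/
theorem norm_pushedPlane_lt {A : E2 →ₗᵢ[ℝ] E3} {n : E3} (hn : IsUnitNormal A n) {C ε R : ℝ} {u : E2}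
    (hC : 0 < C) (hR : 0 < R) (hCR : 4 ≤ C * R ^ 2) (hε : 2 * ε ^ 2 < R ^ 2)
    (h : C * ‖u‖ ^ 2 < 2) : ‖pushedPlane A n C ε u‖ < R := by
  have h1 : 2 * ‖u‖ ^ 2 < R ^ 2 := by
    have : C * (2 * ‖u‖ ^ 2) < C * R ^ 2 := by linarith
    exact lt_of_mul_lt_mul_left this hC.le
  have h2 : ‖pushedPlane A n C ε u‖ ^ 2 = ‖u‖ ^ 2 + (ε * cut C (‖u‖ ^ 2)) ^ 2 :=
    hn.norm_sq_decompose u _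
  have h3 : (cut C (‖u‖ ^ 2)) ^ 2 ≤ 1 := by
    have := cut_nonneg C (‖u‖ ^ 2)
    have := cut_le_one C (‖u‖ ^ 2)
    nlinarith
  have h4 : (ε * cut C (‖u‖ ^ 2)) ^ 2 ≤ ε ^ 2 := by
    rw [mul_pow]
    exact mul_le_of_le_one_right (sq_nonneg _) h3
  exact lt_of_pow_lt_pow_left₀ 2 hR.le (by linarith)

theorem norm_pushedPlane_lt_iff {A : E2 →ₗᵢ[ℝ] E3} {n : E3} (hn : IsUnitNormal A n) {C ε R : ℝ}
    {u : E2} (hC : 0 < C) (hR : 0 < R) (hCR : 4 ≤ C * R ^ 2) (hε : 2 * ε ^ 2 < R ^ 2) :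
    ‖pushedPlane A n C ε u‖ < R ↔ ‖u‖ < R := by
  rcases le_or_gt 2 (C * ‖u‖ ^ 2) with h | h
  · rw [norm_pushedPlane_of_le h]
  · refine ⟨fun _ => ?_, fun _ => norm_pushedPlane_lt hn hC hR hCR hε h⟩
    have : C * ‖u‖ ^ 2 < C * R ^ 2 := by linarith
    exact lt_of_pow_lt_pow_left₀ 2 hR.le (lt_of_mul_lt_mul_left this hC.le)

namespace PushedDiscs
variable {c : Fin 4 → E2 → F} {A : Fin 4 → E2 →ₗᵢ[ℝ] E3} {k : Fin 4} {n : E3} {C ε R : ℝ}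
  {h : F → E3} (P : PushedDiscs c A k n C ε R h)
include P

theorem norm_lt_iff (a : Fin 4) {u : E2} (hu : u ∈ Metric.closedBall (0 : E2) R) :
    ‖h (c a u)‖ < R ↔ ‖u‖ < R := by
  by_cases ha : a = k
  · subst ha
    rw [P.pushed u hu, norm_pushedPlane_lt_iff P.normal P.C_pos P.R_pos P.four_le P.ε_lt]
  · rw [P.linear a ha u hu, (A a).norm_map]

theorem norm_lt_iff_mem (x : F) : ‖h x‖ < R ↔ ∃ a, x ∈ c a '' Metric.ball 0 R := by
  constructor
  · intro hx
    have : x ∈ discs c R := by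
      rw [← P.preimage]; simpa using hx.le
    obtain ⟨a, u, hu, rfl⟩ := mem_iUnion.1 this
    exact ⟨a, u, by simpa using (P.norm_lt_iff a hu).1 hx, rfl⟩
  · rintro ⟨a, u, hu, rfl⟩
    exact (P.norm_lt_iff a (Metric.ball_subset_closedBall hu)).2 (by simpa using hu)

theorem eq_of_mem {a b : Fin 4} {x : F} (ha : x ∈ c a '' Metric.closedBall 0 R)
    (hb : x ∈ c b '' Metric.closedBall 0 R) : a = b := by
  by_contra hab
  exact disjoint_left.1 (P.disjoint a b hab) ha hb

theorem ball_subset (a : Fin 4) : c a '' Metric.ball 0 R ⊆ c a '' Metric.closedBall 0 R :=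
  image_mono Metric.ball_subset_closedBall

theorem isClosed_disc [T2Space F] (a : Fin 4) : IsClosed (c a '' Metric.closedBall 0 R) :=
  ((isCompact_closedBall _ _).image_of_continuousOn (P.continuousOn a)).isClosed

/-- The open disc is what remains of the open set `‖h x‖ < R` when the other three compact discs are
removed. -/
theorem isOpen_disc [T2Space F] (hh : Continuous h) (a : Fin 4) :
    IsOpen (c a '' Metric.ball 0 R) := by
  have h1 : c a '' Metric.ball 0 R =
      {x | ‖h x‖ < R} ∩ ⋂ b : Fin 4, {x | a ≠ b → x ∉ c b '' Metric.closedBall 0 R} := by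
    ext x
    constructor
    · refine fun hx => ⟨(P.norm_lt_iff_mem x).2 ⟨a, hx⟩, mem_iInter.2 fun b hab hb => ?_⟩
      exact hab (P.eq_of_mem (P.ball_subset a hx) hb)
    · rintro ⟨hx, hb⟩
      obtain ⟨b, hxb⟩ := (P.norm_lt_iff_mem x).1 hx
      by_cases hab : a = b
      · rwa [hab]
      · exact absurd (P.ball_subset b hxb) (mem_iInter.1 hb b hab)
  rw [h1]
  refine (isOpen_lt hh.norm continuous_const).inter (isOpen_iInter_of_finite fun b => ?_)
  by_cases hab : a = b
  · simp [hab]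
  · have : {x | a ≠ b → x ∉ c b '' Metric.closedBall 0 R} = (c b '' Metric.closedBall 0 R)ᶜ := by
      ext x
      exact ⟨fun hx => hx hab, fun hx _ => hx⟩
    rw [this]
    exact (P.isClosed_disc b).isOpen_compl

/-- The two branches of `twistOn` fit together smoothly: since `T.ρ < R ^ 2`, the twist is the
identity near points with `‖h x‖ ≥ R`, in particular at the boundary of the disc. -/
theorem twistOn_cases [T2Space F] (hh : Continuous h) (T : Twist) (hρ : T.ρ < R ^ 2) {s : ℝ}
    (hs : s ≤ 1) (x : F) :
    (∀ᶠ q : ℝ × F in 𝓝 (s, x), twistOn T (c k '' Metric.closedBall 0 R) h q.1 q.2 = h q.2) ∨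
    (∀ᶠ q : ℝ × F in 𝓝 (s, x),
      twistOn T (c k '' Metric.closedBall 0 R) h q.1 q.2 = T.map q.1 (h q.2)) := by
  by_cases hx : ‖h x‖ < R
  · obtain ⟨a, ha⟩ := (P.norm_lt_iff_mem x).1 hx
    have hev : ∀ᶠ q : ℝ × F in 𝓝 (s, x), q.2 ∈ c a '' Metric.ball 0 R :=
      continuousAt_snd.eventually ((P.isOpen_disc hh a).mem_nhds ha)
    by_cases hak : a = k
    · subst hak
      right
      filter_upwards [hev] with q hq
      exact twistOn_of_mem T h _ (P.ball_subset _ hq)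
    · left
      filter_upwards [hev] with q hq
      exact twistOn_of_notMem T h _ fun hq' => hak (P.eq_of_mem (P.ball_subset _ hq) hq')
  · left
    have hx' : T.ρ * s < ‖h x‖ ^ 2 := by
      have h1 : R ^ 2 ≤ ‖h x‖ ^ 2 := pow_le_pow_left₀ P.R_pos.le (not_lt.1 hx) 2
      have h2 : T.ρ * s ≤ T.ρ := mul_le_of_le_one_right T.ρ_pos.le hs
      linarith
    have hc1 : Continuous fun q : ℝ × F => T.ρ * q.1 := continuous_const.mul continuous_fst
    have hc2 : Continuous fun q : ℝ × F => ‖h q.2‖ ^ 2 := (hh.comp continuous_snd).norm.pow 2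
    have hev : ∀ᶠ q : ℝ × F in 𝓝 (s, x), T.ρ * q.1 < ‖h q.2‖ ^ 2 :=
      (hc1.continuousAt (x := (s, x))).eventually_lt (hc2.continuousAt (x := (s, x))) hx'
    filter_upwards [hev] with q hq
    exact twistOn_of_le T _ h hq.le

variable [ChartedSpace E2 F] [IsManifold (𝓡 2) ∞ F]

theorem contMDiffAt_twistOn [T2Space F] (hh : ContMDiff (𝓡 2) 𝓘(ℝ, E3) ∞ h) (T : Twist)
    (hρ : T.ρ < R ^ 2) {s : ℝ} (hs : s ≤ 1) (x : F) :
    ContMDiffAt ((𝓘(ℝ, ℝ)).prod (𝓡 2)) 𝓘(ℝ, E3) ∞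
      (fun q : ℝ × F => twistOn T (c k '' Metric.closedBall 0 R) h q.1 q.2) (s, x) := by
  have h1 : ContMDiff ((𝓘(ℝ, ℝ)).prod (𝓡 2)) 𝓘(ℝ, E3) ∞ fun q : ℝ × F => h q.2 :=
    hh.comp contMDiff_snd
  rcases P.twistOn_cases hh.continuous T hρ hs x with he | he
  · exact h1.contMDiffAt.congr_of_eventuallyEq he
  · have h2 : ContMDiff ((𝓘(ℝ, ℝ)).prod (𝓡 2)) 𝓘(ℝ, ℝ × E3) ∞ fun q : ℝ × F => (q.1, h q.2) :=
      contMDiff_fst.prodMk_space h1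
    have h3 := T.contDiff_map.contMDiff.comp h2
    exact h3.contMDiffAt.congr_of_eventuallyEq he

theorem twistOn_cases_right [T2Space F] (hh : Continuous h) (T : Twist) (hρ : T.ρ < R ^ 2) {s : ℝ}
    (hs : s ≤ 1) (x : F) :
    twistOn T (c k '' Metric.closedBall 0 R) h s =ᶠ[𝓝 x] h ∨
    twistOn T (c k '' Metric.closedBall 0 R) h s =ᶠ[𝓝 x] T.map s ∘ h := by
  have ht : Tendsto (fun y : F => (s, y)) (𝓝 x) (𝓝 (s, x)) :=
    (Continuous.prodMk_right s).tendsto x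
  rcases P.twistOn_cases hh T hρ hs x with he | he
  · exact Or.inl (ht.eventually he)
  · exact Or.inr (ht.eventually he)

theorem isImmersion_twistOn [T2Space F] (hh : IsImmersion h) (T : Twist) (hρ : T.ρ < R ^ 2)
    {s : ℝ} (hs : s ≤ 1) : IsImmersion (twistOn T (c k '' Metric.closedBall 0 R) h s) := by
  rw [isImmersion_iff] at hh ⊢
  obtain ⟨h1, h2⟩ := hh
  refine ⟨fun x => ?_, fun x => ?_⟩
  · have h3 : ContMDiff (𝓡 2) ((𝓘(ℝ, ℝ)).prod (𝓡 2)) ∞ fun y : F => (s, y) :=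
      contMDiff_const.prodMk contMDiff_id
    exact (P.contMDiffAt_twistOn h1 T hρ hs x).comp x (h3 x)
  · rcases P.twistOn_cases_right h1.continuous T hρ hs x with he | he
    · rw [chartDeriv_congr he]
      exact h2 x
    · rw [chartDeriv_congr he]
      have hd : DifferentiableAt ℝ (chartRep h x) (extChartAt (𝓡 2) x x) :=
        (contDiffAt_chartRep (mem_chart_source E2 x) (h1 x)).differentiableAt (by simp)
      have hT : DifferentiableAt ℝ (T.map s) (chartRep h x (extChartAt (𝓡 2) x x)) :=
        (T.contDiff_map_right s).differentiable (by simp) _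
      have e : chartDeriv (T.map s ∘ h) x = (fderiv ℝ (T.map s)
          (chartRep h x (extChartAt (𝓡 2) x x))).comp (chartDeriv h x) :=
        fderiv_comp _ hT hd
      rw [e, ContinuousLinearMap.coe_comp]
      exact (T.fderiv_map_injective s _).comp (h2 x)

end PushedDiscs

/-- Defining functions of four planes, the `k`-th of which is pushed and twisted. -/
def sheetFunction (T : Twist) (A : Fin 4 → E2 →ₗᵢ[ℝ] E3) (n : Fin 4 → E3) (k : Fin 4) (C ε : ℝ)
    (a : Fin 4) (s : ℝ) (y : E3) : ℝ :=
  if a = k then level T (A k) (n k) C ε s y else inner ℝ (n a) y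

section
variable {T : Twist} {A : Fin 4 → E2 →ₗᵢ[ℝ] E3} {n : Fin 4 → E3} {k : Fin 4} {C ε : ℝ}

theorem sheetFunction_self : sheetFunction T A n k C ε k = level T (A k) (n k) C ε := by
  funext s y; simp [sheetFunction]

theorem sheetFunction_of_ne {a : Fin 4} (ha : a ≠ k) :
    sheetFunction T A n k C ε a = fun _ y => inner ℝ (n a) y := by
  funext s y; simp [sheetFunction, ha]

theorem contDiff_sheetFunction (a : Fin 4) :
    ContDiff ℝ ∞ fun q : ℝ × E3 => sheetFunction T A n k C ε a q.1 q.2 := by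
  by_cases ha : a = k
  · subst ha
    rw [sheetFunction_self]
    have h1 : ContDiff ℝ ∞ fun q : ℝ × E3 => (ε, q.1, q.2) :=
      contDiff_const.prodMk (contDiff_fst.prodMk contDiff_snd)
    have h2 := (contDiff_level T C (A a) (n a)).comp h1
    exact h2
  · rw [sheetFunction_of_ne ha]
    exact contDiff_const.inner ℝ contDiff_snd

theorem contDiff_sheetFunction_right (a : Fin 4) (s : ℝ) :
    ContDiff ℝ ∞ (sheetFunction T A n k C ε a s) := by
  have h1 : ContDiff ℝ ∞ fun y : E3 => (s, y) := contDiff_const.prodMk contDiff_id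
  have h2 := (contDiff_sheetFunction (T := T) (A := A) (n := n) (k := k) (C := C) (ε := ε) a).comp h1
  exact h2

end

theorem PushedDiscs.localPicture [ChartedSpace E2 F] [IsManifold (𝓡 2) ∞ F] [T2Space F]
    {c : Fin 4 → E2 → F} {A : Fin 4 → E2 →ₗᵢ[ℝ] E3}
    {k : Fin 4} {n : Fin 4 → E3} {C ε R : ℝ} {h : F → E3} (P : PushedDiscs c A k (n k) C ε R h)
    (hn : ∀ a, IsUnitNormal (A a) (n a)) (hh : IsImmersion h) (T : Twist) (hρ : T.ρ < R ^ 2)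
    {s : ℝ} (hs : s ≤ 1) :
    LocalPicture (fun a => c a '' Metric.ball 0 R) (fun a => sheetFunction T A n k C ε a s)
      (twistOn T (c k '' Metric.closedBall 0 R) h s) R where
  imm := P.isImmersion_twistOn hh T hρ hs
  isOpen := P.isOpen_disc hh.1.continuous
  disj a b x ha hb := P.eq_of_mem (P.ball_subset a ha) (P.ball_subset b hb)
  norm_lt x := by rw [norm_twistOn]; exact P.norm_lt_iff_mem x
  inj a := by
    rintro _ ⟨u, hu, rfl⟩ _ ⟨v, hv, rfl⟩ huv
    have hu' := Metric.ball_subset_closedBall hu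
    have hv' := Metric.ball_subset_closedBall hv
    by_cases hak : a = k
    · subst hak
      rw [twistOn_of_mem T h s (mem_image_of_mem (c a) hu'), twistOn_of_mem T h s (mem_image_of_mem (c a) hv')] at huv
      have h1 := congrArg (T.inv s) huv
      rw [T.inv_map, T.inv_map, P.pushed u hu', P.pushed v hv'] at h1
      have h2 := congrArg (planeProj (A a)) h1
      rw [planeProj_pushedPlane C P.normal, planeProj_pushedPlane C P.normal] at h2
      rw [h2]
    · rw [twistOn_of_notMem T h s fun h' => hak (P.eq_of_mem (mem_image_of_mem _ hu') h'),
        twistOn_of_notMem T h s fun h' => hak (P.eq_of_mem ⟨v, hv', rfl⟩ h'),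
        P.linear a hak u hu', P.linear a hak v hv'] at huv
      rw [(A a).injective huv]
  smooth a := contDiff_sheetFunction_right a s
  zero a := by
    rintro _ ⟨u, hu, rfl⟩
    have hu' := Metric.ball_subset_closedBall hu
    by_cases hak : a = k
    · subst hak
      rw [twistOn_of_mem T h s (mem_image_of_mem (c a) hu'), sheetFunction_self, P.pushed u hu']
      exact level_map_pushedPlane T C P.normal ε s u
    · rw [twistOn_of_notMem T h s fun h' => hak (P.eq_of_mem (mem_image_of_mem _ hu') h'),
        sheetFunction_of_ne hak, P.linear a hak u hu']
      exact (hn a).inner_eq u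
  surj a p hp hz := by
    by_cases hak : a = k
    · subst hak
      simp only [sheetFunction_self] at hz
      have h1 := map_pushedPlane_of_level T C P.normal hz
      set u := planeProj (A a) (T.inv s p)
      have hu : ‖u‖ < R := by
        have h2 := P.normal.norm_planeProj_le (T.inv s p)
        rw [T.norm_inv] at h2
        exact (le_of_sq_le_sq h2 (norm_nonneg _)).trans_lt hp
      have hu1 : u ∈ Metric.ball (0 : E2) R := by simpa using hu
      have hu' := Metric.ball_subset_closedBall hu1
      refine ⟨c a u, ⟨u, hu1, rfl⟩, ?_⟩
      rw [twistOn_of_mem T h s (mem_image_of_mem (c a) hu'), P.pushed u hu', h1]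
    · simp only [sheetFunction_of_ne hak] at hz
      obtain ⟨u, rfl⟩ := (hn a).mem_range_iff.2 hz
      have hu : ‖u‖ < R := by
        have : ‖A a u‖ < R := hp
        rwa [(A a).norm_map] at this
      have hu1 : u ∈ Metric.ball (0 : E2) R := by simpa using hu
      have hu' := Metric.ball_subset_closedBall hu1
      refine ⟨c a u, ⟨u, hu1, rfl⟩, ?_⟩
      rw [twistOn_of_notMem T h s fun h' => hak (P.eq_of_mem (mem_image_of_mem _ hu') h'),
        P.linear a hak u hu']
      rfl

end

section
/-! ### Twisting a slightly pushed plane through three fixed planes -/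

theorem fderiv_inner_left (m p : E3) : fderiv ℝ (fun y : E3 => (inner ℝ m y : ℝ)) p = innerSL ℝ m :=
  (innerSL ℝ m).fderiv

theorem grad_inner (m p : E3) : grad (fun y : E3 => (inner ℝ m y : ℝ)) p = m := by
  refine ext_inner_right ℝ fun v => ?_
  rw [inner_grad, fderiv_inner_left, innerSL_apply_apply]

/-- The planes of `A` with unit normals `n`, except for the `k`-th, meet pairwise in the lines
spanned by the unit vectors `e`, and the `k`-th plane is twisted transversely to them. -/
structure IsTwistFrame (T : Twist) (A : Fin 4 → E2 →ₗᵢ[ℝ] E3) (k : Fin 4) (n e : Fin 4 → E3) :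
    Prop where
  normal : ∀ a, IsUnitNormal (A a) (n a)
  triple : ∀ v, (∀ a, a ≠ k → inner ℝ (n a) v = 0) → v = 0
  norm_line : ∀ l, l ≠ k → ‖e l‖ = 1
  line : ∀ l, l ≠ k → ∀ v, (∀ a, a ≠ l → a ≠ k → inner ℝ (n a) v = 0) → ∃ z : ℝ, v = z • e l
  inner_line : ∀ l a, l ≠ k → a ≠ l → a ≠ k → inner ℝ (n a) (e l) = 0
  transverse : ∀ a, a ≠ k → ∀ x, (inner ℝ (T.normal (n k) x) (n a) : ℝ) ^ 2 ≠ 1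
  slope : ∀ l, l ≠ k → ∀ x, T.height (n k) (e l) x = 0 → deriv (T.height (n k) (e l)) x ≠ 0

/-- The size of the push is so small that the twisted pushed plane behaves like the twisted plane
over the ball of radius `R`. -/
structure IsSmallPush (T : Twist) (A : Fin 4 → E2 →ₗᵢ[ℝ] E3) (k : Fin 4) (n e : Fin 4 → E3)
    (C ε R : ℝ) : Prop where
  transverse : ∀ a, a ≠ k → ∀ s ∈ Icc (0 : ℝ) 1, ∀ p, ‖p‖ ≤ R → level T (A k) (n k) C ε s p = 0 →
    (inner ℝ (n a) p : ℝ) = 0 →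
    ∃ v, (inner ℝ (n a) v : ℝ) = 0 ∧ fderiv ℝ (level T (A k) (n k) C ε s) p v ≠ 0
  nondegenerate : ∀ l, l ≠ k → ∀ s ∈ Icc (0 : ℝ) 1, ∀ z ∈ Icc (-R) R, ε ≠ 0 →
    IsLineTangency T C (A k) (n k) (e l) ε s z →
    deriv (fun s => level T (A k) (n k) C ε s (z • e l)) s ≠ 0 ∧
    fderiv ℝ (fderiv ℝ (level T (A k) (n k) C ε s)) (z • e l) (e l) (e l) ≠ 0
  unique : ∀ l, l ≠ k → ∀ s ∈ Icc (0 : ℝ) 1, ∀ z ∈ Icc (-R) R, ∀ z' ∈ Icc (-R) R, ε ≠ 0 →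
    IsLineTangency T C (A k) (n k) (e l) ε s z → IsLineTangency T C (A k) (n k) (e l) ε s z' →
    z = z'
  disjoint : ∀ l l', l ≠ k → l' ≠ k → l ≠ l' → ∀ s ∈ Icc (0 : ℝ) 1, ∀ z ∈ Icc (-R) R,
    ∀ z' ∈ Icc (-R) R, IsLineTangency T C (A k) (n k) (e l) ε s z →
    ¬ IsLineTangency T C (A k) (n k) (e l') ε s z'

namespace IsTwistFrame
variable {T : Twist} {A : Fin 4 → E2 →ₗᵢ[ℝ] E3} {k : Fin 4} {n e : Fin 4 → E3}
  (Φ : IsTwistFrame T A k n e)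
include Φ

theorem pair {a b : Fin 4} (hab : a ≠ b) (ha : a ≠ k) (hb : b ≠ k) {s t : ℝ}
    (h : s • n a + t • n b = 0) : s = 0 ∧ t = 0 := by
  have hli : LinearIndependent ℝ fun m : Fin 3 => n (k.succAbove m) :=
    linearIndependent_of_orthogonal fun v hv => Φ.triple v fun a ha => by
      obtain ⟨m, rfl⟩ := Fin.exists_succAbove_eq ha
      exact hv m
  obtain ⟨i, rfl⟩ := Fin.exists_succAbove_eq ha
  obtain ⟨j, rfl⟩ := Fin.exists_succAbove_eq hb
  have hij : i ≠ j := fun h => hab (by rw [h])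
  have hinj : Function.Injective ![i, j] := by
    intro x y hxy
    fin_cases x <;> fin_cases y <;> simp_all [eq_comm]
  have h2 := Fintype.linearIndependent_iff.1 (hli.comp _ hinj) ![s, t] (by simpa using h)
  exact ⟨h2 0, h2 1⟩

theorem inner_line_self {l : Fin 4} (hl : l ≠ k) : (inner ℝ (n l) (e l) : ℝ) ≠ 0 := fun h => by
  have h0 : e l = 0 := Φ.triple _ fun a ha => by
    by_cases hal : a = l
    · rwa [hal]
    · exact Φ.inner_line l a hl hal ha
  have := Φ.norm_line l hl
  rw [h0, norm_zero] at this
  norm_num at this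

/-- The two lines span the plane of the remaining fixed disc `d`. A normal orthogonal to both is
parallel to the normal of that plane, which `transverse` forbids. -/
theorem height_disjoint {l l' : Fin 4} (hl : l ≠ k) (hl' : l' ≠ k) (hll' : l ≠ l') {x : ℝ}
    (h : T.height (n k) (e l) x = 0) : T.height (n k) (e l') x ≠ 0 := fun h' => by
  obtain ⟨d, hdk, hdl, hdl', hd⟩ : ∃ d : Fin 4, d ≠ k ∧ d ≠ l ∧ d ≠ l' ∧
      ∀ a, a ≠ l' → a ≠ k → a = d ∨ a = l := by
    clear * - hl hl' hll'
    revert k l l'; decide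
  unfold Twist.height at h h'
  set N := T.normal (n k) x
  have hN : (inner ℝ N N : ℝ) = 1 := by
    rw [real_inner_self_eq_norm_sq, norm_normal T (Φ.normal k).norm_eq]; norm_num
  have hd1 := (Φ.normal d).inner_self
  obtain ⟨v, hv⟩ : ∃ v, v = N - (inner ℝ N (n d) : ℝ) • n d := ⟨_, rfl⟩
  have v1 : (inner ℝ (n d) v : ℝ) = 0 := by
    rw [hv, inner_sub_right, real_inner_smul_right, hd1, real_inner_comm]; ring
  have v2 : (inner ℝ v (e l) : ℝ) = 0 := by
    rw [hv, inner_sub_left, real_inner_smul_left, h, Φ.inner_line l d hl hdl hdk]; ring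
  have v3 : (inner ℝ v (e l') : ℝ) = 0 := by
    rw [hv, inner_sub_left, real_inner_smul_left, h', Φ.inner_line l' d hl' hdl' hdk]; ring
  have v4 : (inner ℝ v v : ℝ) = 1 - (inner ℝ N (n d) : ℝ) ^ 2 := by
    conv_lhs => rw [hv]
    simp only [inner_sub_left, inner_sub_right, real_inner_smul_left, real_inner_smul_right, hN,
      hd1, real_inner_comm N (n d)]
    ring
  have hne := Φ.inner_line_self hl
  obtain ⟨z', hz'⟩ := Φ.line l' hl' (v - ((inner ℝ (n l) v : ℝ) / inner ℝ (n l) (e l)) • e l)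
    fun a ha ha' => by
      rcases hd a ha ha' with rfl | rfl
      · rw [inner_sub_right, real_inner_smul_right, v1, Φ.inner_line l a hl hdl hdk]; ring
      · rw [inner_sub_right, real_inner_smul_right]
        field_simp
        ring
  have v5 : (inner ℝ v v : ℝ) = 0 := by
    have : v = z' • e l' + ((inner ℝ (n l) v : ℝ) / inner ℝ (n l) (e l)) • e l := by
      rw [← hz']; abel
    nth_rewrite 2 [this]
    rw [inner_add_right, real_inner_smul_right, real_inner_smul_right, v2, v3]
    ring
  exact Φ.transverse d hdk x (by linarith)

theorem eventually_isSmallPush {C : ℝ} (hC : 0 < C) (R : ℝ) :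
    ∀ᶠ ε in 𝓝 (0 : ℝ), IsSmallPush T A k n e C ε R := by
  have h1 : ∀ a, a ≠ k → _ := fun a ha => eventually_transverse T C (A k) (n k)
    (Φ.normal a).norm_eq (Φ.normal k).norm_eq (Φ.transverse a ha) R
  have h2 : ∀ l, l ≠ k → _ := fun l hl => eventually_isLineTangency_nondegenerate T C (Φ.normal k)
    hC (Φ.norm_line l hl) (Φ.slope l hl) R
  have h3 : ∀ l, l ≠ k → _ := fun l hl => eventually_isLineTangency_unique T C (Φ.normal k)
    hC (Φ.norm_line l hl) (Φ.slope l hl) R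
  have h4 : ∀ l, l ≠ k → ∀ l', l' ≠ k → l ≠ l' → _ := fun l hl l' hl' hll' =>
    eventually_isLineTangency_disjoint (A := A k) T C (Φ.norm_line l hl) (Φ.norm_line l' hl')
      (Φ.slope l hl) (Φ.slope l' hl') (fun x => Φ.height_disjoint hl hl' hll') R
  simp only [← eventually_imp_distrib_left, ← eventually_all] at h1 h2 h3 h4
  filter_upwards [h1, h2, h3, h4] with ε k1 k2 k3 k4
  exact ⟨fun a ha s hs p hp => k1 a ha (s, p) ⟨hs, by simpa using hp⟩,
    fun l hl s hs z hz => k2 l hl (s, z) ⟨hs, hz⟩,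
    fun l hl s hs z hz z' hz' => k3 l hl (s, z, z') ⟨hs, hz, hz'⟩,
    fun l l' hl hl' hll' s hs z hz z' hz' => k4 l hl l' hl' hll' (s, z, z') ⟨hs, hz, hz'⟩⟩

variable {C ε R s : ℝ} {p : E3}

theorem sheet_pair (S : IsSmallPush T A k n e C ε R) (hs : s ∈ Icc (0 : ℝ) 1) (hp : ‖p‖ < R)
    (a b : Fin 4) (hab : a ≠ b) (ha : sheetFunction T A n k C ε a s p = 0)
    (hb : sheetFunction T A n k C ε b s p = 0) (t t' : ℝ)
    (h : t • grad (sheetFunction T A n k C ε a s) p + t' • grad (sheetFunction T A n k C ε b s) p =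
      0) : t = 0 ∧ t' = 0 := by
  have key : ∀ b, b ≠ k → level T (A k) (n k) C ε s p = 0 → (inner ℝ (n b) p : ℝ) = 0 →
      ∀ t t' : ℝ, t • grad (level T (A k) (n k) C ε s) p + t' • n b = 0 → t = 0 ∧ t' = 0 := by
    intro b hb h1 h2 t t' h
    obtain ⟨v, v1, v2⟩ := S.transverse b hb s hs p hp.le h1 h2
    have ht : t = 0 := by
      have := congrArg (fun w => (inner ℝ w v : ℝ)) h
      simp only [inner_add_left, real_inner_smul_left, v1, inner_zero_left, inner_grad] at this
      simpa [v2] using this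
    refine ⟨ht, ?_⟩
    rw [ht, zero_smul, zero_add] at h
    exact (smul_eq_zero.1 h).resolve_right (Φ.normal b).ne_zero
  by_cases hak : a = k
  · subst hak
    rw [sheetFunction_self, sheetFunction_of_ne hab.symm] at h
    rw [sheetFunction_self] at ha
    rw [sheetFunction_of_ne hab.symm] at hb
    rw [grad_inner] at h
    exact key b hab.symm ha hb t t' h
  · by_cases hbk : b = k
    · subst hbk
      rw [sheetFunction_self, sheetFunction_of_ne hab] at h
      rw [sheetFunction_self] at hb
      rw [sheetFunction_of_ne hab] at ha
      rw [grad_inner, add_comm] at h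
      exact (key a hab hb ha t' t h).symm
    · rw [sheetFunction_of_ne hak, sheetFunction_of_ne hbk, grad_inner, grad_inner] at h
      exact Φ.pair hab hak hbk h

/-- If three of the sheets that meet at a point are not transverse, then one of them is the twisted
plane, and it is tangent to the intersection line of the other two. -/
theorem sheet_triple (l : Fin 4) (hl : ∀ a, a ≠ l → sheetFunction T A n k C ε a s p = 0) {v : E3}
    (hv : ∀ a, a ≠ l → inner ℝ (grad (sheetFunction T A n k C ε a s) p) v = 0) (hv0 : v ≠ 0) :
    l ≠ k ∧ ∃ z : ℝ, p = z • e l ∧ IsLineTangency T C (A k) (n k) (e l) ε s z := by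
  have hlk : l ≠ k := fun h => by
    subst h
    refine hv0 (Φ.triple v fun a ha => ?_)
    have := hv a ha
    rwa [sheetFunction_of_ne ha, grad_inner] at this
  refine ⟨hlk, ?_⟩
  obtain ⟨z, rfl⟩ := Φ.line l hlk p fun a ha hak => by
    have := hl a ha
    rwa [sheetFunction_of_ne hak] at this
  obtain ⟨z', rfl⟩ := Φ.line l hlk v fun a ha hak => by
    have := hv a ha
    rwa [sheetFunction_of_ne hak, grad_inner] at this
  have h1 := hl k hlk.symm
  have h2 := hv k hlk.symm
  rw [sheetFunction_self] at h1 h2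
  rw [inner_grad, map_smul, smul_eq_mul] at h2
  refine ⟨z, rfl, h1, (mul_eq_zero.1 h2).resolve_left fun h => hv0 (by rw [h, zero_smul])⟩

theorem eq_zero_of_forall (hp : ∀ a, a ≠ k → sheetFunction T A n k C ε a s p = 0) : p = 0 :=
  Φ.triple p fun a ha => by
    have := hp a ha
    rwa [sheetFunction_of_ne ha] at this

/-- The fixed planes meet only at the origin, where the function of the pushed disc has the value
`-ε` at all times. This is what rules out quadruple points. -/
theorem exists_sheetFunction_ne_zero (hC : 0 < C) (hε : ε ≠ 0) :
    ∃ a, sheetFunction T A n k C ε a s p ≠ 0 := by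
  by_contra! h
  have hp := Φ.eq_zero_of_forall fun a _ => h a
  have := h k
  rw [sheetFunction_self, hp, level_of_lt T C (Φ.normal k) hC (by simp), level_zero] at this
  simp [hε] at this

end IsTwistFrame

variable {F : Type*} [TopologicalSpace F] [ChartedSpace E2 F] [IsManifold (𝓡 2) ∞ F] [T2Space F]
  {c : Fin 4 → E2 → F} {T : Twist} {A : Fin 4 → E2 →ₗᵢ[ℝ] E3} {k : Fin 4} {n e : Fin 4 → E3}
  {C ε R : ℝ} {h : F → E3}

/-- A twist preserves norms and does nothing at norm `R` and beyond. -/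
theorem PushedDiscs.preimage_twistOn (T : Twist) (D : Set F) (hR : 0 < R) (hρ : T.ρ < R ^ 2)
    {s : ℝ} (hs : s ≤ 1) {p : E3} (hp : R ≤ ‖p‖) : twistOn T D h s ⁻¹' {p} = h ⁻¹' {p} := by
  have key : ∀ x, ‖h x‖ = ‖p‖ → twistOn T D h s x = h x := fun x hx => by
    refine twistOn_of_le T D h ?_
    rw [hx]
    have h1 : R ^ 2 ≤ ‖p‖ ^ 2 := pow_le_pow_left₀ hR.le hp 2
    have h2 : T.ρ * s ≤ T.ρ := mul_le_of_le_one_right T.ρ_pos.le hs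
    linarith
  ext x
  constructor
  · intro hx
    have hx' : twistOn T D h s x = p := hx
    have h1 : ‖h x‖ = ‖p‖ := by rw [← hx', norm_twistOn]
    exact (key x h1).symm.trans hx'
  · intro hx
    have hx' : h x = p := hx
    exact (key x (by rw [hx'])).trans hx'

theorem twistOn_eventuallyEq (hh : Continuous h) (T : Twist) (D : Set F) (hR : 0 < R)
    (hρ : T.ρ < R ^ 2) {s : ℝ} (hs : s ≤ 1) {x : F} (hx : R ≤ ‖h x‖) :
    twistOn T D h s =ᶠ[𝓝 x] h := by
  have hx' : T.ρ * s < ‖h x‖ ^ 2 := by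
    have h1 : R ^ 2 ≤ ‖h x‖ ^ 2 := pow_le_pow_left₀ hR.le hx 2
    have h2 : T.ρ * s ≤ T.ρ := mul_le_of_le_one_right T.ρ_pos.le hs
    linarith
  filter_upwards [(hh.norm.pow 2).continuousAt.eventually (lt_mem_nhds hx')] with y hy
  exact twistOn_of_le T D h hy.le

theorem isStableAt_twistOn_iff (hh : Continuous h) (T : Twist) (D : Set F) (hR : 0 < R)
    (hρ : T.ρ < R ^ 2) {s : ℝ} (hs : s ≤ 1) {p : E3} (hp : R ≤ ‖p‖) :
    IsStableAt (twistOn T D h s) p ↔ IsStableAt h p :=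
  isStableAt_congr (PushedDiscs.preimage_twistOn T D hR hρ hs hp) fun x hx =>
    twistOn_eventuallyEq hh T D hR hρ hs (by rw [← norm_twistOn T D h s, hx]; exact hp)

theorem isGenericQuadruplePoint_twistOn_iff (hh : Continuous h) (T : Twist) (D : Set F) (hR : 0 < R)
    (hρ : T.ρ < R ^ 2) {s : ℝ} (hs : s ≤ 1) {p : E3} (hp : R ≤ ‖p‖) :
    IsGenericQuadruplePoint (twistOn T D h s) p ↔ IsGenericQuadruplePoint h p :=
  isGenericQuadruplePoint_congr (PushedDiscs.preimage_twistOn T D hR hρ hs hp) fun x hx =>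
    twistOn_eventuallyEq hh T D hR hρ hs (by rw [← norm_twistOn T D h s, hx]; exact hp)

theorem PushedDiscs.isRegularHomotopy (P : PushedDiscs c A k (n k) C ε R h) (hh : IsImmersion h)
    (T : Twist) (hρ : T.ρ < R ^ 2) :
    IsRegularHomotopy (twistOn T (c k '' Metric.closedBall 0 R) h) :=
  ⟨fun q hq => (P.contMDiffAt_twistOn hh.1 T hρ hq.1.2 q.2).contMDiffWithinAt,
    fun _ ht => P.isImmersion_twistOn hh T hρ ht.2⟩

/-- Outside the ball nothing changes. Inside, pairs of sheets are transverse and four sheets never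
meet, so only a failure of triple transversality remains, which by `sheet_triple` is a tangency with
a line. -/
theorem PushedDiscs.exists_tangency_of_not_isStableAt (P : PushedDiscs c A k (n k) C ε R h)
    (Φ : IsTwistFrame T A k n e) (S : IsSmallPush T A k n e C ε R) (hh : IsGenericImmersion h)
    (hρ : T.ρ < R ^ 2) (hε : ε ≠ 0) {s : ℝ} (hs : s ∈ Icc (0 : ℝ) 1) {p : E3}
    (hp : ¬ IsStableAt (twistOn T (c k '' Metric.closedBall 0 R) h s) p) :
    ‖p‖ < R ∧ ∃ l, l ≠ k ∧ (∀ a, a ≠ l → sheetFunction T A n k C ε a s p = 0) ∧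
      ∃ z : ℝ, p = z • e l ∧ IsLineTangency T C (A k) (n k) (e l) ε s z := by
  have hpR : ‖p‖ < R := by
    by_contra hR
    exact hp ((isStableAt_twistOn_iff hh.1.1.continuous T _ P.R_pos hρ hs.2 (not_lt.1 hR)).2
      (hh.2 p))
  refine ⟨hpR, ?_⟩
  by_contra! hl
  refine hp ((P.localPicture Φ.normal hh.1 T hρ hs.2).isStableAt hpR (Φ.sheet_pair S hs hpR)
    (fun l hl0 v hv => ?_) (Φ.exists_sheetFunction_ne_zero P.C_pos hε))
  by_contra hv0
  obtain ⟨h1, z, h2, h3⟩ := Φ.sheet_triple l hl0 hv hv0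
  exact hl l h1 hl0 z h2 h3

theorem PushedDiscs.noQuadruplePoints (P : PushedDiscs c A k (n k) C ε R h)
    (Φ : IsTwistFrame T A k n e) (hh : IsGenericImmersion h) (hρ : T.ρ < R ^ 2) (hε : ε ≠ 0) :
    NoQuadruplePoints (twistOn T (c k '' Metric.closedBall 0 R) h) := by
  intro s hs p
  refine lt_of_le_of_lt (b := 3) ?_ (by norm_num)
  rcases lt_or_ge ‖p‖ R with hp | hp
  · exact (P.localPicture Φ.normal hh.1 T hρ hs.2).encard_preimage_le hp
      (Φ.exists_sheetFunction_ne_zero P.C_pos hε)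
  · rw [preimage_twistOn T _ P.R_pos hρ hs.2 hp]
    exact (hh.2 p).1

/-- All unstable points are line tangencies. Uniqueness on each line and disjointness between lines
leave at most one at a time, and nondegeneracy makes it a codimension one event of three sheets. -/
theorem PushedDiscs.isGenericRegularHomotopy (P : PushedDiscs c A k (n k) C ε R h)
    (Φ : IsTwistFrame T A k n e) (S : IsSmallPush T A k n e C ε R) (hh : IsGenericImmersion h)
    (hρ : T.ρ < R ^ 2) (hε : ε ≠ 0)
    (h1 : IsGenericImmersion (twistOn T (c k '' Metric.closedBall 0 R) h 1)) :
    IsGenericRegularHomotopy (twistOn T (c k '' Metric.closedBall 0 R) h) := by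
  have hz : ∀ {z : ℝ} {l : Fin 4}, l ≠ k → ‖z • e l‖ < R → z ∈ Icc (-R) R := fun hl hz => by
    rw [norm_smul, Φ.norm_line _ hl, mul_one, Real.norm_eq_abs] at hz
    exact abs_le.1 hz.le
  refine ⟨P.isRegularHomotopy hh.1 T hρ, ?_, h1, fun t ht p hp p' hp' => ?_, fun t ht p hp => ?_⟩
  · rwa [twistOn_zero]
  · have ht' := Ioo_subset_Icc_self ht
    obtain ⟨a1, l, hl, -, z, rfl, a2⟩ := P.exists_tangency_of_not_isStableAt Φ S hh hρ hε ht' hp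
    obtain ⟨b1, l', hl', -, z', rfl, b2⟩ := P.exists_tangency_of_not_isStableAt Φ S hh hρ hε ht' hp'
    by_cases hll' : l = l'
    · subst hll'
      rw [S.unique l hl t ht' z (hz hl a1) z' (hz hl' b1) hε a2 b2]
    · exact absurd b2 (S.disjoint l l' hl hl' hll' t ht' z (hz hl a1) z' (hz hl' b1) a2)
  · have ht' := Ioo_subset_Icc_self ht
    obtain ⟨a1, l, hl, hl0, z, rfl, a2⟩ := P.exists_tangency_of_not_isStableAt Φ S hh hρ hε ht' hp
    obtain ⟨n1, n2⟩ := S.nondegenerate l hl t ht' z (hz hl a1) hε a2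
    obtain ⟨b, hb⟩ := Φ.exists_sheetFunction_ne_zero (s := t) (p := z • e l) P.C_pos hε
    have hbl : b = l := by
      by_contra hbl
      exact hb (hl0 b hbl)
    subst hbl
    refine (P.localPicture Φ.normal hh.1 T hρ ht'.2).isCodimOneEvent (k := k) (l := b) (e := e b)
      (G := fun a s => sheetFunction T A n k C ε a s) a1 hl.symm ?_
      (fun a => ⟨fun h => ?_, hl0 a⟩) (fun a a' haa' ha ha' => ?_) (fun a ha => ?_) (fun v hv => ?_)
      contDiff_sheetFunction (fun x => ?_) (fun a x hx s => ?_) (fun a ha hak => ?_) ?_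
      (fun a ha hak => ?_) ?_
    · intro h0
      have := Φ.norm_line b hl
      rw [h0, norm_zero] at this
      norm_num at this
    · rintro rfl
      exact hb h
    · exact Φ.sheet_pair S ht' a1 a a' haa' (hl0 a ha) (hl0 a' ha')
    · by_cases hak : a = k
      · subst hak
        rw [sheetFunction_self, inner_grad]
        exact a2.2
      · rw [sheetFunction_of_ne hak, grad_inner]
        exact Φ.inner_line b a hl ha hak
    · refine Φ.line b hl v fun a ha hak => ?_
      have := hv a ha hak
      rwa [sheetFunction_of_ne hak, grad_inner] at this
    · by_cases hx : x ∈ c k '' Metric.closedBall 0 R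
      · simp only [twistOn_of_mem T h _ hx]
        have h2 : ContDiff ℝ ∞ fun s : ℝ => (s, h x) := contDiff_id.prodMk contDiff_const
        have h3 := T.contDiff_map.comp h2
        exact h3.differentiable (by simp) t
      · simp only [twistOn_of_notMem T h _ hx]
        exact differentiableAt_const _
    · obtain ⟨u, hu, rfl⟩ := hx
      have hu' := Metric.ball_subset_closedBall hu
      by_cases hak : a = k
      · subst hak
        rw [twistOn_of_mem T h s (mem_image_of_mem (c a) hu'), sheetFunction_self, P.pushed u hu']
        exact level_map_pushedPlane T C P.normal ε s u
      · rw [twistOn_of_notMem T h s fun h' => hak (P.eq_of_mem (mem_image_of_mem _ hu') h'),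
          sheetFunction_of_ne hak, P.linear a hak u hu']
        exact (Φ.normal a).inner_eq u
    · simp only [sheetFunction_of_ne hak]
      exact deriv_const _ _
    · rw [sheetFunction_self]; exact n1
    · rw [sheetFunction_of_ne hak]
      have : fderiv ℝ (fun y : E3 => (inner ℝ (n a) y : ℝ)) = fun _ => innerSL ℝ (n a) :=
        funext fun p => fderiv_inner_left _ p
      rw [this, fderiv_fun_const]
      simp
    · rw [sheetFunction_self]; exact n2

/-- The twisted flat discs have a generic quadruple point at the origin, and no other unstable self
intersections inside the ball, at those times at which the planes at the origin are in general
position. -/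
theorem PushedDiscs.isGenericQuadruplePoint_zero (P : PushedDiscs c A k (n k) C 0 R h)
    (Φ : IsTwistFrame T A k n e) (hh : IsImmersion h) (hρ : T.ρ < R ^ 2) {s : ℝ}
    (hs : s ∈ Icc (0 : ℝ) 1) (hgp : ∀ l, l ≠ k → T.height (n k) (e l) (T.phase s 0) ≠ 0) :
    IsGenericQuadruplePoint (twistOn T (c k '' Metric.closedBall 0 R) h s) 0 ∧
    ∀ p, ‖p‖ < R → p ≠ 0 → IsStableAt (twistOn T (c k '' Metric.closedBall 0 R) h s) p := by
  -- Smallness holds in a full neighbourhood of `0`, hence for the unpushed disc itself.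
  have S : IsSmallPush T A k n e C 0 R := (Φ.eventually_isSmallPush P.C_pos R).self_of_nhds
  have L := P.localPicture Φ.normal hh T hρ hs.2
  have hno : ∀ l, l ≠ k → ∀ z, ¬ IsLineTangency T C (A k) (n k) (e l) 0 s z := fun l hl z =>
    (eventually_not_isLineTangency (A := A k) T C (Φ.norm_line l hl) (Φ.slope l hl)
      fun h => hgp l hl h.2).self_of_nhds
  have htriple : ∀ p l, (∀ a, a ≠ l → sheetFunction T A n k C 0 a s p = 0) → ∀ v,
      (∀ a, a ≠ l → inner ℝ (grad (sheetFunction T A n k C 0 a s) p) v = 0) → v = 0 := by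
    intro p l hl v hv
    by_contra hv0
    obtain ⟨h1, z, h2, h3⟩ := Φ.sheet_triple l hl hv hv0
    exact hno l h1 z h3
  refine ⟨L.isGenericQuadruplePoint (by simpa using P.R_pos)
    (Φ.sheet_pair S hs (by simpa using P.R_pos)) (htriple 0) fun a => ?_, fun p hp hp0 => ?_⟩
  · by_cases hak : a = k
    · subst hak
      rw [sheetFunction_self, level_zero]; simp
    · rw [sheetFunction_of_ne hak]; simp
  · refine L.isStableAt hp (Φ.sheet_pair S hs hp) (htriple p) ?_
    by_contra! h
    exact hp0 (Φ.eq_zero_of_forall fun a _ => h a)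

end

section
/-! ### Twisting does not change the values of q-invariants -/

variable {F : Type*} [TopologicalSpace F]

/-- The part of `h` over the ball of radius `R` consists of four disjoint flat discs. -/
structure FlatDiscs (c : Fin 4 → E2 → F) (A : Fin 4 → E2 →ₗᵢ[ℝ] E3) (R : ℝ) (h : F → E3) :
    Prop where
  continuousOn : ∀ a, ContinuousOn (c a) (Metric.closedBall 0 R)
  disjoint : ∀ a b, a ≠ b →
    Disjoint (c a '' Metric.closedBall 0 R) (c b '' Metric.closedBall 0 R)
  preimage : h ⁻¹' Metric.closedBall 0 R = discs c R
  linear : ∀ a, ∀ u ∈ Metric.closedBall (0 : E2) R, h (c a u) = A a u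

namespace FlatDiscs
variable {c : Fin 4 → E2 → F} {A : Fin 4 → E2 →ₗᵢ[ℝ] E3} {R : ℝ} {h : F → E3}

theorem mono (P : FlatDiscs c A R h) {r : ℝ} (hr : r ≤ R) : FlatDiscs c A r h where
  continuousOn a := (P.continuousOn a).mono (Metric.closedBall_subset_closedBall hr)
  disjoint a b hab := (P.disjoint a b hab).mono (image_mono (Metric.closedBall_subset_closedBall hr))
    (image_mono (Metric.closedBall_subset_closedBall hr))
  preimage := by
    ext x
    constructor
    · intro hx
      have hx' : x ∈ discs c R := by
        rw [← P.preimage]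
        exact Metric.closedBall_subset_closedBall hr hx
      obtain ⟨a, u, hu, rfl⟩ := mem_iUnion.1 hx'
      rw [mem_preimage, P.linear a u hu, mem_closedBall_zero_iff, (A a).norm_map] at hx
      exact mem_iUnion.2 ⟨a, u, by simpa using hx, rfl⟩
    · intro hx
      obtain ⟨a, u, hu, rfl⟩ := mem_iUnion.1 hx
      rw [mem_preimage, P.linear a u (Metric.closedBall_subset_closedBall hr hu),
        mem_closedBall_zero_iff, (A a).norm_map]
      simpa using hu
  linear a u hu := P.linear a u (Metric.closedBall_subset_closedBall hr hu)

theorem pushedDiscs (P : FlatDiscs c A R h) {k : Fin 4} {n : E3} (hn : IsUnitNormal (A k) n)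
    {C : ℝ} (hC : 0 < C) (hR : 0 < R) (hCR : 4 ≤ C * R ^ 2) : PushedDiscs c A k n C 0 R h where
  continuousOn := P.continuousOn
  disjoint := P.disjoint
  preimage := P.preimage
  linear a _ := P.linear a
  pushed u hu := by rw [P.linear k u hu, pushedPlane, zero_mul, zero_smul, add_zero]
  normal := hn
  R_pos := hR
  C_pos := hC
  four_le := hCR
  ε_lt := by have := pow_pos hR 2; simpa using this

end FlatDiscs

open Classical in
/-- A push of the disc `D`, which is flat and parallel to `A`, near its centre. -/
def centralPush (D : Set F) (A : E2 →ₗᵢ[ℝ] E3) (n : E3) (C : ℝ) (i : F → E3) (x : F) : E3 :=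
  if x ∈ D then cut C (‖planeProj A (i x)‖ ^ 2) • n else 0

theorem centralPush_of_mem {D : Set F} (A : E2 →ₗᵢ[ℝ] E3) (n : E3) (C : ℝ) (i : F → E3) {x : F}
    (hx : x ∈ D) : centralPush D A n C i x = cut C (‖planeProj A (i x)‖ ^ 2) • n := if_pos hx

theorem centralPush_of_notMem {D : Set F} (A : E2 →ₗᵢ[ℝ] E3) (n : E3) (C : ℝ) (i : F → E3) {x : F}
    (hx : x ∉ D) : centralPush D A n C i x = 0 := if_neg hx

variable [ChartedSpace E2 F] [IsManifold (𝓡 2) ∞ F] [CompactSpace F] [T2Space F]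
  {c : Fin 4 → E2 → F} {T : Twist} {A : Fin 4 → E2 →ₗᵢ[ℝ] E3} {k : Fin 4} {n e : Fin 4 → E3}
  {C R : ℝ} {i : F → E3} {m : ℕ}

theorem PushedDiscs.contMDiff_centralPush {n : E3} (P : PushedDiscs c A k n C 0 R i)
    (hi : ContMDiff (𝓡 2) 𝓘(ℝ, E3) ∞ i) :
    ContMDiff (𝓡 2) 𝓘(ℝ, E3) ∞ (centralPush (c k '' Metric.closedBall 0 R) (A k) n C i) := by
  have h1 : ContMDiff (𝓡 2) 𝓘(ℝ, E3) ∞ fun x => cut C (‖planeProj (A k) (i x)‖ ^ 2) • n := by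
    have h2 : ContDiff ℝ ∞ fun y : E3 => cut C (‖planeProj (A k) y‖ ^ 2) • n :=
      ((contDiff_cut C).comp ((planeProj (A k)).contDiff.norm_sq ℝ)).smul contDiff_const
    exact h2.contMDiff.comp hi
  have h0 : ContMDiff (𝓡 2) 𝓘(ℝ, E3) ∞ fun _ : F => (0 : E3) := contMDiff_const
  intro x
  by_cases hx : x ∈ c k '' Metric.closedBall 0 R
  swap
  · refine (h0 x).congr_of_eventuallyEq ?_
    filter_upwards [(P.isClosed_disc k).isOpen_compl.mem_nhds hx] with y hy
    exact centralPush_of_notMem _ _ _ _ hy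
  by_cases hx' : x ∈ c k '' Metric.ball 0 R
  · refine (h1 x).congr_of_eventuallyEq ?_
    filter_upwards [(P.isOpen_disc hi.continuous k).mem_nhds hx'] with y hy
    exact centralPush_of_mem _ _ _ _ (P.ball_subset k hy)
  · refine (h0 x).congr_of_eventuallyEq ?_
    obtain ⟨u, hu, rfl⟩ := hx
    have hu' : ‖u‖ = R := by
      refine le_antisymm (by simpa using hu) (not_lt.1 fun h => hx' ⟨u, by simpa using h, rfl⟩)
    -- On the boundary circle the cutoff parameter is `C * R ^ 2 ≥ 4`, so the push vanishes nearby
    -- and its extension by zero is smooth.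
    have h3 : 2 < C * ‖planeProj (A k) (i (c k u))‖ ^ 2 := by
      rw [P.pushed u hu, planeProj_pushedPlane C P.normal, hu']
      linarith [P.four_le]
    have hc : Continuous fun x => C * ‖planeProj (A k) (i x)‖ ^ 2 :=
      continuous_const.mul (((planeProj (A k)).continuous.comp hi.continuous).norm.pow 2)
    filter_upwards [hc.continuousAt.eventually (lt_mem_nhds h3)] with y hy
    unfold centralPush
    split_ifs
    · rw [cut_of_ge hy.le, zero_smul]
    · rfl

/-- The direction of the central push of a twisted disc. -/
def twistedPush (T : Twist) (D : Set F) (A : E2 →ₗᵢ[ℝ] E3) (n : E3) (C : ℝ) (i : F → E3) (s : ℝ)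
    (x : F) : E3 :=
  rot T.m₁ T.m₂ (T.angle (T.phase s 0)) (centralPush D A n C i x)

theorem twistedPush_of_notMem (T : Twist) {D : Set F} (A : E2 →ₗᵢ[ℝ] E3) (n : E3) (C : ℝ)
    (i : F → E3) (s : ℝ) {x : F} (hx : x ∉ D) : twistedPush T D A n C i s x = 0 := by
  rw [twistedPush, centralPush_of_notMem _ _ _ _ hx]
  have := rot_smul T.m₁ T.m₂ (T.angle (T.phase s 0)) 0 0
  simpa using this

theorem twistedPush_zero (T : Twist) (D : Set F) (A : E2 →ₗᵢ[ℝ] E3) (n : E3) (C : ℝ) (i : F → E3) :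
    twistedPush T D A n C i 0 = centralPush D A n C i := by
  funext x
  have : T.angle (T.phase 0 0) = 0 := by
    simp [Twist.angle, Twist.phase, ramp_of_nonpos]
  rw [twistedPush, this, rot_zero]

section
variable {R₀ : ℝ} (P : FlatDiscs c A R₀ i) (Φ : IsTwistFrame T A k n e) (hi : MemI m i)
  (hC : 0 < C) (hR : 0 < R) (hCR : 4 ≤ C * R ^ 2) (hRR : R < R₀) (hρ : T.ρ < R ^ 2)
  (hgp₀ : ∀ l, l ≠ k → (inner ℝ (n k) (e l) : ℝ) ≠ 0)
include P Φ hi hC hR hCR hRR hρ hgp₀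

/-- At times with planes in general position, the origin is the only unstable point in the ball,
before and after the twist; outside the ball nothing changes. -/
theorem memI_twistOn {s : ℝ} (hs : s ∈ Icc (0 : ℝ) 1)
    (hgp : ∀ l, l ≠ k → T.height (n k) (e l) (T.phase s 0) ≠ 0) :
    MemI m (twistOn T (c k '' Metric.closedBall 0 R) i s) ∧
      quadruplePoints (twistOn T (c k '' Metric.closedBall 0 R) i s) = quadruplePoints i := by
  have Q := (P.mono hRR.le).pushedDiscs (Φ.normal k) hC hR hCR
  have hi' := hi.1.1.continuous
  obtain ⟨q1, q2⟩ := Q.isGenericQuadruplePoint_zero Φ hi.1 hρ hs hgp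
  obtain ⟨q3, q4⟩ := Q.isGenericQuadruplePoint_zero Φ hi.1 hρ (s := 0) (by simp) fun l hl => by
    have : T.angle (T.phase 0 0) = 0 := by simp [Twist.angle, Twist.phase, ramp_of_nonpos]
    rw [Twist.height, Twist.normal, this, rot_zero]
    exact hgp₀ l hl
  rw [twistOn_zero] at q3 q4
  have hns : ∀ {h : F → E3} {p : E3}, IsStableAt h p → ¬ IsGenericQuadruplePoint h p :=
    fun h1 h2 => by
      have := h1.1
      rw [h2.1] at this
      norm_num at this
  have hQ : quadruplePoints (twistOn T (c k '' Metric.closedBall 0 R) i s) = quadruplePoints i := by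
    ext p
    show IsGenericQuadruplePoint _ p ↔ IsGenericQuadruplePoint _ p
    rcases lt_or_ge ‖p‖ R with hp | hp
    · by_cases hp0 : p = 0
      · subst hp0; exact iff_of_true q1 q3
      · exact iff_of_false (hns (q2 p hp hp0)) (hns (q4 p hp hp0))
    · exact isGenericQuadruplePoint_twistOn_iff hi' T _ hR hρ hs.2 hp
  refine ⟨⟨Q.isImmersion_twistOn hi.1 T hρ hs.2, fun p => ?_, by rw [hQ]; exact hi.2.2⟩, hQ⟩
  rcases lt_or_ge ‖p‖ R with hp | hp
  · by_cases hp0 : p = 0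
    · subst hp0; exact Or.inr q1
    · exact Or.inl (q2 p hp hp0)
  · rw [isStableAt_twistOn_iff hi' T _ hR hρ hs.2 hp,
      isGenericQuadruplePoint_twistOn_iff hi' T _ hR hρ hs.2 hp]
    exact hi.2.1 p

/-- There are push systems for all twisted immersions that differ only in the direction of the push
at the centre. -/
theorem exists_isPushSystem_twistOn :
    ∃ (x : Fin m → F) (V : Fin m → F → E3) (k₀ : Fin m),
      (∀ l, l ≠ k₀ → tsupport (V l) ⊆ (discs c R)ᶜ) ∧
      (∀ l, Continuous (V l)) ∧
      ∀ s ∈ Icc (0 : ℝ) 1, (∀ l, l ≠ k → T.height (n k) (e l) (T.phase s 0) ≠ 0) →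
        IsPushSystem (twistOn T (c k '' Metric.closedBall 0 R) i s) x
          (Function.update V k₀ (twistedPush T (c k '' Metric.closedBall 0 R) (A k) (n k) C i s)) := by
  have Q := (P.mono hRR.le).pushedDiscs (Φ.normal k) hC hR hCR
  have hR₀ : 0 < R₀ := hR.trans hRR
  -- The larger radius `R₀` keeps the other quadruple points at norm greater than `R`, so their
  -- pushes can be supported off the closed discs of radius `R`.
  have Q₀ := P.pushedDiscs (Φ.normal k) hC hR₀ (hCR.trans (by gcongr))
  have hi' := hi.1.1.continuous
  have hρ₀ : T.ρ < R₀ ^ 2 := hρ.trans (by gcongr)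
  obtain ⟨q3, q4⟩ := Q₀.isGenericQuadruplePoint_zero Φ hi.1 hρ₀ (s := 0) (by simp)
    fun l hl => by
      have : T.angle (T.phase 0 0) = 0 := by simp [Twist.angle, Twist.phase, ramp_of_nonpos]
      rw [Twist.height, Twist.normal, this, rot_zero]
      exact hgp₀ l hl
  rw [twistOn_zero] at q3 q4
  have hquad : ∀ p ∈ quadruplePoints i, p ≠ 0 → R < ‖p‖ := fun p hp hp0 => by
    refine hRR.trans_le (not_lt.1 fun h => ?_)
    have h1 := (q4 p h hp0).1
    have h2 : (i ⁻¹' {p}).encard = 4 := hp.1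
    rw [h2] at h1
    norm_num at h1
  have h0R : (0 : E2) ∈ Metric.closedBall (0 : E2) R := by simpa using hR.le
  have hic : ∀ a, i (c a 0) = 0 := fun a => by
    rw [(P.mono hRR.le).linear a 0 h0R, map_zero]
  have hout : ∀ {y}, R < ‖i y‖ → y ∉ discs c R := fun {y} hy hd => by
    rw [← (P.mono hRR.le).preimage, mem_preimage, mem_closedBall_zero_iff] at hd
    exact absurd hd (not_le.2 hy)
  have hdisc : ∀ a, c a '' Metric.closedBall 0 R ⊆ discs c R := fun a =>
    subset_iUnion (fun a => c a '' Metric.closedBall 0 R) a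
  have hclosed : IsClosed (discs c R) := isClosed_iUnion_of_finite fun a => Q.isClosed_disc a
  obtain ⟨x₀, hx₀⟩ := hi.exists_sheets
  obtain ⟨k₀, -, hk₀⟩ := hx₀.surjOn q3
  have hk₀' : i (x₀ k₀) = 0 := hk₀
  -- At the quadruple point in the origin, the sheet to be pushed is the disc that is twisted.
  let x := Function.update x₀ k₀ (c k 0)
  have hxk : x k₀ = c k 0 := Function.update_self ..
  have hix : (fun l => i (x l)) = fun l => i (x₀ l) := by
    funext l
    by_cases hl : l = k₀
    · subst hl; rw [hxk, hic, hk₀']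
    · simp only [x, Function.update_of_ne hl]
  have hx : BijOn (fun l => i (x l)) univ (quadruplePoints i) := by rw [hix]; exact hx₀
  have hxl : ∀ l, l ≠ k₀ → R < ‖i (x l)‖ := fun l hl => by
    refine hquad _ (hx.mapsTo (mem_univ l)) fun h => hl (hx.injOn (mem_univ _) (mem_univ _) ?_)
    show i (x l) = i (x k₀)
    rw [h, hxk, hic]
  choose v hv using fun l => exists_notMem_tangentPlane hi.1 (x l)
  obtain ⟨V, hV, hVs⟩ := hi.exists_isPushSystem hx hv
    (U := fun l => if l = k₀ then univ else (discs c R)ᶜ) fun l => by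
      by_cases hl : l = k₀
      · simp [hl]
      · simp only [hl, if_false]
        exact hclosed.isOpen_compl.mem_nhds (hout (hxl l hl))
  refine ⟨x, V, k₀, fun l hl => by simpa [hl] using hVs l, fun l => (hV.smooth l).continuous,
    fun s hs hgp => ?_⟩
  obtain ⟨hm, hq⟩ := memI_twistOn P Φ hi hC hR hCR hRR hρ hgp₀ hs hgp
  have hj0 : ∀ a, twistOn T (c k '' Metric.closedBall 0 R) i s (c a 0) = 0 := fun a => by
    rw [← norm_eq_zero, norm_twistOn, hic, norm_zero]
  have hjl : ∀ {y}, R < ‖i y‖ →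
      twistOn T (c k '' Metric.closedBall 0 R) i s =ᶠ[𝓝 y] i := fun hy =>
    twistOn_eventuallyEq hi' T _ hR hρ hs.2 hy.le
  refine ⟨?_, fun l => ?_, fun l => ?_, fun l y hy hyx => ?_⟩
  · have : (fun l => twistOn T (c k '' Metric.closedBall 0 R) i s (x l)) = fun l => i (x l) := by
      funext l
      by_cases hl : l = k₀
      · subst hl; rw [hxk, hic, hj0]
      · exact (hjl (hxl l hl)).self_of_nhds
    rw [this, hq]
    exact hx
  · by_cases hl : l = k₀
    · subst hl
      rw [Function.update_self]
      have h1 : ContDiff ℝ ∞ (rot T.m₁ T.m₂ (T.angle (T.phase s 0))) := by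
        have h2 : ContDiff ℝ ∞ fun y : E3 => (T.angle (T.phase s 0), y) :=
          contDiff_const.prodMk contDiff_id
        have h3 := (contDiff_rot T.m₁ T.m₂).comp h2
        exact h3
      have h4 := h1.contMDiff.comp (Q.contMDiff_centralPush hi.1.1)
      exact h4
    · rw [Function.update_of_ne hl]; exact hV.smooth l
  · by_cases hl : l = k₀
    · subst hl
      have hmem : c k 0 ∈ c k '' Metric.closedBall 0 R := mem_image_of_mem _ h0R
      have hmem' : c k 0 ∈ c k '' Metric.ball 0 R := mem_image_of_mem _ (by simpa using hR)
      have L := Q.localPicture Φ.normal hi.1 T hρ hs.2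
      have e0 : twistedPush T (c k '' Metric.closedBall 0 R) (A k) (n k) C i s (c k 0) =
          T.normal (n k) (T.phase s 0) := by
        rw [twistedPush, centralPush_of_mem _ _ _ _ hmem, hic, map_zero, norm_zero, Twist.normal,
          cut_of_le (by simp), one_smul]
      rw [Function.update_self, hxk, e0]
      obtain ⟨a, ha⟩ : ∃ a, a ≠ k := by clear * -; revert k; decide
      have S : IsSmallPush T A k n e C 0 R := (Φ.eventually_isSmallPush hC R).self_of_nhds
      have hz : ∀ a, sheetFunction T A n k C 0 a s 0 = 0 := fun a => by
        by_cases hak : a = k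
        · subst hak; rw [sheetFunction_self, level_zero]; simp
        · rw [sheetFunction_of_ne hak]; simp
      have hg0 : grad (sheetFunction T A n k C 0 k s) 0 ≠ 0 := fun h => by
        have := (Φ.sheet_pair S hs (p := 0) (by simpa using hR) k a ha.symm (hz k) (hz a) 1 0
          (by rw [h]; simp)).1
        norm_num at this
      rw [L.mem_tangentPlane_iff hmem' (by rw [hj0]; exact hg0), hj0, sheetFunction_self, inner_grad]
      -- At the origin every direction is tangential, so the derivative along the twisted normal is
      -- its squared norm, which is `1`.
      have h1 := fderiv_level_zero_tangential T C (A k) (n k) s (p := 0)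
        (v := T.normal (n k) (T.phase s 0)) (by simp)
      rw [h1, norm_zero, zero_pow two_ne_zero, real_inner_self_eq_norm_sq,
        norm_normal T (Φ.normal k).norm_eq]
      norm_num
    · rw [Function.update_of_ne hl, tangentPlane_congr (hjl (hxl l hl))]
      exact hV.transverse l
  · rw [hq] at hy
    have hiy : twistOn T (c k '' Metric.closedBall 0 R) i s y ∈ quadruplePoints i := hy
    have hyq : i y ∈ quadruplePoints i ∧ (i y = 0 ∨ R < ‖i y‖) := by
      by_cases h0 : twistOn T (c k '' Metric.closedBall 0 R) i s y = 0
      · have : i y = 0 := by rw [← norm_eq_zero, ← norm_twistOn T (c k '' Metric.closedBall 0 R) i s,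
          h0, norm_zero]
        exact ⟨this ▸ h0 ▸ hiy, Or.inl this⟩
      · have h1 := hquad _ hiy h0
        rw [norm_twistOn] at h1
        exact ⟨by rw [← (hjl h1).self_of_nhds]; exact hiy, Or.inr h1⟩
    by_cases hl : l = k₀
    · subst hl
      rw [Function.update_self]
      have hyD : y ∉ c k '' Metric.closedBall 0 R := by
        rintro ⟨u, hu, rfl⟩
        rcases hyq.2 with h0 | h0
        · rw [(P.mono hRR.le).linear k u hu] at h0
          have : u = 0 := (A k).injective (by rw [h0, map_zero])
          exact hyx (by rw [hxk, this])
        · exact hout h0 (hdisc k (mem_image_of_mem _ hu))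
      filter_upwards [(Q.isClosed_disc k).isOpen_compl.mem_nhds hyD] with z hz
      exact twistedPush_of_notMem T _ _ _ _ _ hz
    · rw [Function.update_of_ne hl]
      exact hV.local_support l y hyq.1 hyx

/-- Small pushes with support near the centre and away from the discs. -/
theorem eventually_pushedDiscs {V : Fin m → F → E3} {k₀ : Fin m}
    (hVs : ∀ l, l ≠ k₀ → tsupport (V l) ⊆ (discs c R)ᶜ) (hVc : ∀ l, Continuous (V l)) :
    ∀ᶠ ε in 𝓝 (0 : ℝ), ∀ σ : Fin m → ℤˣ,
      PushedDiscs c A k (n k) C ((((σ k₀ : ℤˣ) : ℤ) : ℝ) * ε) R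
        (pushed i (Function.update V k₀
          (centralPush (c k '' Metric.closedBall 0 R) (A k) (n k) C i)) ε σ) := by
  have P' := P.mono hRR.le
  have Q := P'.pushedDiscs (Φ.normal k) hC hR hCR
  set W := centralPush (c k '' Metric.closedBall 0 R) (A k) (n k) C i with hW
  have hin : ∀ ε σ, ∀ x ∈ discs c R, pushed i (Function.update V k₀ W) ε σ x =
      i x + ((((σ k₀ : ℤˣ) : ℤ) : ℝ) * ε) • W x := fun ε σ x hx => by
    have : ∑ l, (((σ l : ℤˣ) : ℤ) : ℝ) • Function.update V k₀ W l x =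
        (((σ k₀ : ℤˣ) : ℤ) : ℝ) • W x := by
      rw [Finset.sum_eq_single k₀ (fun l _ hl => ?_) (by simp), Function.update_self]
      rw [Function.update_of_ne hl, image_eq_zero_of_notMem_tsupport fun h => hVs l hl h hx,
        smul_zero]
    rw [pushed, this, smul_smul, mul_comm]
  have hdisc : ∀ a, c a '' Metric.closedBall 0 R ⊆ discs c R := fun a =>
    subset_iUnion (fun a => c a '' Metric.closedBall 0 R) a
  have hlin : ∀ ε σ, ∀ a, a ≠ k → ∀ u ∈ Metric.closedBall (0 : E2) R,
      pushed i (Function.update V k₀ W) ε σ (c a u) = A a u := fun ε σ a ha u hu => by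
    rw [hin ε σ _ (hdisc a (mem_image_of_mem _ hu)), hW,
      centralPush_of_notMem _ _ _ _ fun h => ha (Q.eq_of_mem (mem_image_of_mem _ hu) h), smul_zero,
      add_zero, P'.linear a u hu]
  have hpush : ∀ ε σ, ∀ u ∈ Metric.closedBall (0 : E2) R,
      pushed i (Function.update V k₀ W) ε σ (c k u) =
        pushedPlane (A k) (n k) C ((((σ k₀ : ℤˣ) : ℤ) : ℝ) * ε) u := fun ε σ u hu => by
    rw [hin ε σ _ (hdisc k (mem_image_of_mem _ hu)), hW,
      centralPush_of_mem _ _ _ _ (mem_image_of_mem _ hu), P'.linear k u hu, planeProj_apply,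
      smul_smul, pushedPlane]
  -- The pushes at the other quadruple points live on this compact set, where the norm of `i`
  -- exceeds `R`; for small `ε` it still does after pushing, so no further sheet enters the ball.
  let Z : Set F := ⋃ l ∈ {l : Fin m | l ≠ k₀}, tsupport (V l)
  have hZ : IsCompact Z := by
    refine IsClosed.isCompact ?_
    exact (toFinite _).isClosed_biUnion fun l _ => isClosed_tsupport _
  have hZR : ∀ x ∈ Z, x ∉ discs c R := fun x hx => by
    obtain ⟨l, hl, hxl⟩ := mem_iUnion₂.1 hx
    exact hVs l hl hxl
  have hi' := hi.1.1.continuous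
  have hWc : Continuous W := (Q.contMDiff_centralPush hi.1.1).continuous
  have hfar : ∀ x, x ∉ discs c R → R < ‖i x‖ := fun x hx => by
    rw [← P'.preimage, mem_preimage, mem_closedBall_zero_iff, not_le] at hx
    exact hx
  have hev : ∀ σ : Fin m → ℤˣ, ∀ᶠ ε in 𝓝 (0 : ℝ), ∀ x ∈ Z,
      R < ‖pushed i (Function.update V k₀ W) ε σ x‖ := fun σ => by
    refine hZ.eventually_forall_of_forall_eventually fun x hx => ?_
    have hl : ∀ l, Continuous (Function.update V k₀ W l) := fun l => by
      by_cases hl : l = k₀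
      · subst hl; rw [Function.update_self]; exact hWc
      · rw [Function.update_of_ne hl]; exact hVc l
    have hs : Continuous fun x => ∑ l, (((σ l : ℤˣ) : ℤ) : ℝ) • Function.update V k₀ W l x :=
      continuous_finsetSum _ fun l _ => (hl l).const_smul (((σ l : ℤˣ) : ℤ) : ℝ)
    have hc' : Continuous fun q : ℝ × F => pushed i (Function.update V k₀ W) q.1 σ q.2 :=
      (hi'.comp continuous_snd).add (continuous_fst.smul (hs.comp continuous_snd))
    have hc := hc'.norm
    refine (hc.tendsto (0, x)).eventually (lt_mem_nhds ?_)
    simpa [pushed] using hfar x (hZR x hx)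
  have hsmall : ∀ᶠ ε in 𝓝 (0 : ℝ), 2 * ε ^ 2 < R ^ 2 := by
    have hc : Continuous fun ε : ℝ => 2 * ε ^ 2 := by fun_prop
    refine (hc.tendsto 0).eventually (gt_mem_nhds ?_)
    have := pow_pos hR 2
    simpa using this
  filter_upwards [eventually_all.2 hev, hsmall] with ε h1 h2 σ
  have hσ : 2 * ((((σ k₀ : ℤˣ) : ℤ) : ℝ) * ε) ^ 2 < R ^ 2 := by
    rw [mul_pow, pow_two (((σ k₀ : ℤˣ) : ℤ) : ℝ), unit_mul_self_real, one_mul]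
    exact h2
  refine ⟨P'.continuousOn, P'.disjoint, ?_, hlin ε σ, hpush ε σ, Φ.normal k, hR, hC, hCR, hσ⟩
  ext x
  rw [mem_preimage, mem_closedBall_zero_iff]
  by_cases hx : x ∈ discs c R
  · refine iff_of_true ?_ hx
    obtain ⟨a, u, hu, rfl⟩ := mem_iUnion.1 hx
    have hu' : ‖u‖ ≤ R := by simpa using hu
    by_cases ha : a = k
    · subst ha
      rw [hpush ε σ u hu]
      rcases le_or_gt 2 (C * ‖u‖ ^ 2) with h | h
      · rwa [norm_pushedPlane_of_le h]
      · exact (norm_pushedPlane_lt (Φ.normal a) hC hR hCR hσ h).le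
    · rwa [hlin ε σ a ha u hu, (A a).norm_map]
  · refine iff_of_false (not_le.2 ?_) hx
    by_cases hxZ : x ∈ Z
    · exact h1 σ x hxZ
    · have : pushed i (Function.update V k₀ W) ε σ x = i x := by
        have h0 : ∀ l, Function.update V k₀ W l x = 0 := fun l => by
          by_cases hl : l = k₀
          · subst hl
            rw [Function.update_self, hW]
            exact centralPush_of_notMem _ _ _ _ fun h => hx (hdisc k h)
          · rw [Function.update_of_ne hl]
            exact image_eq_zero_of_notMem_tsupport fun h => hxZ (mem_biUnion hl h)
        simp [pushed, h0]
      rw [this]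
      exact hfar x hx

/-- At time `1` the twist is a rigid rotation on the ball of radius `r`, which contains the
supporting part of the central push both before and after pushing. Being linear there, it commutes
with the push. -/
theorem pushed_twistOn {V : Fin m → F → E3} {k₀ : Fin m} {r : ℝ} (hr : 0 < r)
    (hVs : ∀ l, l ≠ k₀ → tsupport (V l) ⊆ (discs c R)ᶜ)
    (hCr : 4 ≤ C * r ^ 2) (hphase : 1 ≤ T.phase 1 (r ^ 2)) {ε : ℝ} (hε : 2 * ε ^ 2 < r ^ 2)
    (σ : Fin m → ℤˣ) :
    pushed (twistOn T (c k '' Metric.closedBall 0 R) i 1) (Function.update V k₀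
        (twistedPush T (c k '' Metric.closedBall 0 R) (A k) (n k) C i 1)) ε σ =
      twistOn T (c k '' Metric.closedBall 0 R) (pushed i (Function.update V k₀
        (centralPush (c k '' Metric.closedBall 0 R) (A k) (n k) C i)) ε σ) 1 := by
  have P' := P.mono hRR.le
  have hphase' : ∀ {t : ℝ}, t ≤ r ^ 2 → 1 ≤ T.phase 1 t := fun ht => by
    refine hphase.trans ?_
    unfold Twist.phase
    have := T.K_pos
    gcongr
  have hangle : T.angle (T.phase 1 0) = T.θ := by
    rw [Twist.angle, ramp_of_one_le (hphase' (by positivity)), mul_one]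
  funext x
  by_cases hx : x ∈ c k '' Metric.closedBall 0 R
  · have hxd : x ∈ discs c R := mem_iUnion.2 ⟨k, hx⟩
    have hsum : ∀ (W : F → E3), ∑ l, (((σ l : ℤˣ) : ℤ) : ℝ) • Function.update V k₀ W l x =
        (((σ k₀ : ℤˣ) : ℤ) : ℝ) • W x := fun W => by
      rw [Finset.sum_eq_single k₀ (fun l _ hl => ?_) (by simp), Function.update_self]
      rw [Function.update_of_ne hl, image_eq_zero_of_notMem_tsupport fun h => hVs l hl h hxd,
        smul_zero]
    rw [twistOn_of_mem T _ _ hx]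
    simp only [pushed]
    rw [hsum, hsum, twistOn_of_mem T _ _ hx, twistedPush, hangle, centralPush_of_mem _ _ _ _ hx]
    obtain ⟨u, hu, rfl⟩ := hx
    rw [P'.linear k u hu, planeProj_apply]
    rcases le_or_gt 2 (C * ‖u‖ ^ 2) with h | h
    · have h0 : rot T.m₁ T.m₂ T.θ ((0 : ℝ) • n k) = 0 := by rw [rot_smul, zero_smul]
      rw [cut_of_ge h, h0, zero_smul]
      simp
    · have h1 : ‖pushedPlane (A k) (n k) C ((((σ k₀ : ℤˣ) : ℤ) : ℝ) * ε) u‖ < r :=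
        norm_pushedPlane_lt (Φ.normal k) hC hr hCr (by
          rw [mul_pow, pow_two (((σ k₀ : ℤˣ) : ℤ) : ℝ), unit_mul_self_real, one_mul]
          exact hε) h
      have h2 : ‖u‖ < r := by
        have : C * ‖u‖ ^ 2 < C * r ^ 2 := by linarith
        exact lt_of_pow_lt_pow_left₀ 2 hr.le (lt_of_mul_lt_mul_left this hC.le)
      have e1 : A k u + ε • (((σ k₀ : ℤˣ) : ℤ) : ℝ) • cut C (‖u‖ ^ 2) • n k =
          pushedPlane (A k) (n k) C ((((σ k₀ : ℤˣ) : ℤ) : ℝ) * ε) u := by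
        rw [pushedPlane]; module
      rw [e1, T.map_of_one_le_phase (hphase' (pow_le_pow_left₀ (norm_nonneg _) h1.le 2)),
        T.map_of_one_le_phase (hphase' (pow_le_pow_left₀ (norm_nonneg _)
          (by rw [(A k).norm_map]; exact h2.le) 2)), ← e1, rot_add_right, rot_smul, rot_smul,
        rot_smul, rot_smul]
  · rw [twistOn_of_notMem T _ _ hx]
    simp only [pushed]
    rw [twistOn_of_notMem T _ _ hx]
    congr 2
    refine Finset.sum_congr rfl fun l _ => ?_
    by_cases hl : l = k₀
    · subst hl
      rw [Function.update_self, Function.update_self, twistedPush_of_notMem _ _ _ _ _ _ hx,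
        centralPush_of_notMem _ _ _ _ hx]
    · rw [Function.update_of_ne hl, Function.update_of_ne hl]

/-- Twisting one of four flat discs about the quadruple point at their common centre preserves the
values of q-invariants. -/
theorem exists_hasValue_twistOn {r : ℝ} (hr : 0 < r) (hCr : 4 ≤ C * r ^ 2)
    (hphase : 1 ≤ T.phase 1 (r ^ 2))
    (hgp₁ : ∀ l, l ≠ k → (inner ℝ (rot T.m₁ T.m₂ T.θ (n k)) (e l) : ℝ) ≠ 0)
    {f : GenericImm F → ZMod 2} (hf : IsQInvariant f) :
    ∃ v, HasValue f i v ∧ HasValue f (twistOn T (c k '' Metric.closedBall 0 R) i 1) v := by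
  have hangle₀ : T.angle (T.phase 0 0) = 0 := by simp [Twist.angle, Twist.phase, ramp_of_nonpos]
  have hangle : T.angle (T.phase 1 0) = T.θ := by
    have : 1 ≤ T.phase 1 0 := by
      refine hphase.trans ?_
      unfold Twist.phase
      have := T.K_pos
      gcongr
      positivity
    rw [Twist.angle, ramp_of_one_le this, mul_one]
  have hg₀ : ∀ l, l ≠ k → T.height (n k) (e l) (T.phase 0 0) ≠ 0 := fun l hl => by
    rw [Twist.height, Twist.normal, hangle₀, rot_zero]
    exact hgp₀ l hl
  have hg₁ : ∀ l, l ≠ k → T.height (n k) (e l) (T.phase 1 0) ≠ 0 := fun l hl => by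
    rw [Twist.height, Twist.normal, hangle]
    exact hgp₁ l hl
  obtain ⟨hj, -⟩ := memI_twistOn P Φ hi hC hR hCR hRR hρ hgp₀ (s := 1) (by simp) hg₁
  obtain ⟨v, hv⟩ := hf.exists_hasValue hi
  obtain ⟨w, hw⟩ := hf.exists_hasValue hj
  refine ⟨v, hv, ?_⟩
  suffices v = w by rwa [this]
  obtain ⟨m₁, hm₁, -, h₁⟩ := hv
  obtain ⟨m₂, hm₂, -, h₂⟩ := hw
  obtain rfl : m₁ = m := by
    have := hm₁.2.2.symm.trans hi.2.2
    exact_mod_cast this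
  obtain rfl : m₂ = m₁ := by
    have := hm₂.2.2.symm.trans hj.2.2
    exact_mod_cast this
  obtain ⟨x, V, k₀, hVs, hVc, hV⟩ := exists_isPushSystem_twistOn P Φ hi hC hR hCR hRR hρ hgp₀
  have hV₀ := hV 0 (by simp) hg₀
  rw [twistOn_zero, twistedPush_zero] at hV₀
  have hV₁ := hV 1 (by simp) hg₁
  have hdiscs := eventually_pushedDiscs P Φ hi hC hR hCR hRR hρ hgp₀ hVs hVc
  have hsmall : ∀ σ : ℤˣ, ∀ᶠ ε in 𝓝 (0 : ℝ),
      IsSmallPush T A k n e C ((((σ : ℤˣ) : ℤ) : ℝ) * ε) R := fun σ => by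
    have ht : Tendsto (fun ε : ℝ => (((σ : ℤˣ) : ℤ) : ℝ) * ε) (𝓝 0) (𝓝 0) := by
      have : Continuous fun ε : ℝ => (((σ : ℤˣ) : ℤ) : ℝ) * ε := by fun_prop
      simpa using this.tendsto 0
    exact ht.eventually (Φ.eventually_isSmallPush hC R)
  have hsq : ∀ᶠ ε in 𝓝 (0 : ℝ), 2 * ε ^ 2 < r ^ 2 := by
    have hc : Continuous fun ε : ℝ => 2 * ε ^ 2 := by fun_prop
    refine (hc.tendsto 0).eventually (gt_mem_nhds ?_)
    have := pow_pos hr 2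
    simpa using this
  -- One `ε` serves both values, so that the two sums can be compared term by term.
  obtain ⟨ε, ⟨⟨⟨g₁, e₁⟩, g₂, e₂⟩, hε⟩, hD, hS, hsq⟩ := ((((h₁ x _ hV₀).and (h₂ x _ hV₁)).and
    self_mem_nhdsWithin).and ((hdiscs.and ((eventually_all.2 hsmall).and hsq)).filter_mono
      nhdsWithin_le_nhds)).exists
  rw [← e₁, ← e₂]
  refine Finset.sum_congr rfl fun σ _ => ?_
  have hcomm := pushed_twistOn P Φ hi hC hR hCR hRR hρ hgp₀ (k₀ := k₀) hr hVs hCr hphase hsq σ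
  have hne : (((σ k₀ : ℤˣ) : ℤ) : ℝ) * ε ≠ 0 := by
    refine mul_ne_zero (fun h => ?_) (ne_of_gt hε)
    have := unit_mul_self_real (σ k₀)
    rw [h] at this
    norm_num at this
  have hfin := g₂ σ
  rw [hcomm] at hfin
  -- For each choice of sides, twisting the pushed immersion is a generic regular homotopy without
  -- quadruple points from one term to the other.
  exact hf.eq_of_homotopy ((hD σ).isGenericRegularHomotopy Φ (hS (σ k₀)) (g₁ σ) hρ hne hfin)
    ((hD σ).noQuadruplePoints Φ (g₁ σ) hρ hne) (twistOn_zero T _ _) hcomm.symm (g₁ σ) (g₂ σ)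

end

end

section
/-! ### Deformations of flat discs -/

section
variable {F : Type*} [TopologicalSpace F] [ChartedSpace E2 F]

/-- `j` is regularly homotopic to `i` by a regular homotopy that is fixed off `D` (and at rest
before time `0` and after time `1`), and all q-invariants take equal values on `i` and `j`. -/
structure Deforms (D : Set F) (i j : F → E3) : Prop where
  homotopy : ∃ H : ℝ → F → E3,
    ContMDiff ((𝓘(ℝ, ℝ)).prod (𝓡 2)) 𝓘(ℝ, E3) ∞ (fun q : ℝ × F => H q.1 q.2) ∧
    (∀ t, IsImmersion (H t)) ∧ (∀ t ≤ 0, H t = i) ∧ (∀ t ≥ 1, H t = j) ∧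
    ∀ t, ∀ x, x ∉ D → H t x = i x
  memI : ∃ m, MemI m j
  value : ∀ f : GenericImm F → ZMod 2, IsQInvariant f → ∃ v, HasValue f i v ∧ HasValue f j v

theorem Deforms.mono {D D' : Set F} {i j : F → E3} (h : Deforms D i j) (hD : D ⊆ D') :
    Deforms D' i j := by
  obtain ⟨H, h1, h2, h3, h4, h5⟩ := h.homotopy
  exact ⟨⟨H, h1, h2, h3, h4, fun t x hx => h5 t x fun h => hx (hD h)⟩, h.memI, h.value⟩

/-- Homotopies in `Deforms` are at rest before time `0` and after time `1`, so that run at fourfold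
speed they concatenate smoothly: between times `1 / 4` and `1 / 2` both halves equal `j`. -/
theorem Deforms.trans {D : Set F} {i j l : F → E3} (h : Deforms D i j) (h' : Deforms D j l) :
    Deforms D i l := by
  refine ⟨?_, h'.memI, fun f hf => ?_⟩
  · obtain ⟨H, a1, a2, a3, a4, a5⟩ := h.homotopy
    obtain ⟨G, b1, b2, b3, b4, b5⟩ := h'.homotopy
    have hij : ∀ x, x ∉ D → j x = i x := fun x hx => by rw [← a5 1 x hx, a4 1 le_rfl]
    have hG : ∀ t : ℝ, t ≤ 1 / 2 → 1 / 4 ≤ t → H (4 * t) = G (4 * t - 2) := fun t h1 h2 => by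
      rw [a4 _ (by linarith), b3 _ (by linarith)]
    refine ⟨fun t => if t ≤ 1 / 2 then H (4 * t) else G (4 * t - 2), fun q => ?_, fun t => ?_,
      fun t ht => ?_, fun t ht => ?_, fun t x hx => ?_⟩
    · have hfst : Continuous fun q : ℝ × F => q.1 := continuous_fst
      rcases lt_or_ge q.1 (1 / 2) with hq | hq
      · have hc : ContDiff ℝ ∞ fun t : ℝ => 4 * t := contDiff_const.mul contDiff_id
        have hd : ContMDiff ((𝓘(ℝ, ℝ)).prod (𝓡 2)) ((𝓘(ℝ, ℝ)).prod (𝓡 2)) ∞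
            fun q : ℝ × F => (4 * q.1, q.2) :=
          (hc.contMDiff.comp contMDiff_fst).prodMk contMDiff_snd
        refine ((a1.comp hd) q).congr_of_eventuallyEq ?_
        filter_upwards [hfst.continuousAt.eventually (gt_mem_nhds hq)] with p hp
        simp only [if_pos hp.le, Function.comp]
      · have hc : ContDiff ℝ ∞ fun t : ℝ => 4 * t - 2 :=
          (contDiff_const.mul contDiff_id).sub contDiff_const
        have hd : ContMDiff ((𝓘(ℝ, ℝ)).prod (𝓡 2)) ((𝓘(ℝ, ℝ)).prod (𝓡 2)) ∞
            fun q : ℝ × F => (4 * q.1 - 2, q.2) :=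
          (hc.contMDiff.comp contMDiff_fst).prodMk contMDiff_snd
        refine ((b1.comp hd) q).congr_of_eventuallyEq ?_
        have hq' : 1 / 4 < q.1 := by linarith
        filter_upwards [hfst.continuousAt.eventually (lt_mem_nhds hq')] with p hp
        by_cases hp' : p.1 ≤ 1 / 2
        · simp only [if_pos hp', Function.comp, hG p.1 hp' hp.le]
        · simp only [if_neg hp', Function.comp]
    · dsimp only
      split_ifs
      · exact a2 _
      · exact b2 _
    · dsimp only
      rw [if_pos (by linarith), a3 _ (by linarith)]
    · dsimp only
      rw [if_neg (by linarith), b4 _ (by linarith)]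
    · dsimp only
      split_ifs
      · exact a5 _ x hx
      · rw [b5 _ x hx, hij x hx]
  · obtain ⟨v, v1, v2⟩ := h.value f hf
    obtain ⟨w, w1, w2⟩ := h'.value f hf
    exact ⟨v, v1, w1.unique v2 ▸ w2⟩

/-- Any immersion in `I` with flat discs given by `A` can be deformed over a ball in such a way that
over a slightly smaller ball it has flat discs given by `A'`. -/
def Reachable (c : Fin 4 → E2 → F) (A A' : Fin 4 → E2 →ₗᵢ[ℝ] E3) : Prop :=
  ∀ (i : F → E3) (R r : ℝ), 0 < r → r < R → (∃ m, MemI m i) → FlatDiscs c A R i →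
    ∃ j, Deforms (discs c R) i j ∧ FlatDiscs c A' r j

theorem discs_mono (c : Fin 4 → E2 → F) {r R : ℝ} (h : r ≤ R) : discs c r ⊆ discs c R :=
  iUnion_mono fun _ => image_mono (Metric.closedBall_subset_closedBall h)

/-- Each move costs some radius. As `Reachable` asks for an arbitrarily small loss, the loss can be
shared between two moves. -/
theorem Reachable.trans {c : Fin 4 → E2 → F} {A A' A'' : Fin 4 → E2 →ₗᵢ[ℝ] E3}
    (h : Reachable c A A') (h' : Reachable c A' A'') : Reachable c A A'' := by
  intro i R r hr hrR hi P
  obtain ⟨j, j1, j2⟩ := h i R ((r + R) / 2) (by linarith) (by linarith) hi P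
  obtain ⟨l, l1, l2⟩ := h' j ((r + R) / 2) r hr (by linarith) j1.memI j2
  exact ⟨l, j1.trans (l1.mono (discs_mono c (by linarith))), l2⟩

end

/-- A rotation, composed with an isometric embedding. -/
def IsOrthonormalPair.rotate {m₁ m₂ : E3} (h : IsOrthonormalPair m₁ m₂) (θ : ℝ)
    (A : E2 →ₗᵢ[ℝ] E3) : E2 →ₗᵢ[ℝ] E3 := (h.rotIsometry θ).comp A

theorem IsOrthonormalPair.rotate_apply {m₁ m₂ : E3} (h : IsOrthonormalPair m₁ m₂) (θ : ℝ)
    (A : E2 →ₗᵢ[ℝ] E3) (u : E2) : h.rotate θ A u = rot m₁ m₂ θ (A u) := rfl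

variable {F : Type*} [TopologicalSpace F] [ChartedSpace E2 F] [IsManifold (𝓡 2) ∞ F]
  [CompactSpace F] [T2Space F] {c : Fin 4 → E2 → F} {A : Fin 4 → E2 →ₗᵢ[ℝ] E3} {k : Fin 4}
  {n e : Fin 4 → E3}

/-- The frame condition is required for all twists with the given rotation, since `K` and `ρ` are
fixed only once the radii are known. -/
theorem reachable_rotate {m₁ m₂ : E3} (hm : IsOrthonormalPair m₁ m₂) (θ : ℝ)
    (hΦ : ∀ T : Twist, T.m₁ = m₁ → T.m₂ = m₂ → T.θ = θ → IsTwistFrame T A k n e)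
    (hgp₀ : ∀ l, l ≠ k → (inner ℝ (n k) (e l) : ℝ) ≠ 0)
    (hgp₁ : ∀ l, l ≠ k → (inner ℝ (rot m₁ m₂ θ (n k)) (e l) : ℝ) ≠ 0) :
    Reachable c A (Function.update A k (hm.rotate θ (A k))) := by
  rintro i R₀ r hr hrR ⟨m, hi⟩ P
  obtain ⟨R, hrR', hRR⟩ := exists_between hrR
  have hR : 0 < R := hr.trans hrR'
  have hsq : r ^ 2 < R ^ 2 := by gcongr
  obtain ⟨ρ, hρ₁, hρ₂⟩ := exists_between hsq
  have hρ : 0 < ρ := (pow_pos hr 2).trans hρ₁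
  have hd : 0 < ρ - r ^ 2 := by linarith
  -- This `K` makes the phase equal to `1` at radius `r` and time `1`, while `ρ < R ^ 2` keeps the
  -- twist inside the ball of radius `R`.
  let T : Twist := ⟨m₁, m₂, hm, θ, 1 / (ρ - r ^ 2), by positivity, ρ, hρ⟩
  have Φ : IsTwistFrame T A k n e := hΦ T rfl rfl rfl
  -- With this constant the push is confined to `2 * ‖u‖ ^ 2 ≤ r ^ 2`, well within the region of
  -- rigid rotation.
  have hC : 0 < 4 / r ^ 2 := by positivity
  have hCr : 4 ≤ 4 / r ^ 2 * r ^ 2 := by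
    have := (pow_pos hr 2).ne'
    field_simp
    exact le_rfl
  have hCR : 4 ≤ 4 / r ^ 2 * R ^ 2 := hCr.trans (by gcongr)
  have hphase : 1 ≤ T.phase 1 (r ^ 2) := by
    simp only [Twist.phase, T]
    field_simp
    linarith
  have hangle : T.angle (T.phase 1 0) = θ := by
    have : 1 ≤ T.phase 1 0 := by
      refine hphase.trans ?_
      unfold Twist.phase
      have := T.K_pos
      gcongr
      positivity
    rw [Twist.angle, ramp_of_one_le this, mul_one]
  have Q := (P.mono hRR.le).pushedDiscs (Φ.normal k) hC hR hCR
  have hD : c k '' Metric.closedBall 0 R ⊆ discs c R₀ :=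
    (subset_iUnion (fun a => c a '' Metric.closedBall 0 R) k).trans (discs_mono c hRR.le)
  refine ⟨twistOn T (c k '' Metric.closedBall 0 R) i 1, ⟨⟨fun t =>
    twistOn T (c k '' Metric.closedBall 0 R) i (Real.smoothTransition t), fun q => ?_,
    fun t => Q.isImmersion_twistOn hi.1 T hρ₂ (Real.smoothTransition.le_one t), fun t ht => ?_,
    fun t ht => ?_, fun t x hx => twistOn_of_notMem T i _ fun h => hx (hD h)⟩, ⟨m, ?_⟩,
    fun f hf => exists_hasValue_twistOn P Φ hi hC hR hCR hRR hρ₂ hgp₀ hr hCr hphase hgp₁ hf⟩, ?_⟩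
  · have hd : ContMDiff ((𝓘(ℝ, ℝ)).prod (𝓡 2)) ((𝓘(ℝ, ℝ)).prod (𝓡 2)) ∞
        fun q : ℝ × F => (Real.smoothTransition q.1, q.2) :=
      (Real.smoothTransition.contDiff.contMDiff.comp contMDiff_fst).prodMk contMDiff_snd
    have h1 := Q.contMDiffAt_twistOn hi.1.1 T hρ₂ (Real.smoothTransition.le_one q.1) q.2
    exact h1.comp q (hd q)
  · simp only [Real.smoothTransition.zero_of_nonpos ht, twistOn_zero]
  · simp only [Real.smoothTransition.one_of_one_le ht]
  · refine (memI_twistOn P Φ hi hC hR hCR hRR hρ₂ hgp₀ (s := 1) (by simp) fun l hl => ?_).1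
    rw [Twist.height, Twist.normal, hangle]
    exact hgp₁ l hl
  · have P' := P.mono hrR.le
    refine ⟨P'.continuousOn, P'.disjoint, ?_, fun a u hu => ?_⟩
    · rw [← P'.preimage]
      ext x
      simp only [mem_preimage, mem_closedBall_zero_iff, norm_twistOn]
    · have hu' := Metric.closedBall_subset_closedBall hrR'.le hu
      by_cases ha : a = k
      · subst ha
        rw [Function.update_self, twistOn_of_mem T i 1 (mem_image_of_mem _ hu'), P'.linear a u hu,
          T.map_of_one_le_phase, hm.rotate_apply]
        refine hphase.trans ?_
        unfold Twist.phase
        have := T.K_pos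
        have h2 : ‖u‖ ≤ r := by simpa using hu
        rw [(A a).norm_map]
        gcongr
      · rw [Function.update_of_ne ha, twistOn_of_notMem T i 1 fun h => ha
          (Q.eq_of_mem (mem_image_of_mem _ hu') h), P'.linear a u hu]

end

section
/-! ### Normals in general position -/

/-- Three vectors are linearly independent. -/
def Indep3 (x y z : E3) : Prop := ∀ r s t : ℝ, r • x + s • y + t • z = 0 → r = 0 ∧ s = 0 ∧ t = 0

theorem Indep3.rotate {x y z : E3} (h : Indep3 x y z) : Indep3 y z x := fun r s t h0 => by
  obtain ⟨h1, h2, h3⟩ := h t r s (by rw [← h0]; abel)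
  exact ⟨h2, h3, h1⟩

theorem Indep3.swap {x y z : E3} (h : Indep3 x y z) : Indep3 y x z := fun r s t h0 => by
  obtain ⟨h1, h2, h3⟩ := h s r t (by rw [← h0]; abel)
  exact ⟨h2, h1, h3⟩

theorem Indep3.linearIndependent {x y z : E3} (h : Indep3 x y z) :
    LinearIndependent ℝ ![x, y, z] := by
  rw [Fintype.linearIndependent_iff]
  intro g hg
  rw [Fin.sum_univ_three] at hg
  obtain ⟨h1, h2, h3⟩ := h (g 0) (g 1) (g 2) hg
  intro i
  fin_cases i <;> assumption

theorem Indep3.eq_zero {x y z v : E3} (h : Indep3 x y z) (hx : (inner ℝ x v : ℝ) = 0)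
    (hy : (inner ℝ y v : ℝ) = 0) (hz : (inner ℝ z v : ℝ) = 0) : v = 0 := by
  have hspan : Submodule.span ℝ (range ![x, y, z]) = ⊤ :=
    h.linearIndependent.span_eq_top_of_card_eq_finrank (by simp)
  have hmem : v ∈ (Submodule.span ℝ (range ![x, y, z]))ᗮ := by
    rw [Submodule.mem_orthogonal]
    intro u hu
    induction hu using Submodule.span_induction with
    | mem w hw => obtain ⟨m, rfl⟩ := hw; fin_cases m <;> assumption
    | zero => simp
    | add a b _ _ ha hb => rw [inner_add_left, ha, hb, add_zero]
    | smul a b _ hb => rw [real_inner_smul_left, hb, mul_zero]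
  rw [hspan, Submodule.top_orthogonal_eq_bot] at hmem
  exact hmem

theorem indep3_of_orthogonal {x y z : E3}
    (h : ∀ v : E3, (inner ℝ x v : ℝ) = 0 → (inner ℝ y v : ℝ) = 0 → (inner ℝ z v : ℝ) = 0 → v = 0) :
    Indep3 x y z := by
  have hli : LinearIndependent ℝ ![x, y, z] :=
    linearIndependent_of_orthogonal fun v hv => h v (hv 0) (hv 1) (hv 2)
  intro r s t h0
  have := Fintype.linearIndependent_iff.1 hli ![r, s, t] (by
    rw [Fin.sum_univ_three]; simpa using h0)
  exact ⟨this 0, this 1, this 2⟩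

theorem Indep3.exists_line {x y z : E3} (h : Indep3 x y z) :
    ∃ e : E3, ‖e‖ = 1 ∧ (inner ℝ x e : ℝ) = 0 ∧ (inner ℝ y e : ℝ) = 0 ∧
      ∀ v : E3, (inner ℝ x v : ℝ) = 0 → (inner ℝ y v : ℝ) = 0 → ∃ t : ℝ, v = t • e := by
  have hli : LinearIndependent ℝ ![x, y] := by
    rw [LinearIndependent.pair_iff]
    intro s t hst
    obtain ⟨h1, h2, -⟩ := h s t 0 (by rw [hst, zero_smul, add_zero])
    exact ⟨h1, h2⟩
  set S := Submodule.span ℝ (range ![x, y]) with hS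
  have h2 : Module.finrank ℝ S = 2 := by rw [hS, finrank_span_eq_card hli]; simp
  have h1 : Module.finrank ℝ Sᗮ = 1 := by
    have := S.finrank_add_finrank_orthogonal
    simp only [h2, finrank_euclideanSpace, Fintype.card_fin] at this
    omega
  have hmem : ∀ v, v ∈ Sᗮ ↔ (inner ℝ x v : ℝ) = 0 ∧ (inner ℝ y v : ℝ) = 0 := fun v => by
    constructor
    · intro hv
      rw [Submodule.mem_orthogonal] at hv
      exact ⟨hv x (Submodule.subset_span ⟨0, rfl⟩), hv y (Submodule.subset_span ⟨1, rfl⟩)⟩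
    · rintro ⟨hx, hy⟩
      rw [Submodule.mem_orthogonal]
      intro u hu
      induction hu using Submodule.span_induction with
      | mem w hw => obtain ⟨m, rfl⟩ := hw; fin_cases m <;> assumption
      | zero => simp
      | add a b _ _ ha hb => rw [inner_add_left, ha, hb, add_zero]
      | smul a b _ hb => rw [real_inner_smul_left, hb, mul_zero]
  obtain ⟨⟨w, hw⟩, hw0, hwt⟩ := finrank_eq_one_iff'.1 h1
  have hw0' : w ≠ 0 := fun h => hw0 (Subtype.ext h)
  have hn : ‖w‖ ≠ 0 := norm_ne_zero_iff.2 hw0'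
  obtain ⟨w1, w2⟩ := (hmem w).1 hw
  refine ⟨‖w‖⁻¹ • w, ?_, ?_, ?_, fun v hx hy => ?_⟩
  · rw [norm_smul, norm_inv, norm_norm, inv_mul_cancel₀ hn]
  · rw [real_inner_smul_right, w1, mul_zero]
  · rw [real_inner_smul_right, w2, mul_zero]
  · obtain ⟨t, ht⟩ := hwt ⟨v, (hmem v).2 ⟨hx, hy⟩⟩
    have ht' : t • w = v := congrArg Subtype.val ht
    refine ⟨t * ‖w‖, ?_⟩
    rw [smul_smul, mul_assoc, mul_inv_cancel₀ hn, mul_one, ht']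

/-- Any three of the four vectors are linearly independent. -/
def InGeneralPosition (n : Fin 4 → E3) : Prop :=
  ∀ a b d, a ≠ b → a ≠ d → b ≠ d → Indep3 (n a) (n b) (n d)

namespace InGeneralPosition
variable {n : Fin 4 → E3} (h : InGeneralPosition n)
include h

theorem eq_zero {l : Fin 4} {v : E3} (hv : ∀ a, a ≠ l → (inner ℝ (n a) v : ℝ) = 0) : v = 0 := by
  obtain ⟨a, b, d, hab, had, hbd, ha, hb, hd⟩ : ∃ a b d : Fin 4, a ≠ b ∧ a ≠ d ∧ b ≠ d ∧
      a ≠ l ∧ b ≠ l ∧ d ≠ l := by clear * -; revert l; decide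
  exact (h a b d hab had hbd).eq_zero (hv a ha) (hv b hb) (hv d hd)

theorem ne_smul {a b : Fin 4} (hab : a ≠ b) (t : ℝ) : n a ≠ t • n b := fun h0 => by
  obtain ⟨d, had, hbd⟩ : ∃ d : Fin 4, a ≠ d ∧ b ≠ d := by clear * -; revert a b; decide
  have := (h a b d hab had hbd 1 (-t) 0 (by rw [h0]; module)).1
  norm_num at this

theorem exists_lines (k : Fin 4) : ∃ e : Fin 4 → E3, ∀ l, l ≠ k → ‖e l‖ = 1 ∧
    (∀ v, (∀ a, a ≠ l → a ≠ k → (inner ℝ (n a) v : ℝ) = 0) → ∃ z : ℝ, v = z • e l) ∧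
    ∀ a, a ≠ l → a ≠ k → (inner ℝ (n a) (e l) : ℝ) = 0 := by
  have : ∀ l, ∃ e : E3, l ≠ k → ‖e‖ = 1 ∧
      (∀ v, (∀ a, a ≠ l → a ≠ k → (inner ℝ (n a) v : ℝ) = 0) → ∃ z : ℝ, v = z • e) ∧
      ∀ a, a ≠ l → a ≠ k → (inner ℝ (n a) e : ℝ) = 0 := fun l => by
    by_cases hl : l = k
    · exact ⟨0, fun h => absurd hl h⟩
    obtain ⟨a, b, hab, hal, hak, hbl, hbk, hall⟩ : ∃ a b : Fin 4, a ≠ b ∧ a ≠ l ∧ a ≠ k ∧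
        b ≠ l ∧ b ≠ k ∧ ∀ d, d ≠ l → d ≠ k → d = a ∨ d = b := by
      clear * - hl; revert l k; decide
    obtain ⟨e, e1, e2, e3, e4⟩ := (h a b k hab hak hbk).exists_line
    refine ⟨e, fun _ => ⟨e1, fun v hv => e4 v (hv a hal hak) (hv b hbl hbk), fun d hd hd' => ?_⟩⟩
    rcases hall d hd hd' with rfl | rfl <;> assumption
  choose e he using this
  exact ⟨e, fun l hl => he l hl⟩

theorem inner_ne_zero {k l : Fin 4} {e : E3} (he : ‖e‖ = 1)
    (h0 : ∀ a, a ≠ l → a ≠ k → (inner ℝ (n a) e : ℝ) = 0) : (inner ℝ (n k) e : ℝ) ≠ 0 := fun hk => by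
  have : e = 0 := h.eq_zero (l := l) fun a ha => by
    by_cases hak : a = k
    · rwa [hak]
    · exact h0 a ha hak
  rw [this, norm_zero] at he
  norm_num at he

theorem update {k : Fin 4} {v : E3} (hv : ∀ a b, ∀ r s : ℝ, v ≠ r • n a + s • n b) :
    InGeneralPosition (Function.update n k v) := by
  have key : ∀ a b, a ≠ b → Indep3 (n a) (n b) v := fun a b hab r s t h0 => by
    have ht : t = 0 := by
      by_contra ht
      refine hv a b (-(r / t)) (-(s / t)) ?_
      have : t • v = -(r • n a) - s • n b := by rw [← sub_eq_zero, ← h0]; module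
      rw [← inv_smul_smul₀ ht v, this]
      module
    obtain ⟨d, had, hbd⟩ : ∃ d : Fin 4, a ≠ d ∧ b ≠ d := by clear * -; revert a b; decide
    obtain ⟨h1, h2, -⟩ := h a b d hab had hbd r s 0 (by rw [← h0, ht]; module)
    exact ⟨h1, h2, ht⟩
  intro a b d hab had hbd
  by_cases ha : a = k
  · subst ha
    rw [Function.update_self, Function.update_of_ne hab.symm, Function.update_of_ne had.symm]
    exact (key b d hbd).rotate.rotate
  by_cases hb : b = k
  · subst hb
    rw [Function.update_self, Function.update_of_ne hab, Function.update_of_ne hbd.symm]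
    exact (key a d had).rotate.rotate.swap
  by_cases hd : d = k
  · subst hd
    rw [Function.update_self, Function.update_of_ne had, Function.update_of_ne hbd]
    exact key a b hab
  · rw [Function.update_of_ne ha, Function.update_of_ne hb, Function.update_of_ne hd]
    exact h a b d hab had hbd

end InGeneralPosition

/-! ### Moving a single disc -/

variable {F : Type*} [TopologicalSpace F] [ChartedSpace E2 F] [IsManifold (𝓡 2) ∞ F]
  [CompactSpace F] [T2Space F] {c : Fin 4 → E2 → F} {A : Fin 4 → E2 →ₗᵢ[ℝ] E3} {k : Fin 4}
  {n : Fin 4 → E3}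

theorem inner_sq_ne_one {x y : E3} (hx : ‖x‖ = 1) (hy : ‖y‖ = 1) (h : ∀ t : ℝ, y ≠ t • x) :
    (inner ℝ x y : ℝ) ^ 2 ≠ 1 := fun h1 => by
  refine h (inner ℝ x y) (sub_eq_zero.1 (norm_eq_zero.1 (pow_eq_zero_iff two_ne_zero |>.1 ?_)))
  rw [norm_sub_sq_real, real_inner_smul_right, norm_smul, mul_pow, Real.norm_eq_abs, sq_abs, hx, hy,
    real_inner_comm]
  rw [real_inner_comm] at h1
  linarith

/-- Rotation in the plane orthogonal to `n k` fixes this normal, so the planes stay in general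
position throughout and no height ever vanishes. -/
theorem reachable_of_spin (hn : ∀ a, IsUnitNormal (A a) (n a)) (hgp : InGeneralPosition n)
    {m₁ m₂ : E3} (hm : IsOrthonormalPair m₁ m₂) (h₁ : (inner ℝ m₁ (n k) : ℝ) = 0)
    (h₂ : (inner ℝ m₂ (n k) : ℝ) = 0) (θ : ℝ) :
    Reachable c A (Function.update A k (hm.rotate θ (A k))) := by
  obtain ⟨e, he⟩ := hgp.exists_lines k
  have hne : ∀ l, l ≠ k → (inner ℝ (n k) (e l) : ℝ) ≠ 0 := fun l hl =>
    hgp.inner_ne_zero (he l hl).1 (he l hl).2.2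
  have hrot : ∀ α, rot m₁ m₂ α (n k) = n k := fun α => hm.rot_of_orthogonal α h₁ h₂
  refine reachable_rotate (n := n) (e := e) hm θ (fun T t1 t2 _ => ?_) hne fun l hl => ?_
  · have hN : ∀ x, T.normal (n k) x = n k := fun x => by rw [Twist.normal, t1, t2, hrot]
    refine ⟨hn, fun v hv => hgp.eq_zero hv, fun l hl => (he l hl).1, fun l hl => (he l hl).2.1,
      fun l a hl => (he l hl).2.2 a, fun a ha x => ?_, fun l hl x hx => ?_⟩
    · rw [hN]
      exact inner_sq_ne_one (hn k).norm_eq (hn a).norm_eq fun t => hgp.ne_smul ha t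
    · rw [Twist.height, hN] at hx
      exact absurd hx (hne l hl)
  · rw [hrot]; exact hne l hl

/-- `harc` keeps the moving normal from becoming parallel to another one. The heights are `cos α * P
+ sin α * Q` with `P ≠ 0`, so their zeros in the angle are simple; general position at both ends
confines them to phases where the angle moves. -/
theorem reachable_of_arc (hn : ∀ a, IsUnitNormal (A a) (n a)) (hgp : InGeneralPosition n)
    {m : E3} (hm : IsOrthonormalPair (n k) m) (harc : ∀ a, a ≠ k → ∀ r s : ℝ, n a ≠ r • n k + s • m)
    {θ : ℝ} (hgp' : InGeneralPosition (Function.update n k (rot (n k) m θ (n k)))) :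
    Reachable c A (Function.update A k (hm.rotate θ (A k))) := by
  obtain ⟨e, he⟩ := hgp.exists_lines k
  have hne : ∀ l, l ≠ k → (inner ℝ (n k) (e l) : ℝ) ≠ 0 := fun l hl =>
    hgp.inner_ne_zero (he l hl).1 (he l hl).2.2
  have hne' : ∀ l, l ≠ k → (inner ℝ (rot (n k) m θ (n k)) (e l) : ℝ) ≠ 0 := fun l hl => by
    have := hgp'.inner_ne_zero (he l hl).1 fun a ha hak => by
      rw [Function.update_of_ne hak]; exact (he l hl).2.2 a ha hak
    rwa [Function.update_self] at this
  refine reachable_rotate (n := n) (e := e) hm θ (fun T t1 t2 t3 => ?_) hne hne'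
  have hN : ∀ x, T.normal (n k) x = Real.cos (T.angle x) • n k + Real.sin (T.angle x) • m :=
    fun x => by rw [Twist.normal, t1, t2, hm.rot_left]
  refine ⟨hn, fun v hv => hgp.eq_zero hv, fun l hl => (he l hl).1, fun l hl => (he l hl).2.1,
    fun l a hl => (he l hl).2.2 a, fun a ha x => ?_, fun l hl x hx => ?_⟩
  · refine inner_sq_ne_one (norm_normal T (hn k).norm_eq x) (hn a).norm_eq fun t ht => ?_
    rw [hN] at ht
    exact harc a ha (t * Real.cos (T.angle x)) (t * Real.sin (T.angle x)) (by rw [ht]; module)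
  · set P : ℝ := inner ℝ (n k) (e l) with hP
    set Q : ℝ := inner ℝ m (e l) with hQ
    have hH : T.height (n k) (e l) = fun x => Real.cos (T.angle x) * P + Real.sin (T.angle x) * Q := by
      funext x
      rw [Twist.height, hN, inner_add_left, real_inner_smul_left, real_inner_smul_left]
    have hx0 : 0 < x := by
      by_contra h
      rw [hH] at hx
      simp only [Twist.angle, ramp_of_nonpos (not_lt.1 h), mul_zero, Real.cos_zero, Real.sin_zero,
        one_mul, zero_mul, add_zero] at hx
      exact hne l hl hx
    have hx1 : x < 1 := by
      by_contra h
      have h1 : T.normal (n k) x = rot (n k) m θ (n k) := by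
        rw [Twist.normal, t1, t2, Twist.angle, ramp_of_one_le (not_lt.1 h), mul_one, t3]
      rw [Twist.height, h1] at hx
      exact hne' l hl hx
    have hθ : T.θ ≠ 0 := fun h => by
      rw [hH] at hx
      simp only [Twist.angle, h, zero_mul, Real.cos_zero, Real.sin_zero, one_mul, add_zero] at hx
      exact hne l hl hx
    have hr := deriv_ramp_pos hx0 hx1
    have hda : HasDerivAt T.angle (T.θ * deriv ramp x) x :=
      ((contDiff_ramp.differentiable (by simp) x).hasDerivAt).const_mul T.θ
    have hd := (hda.cos.mul_const P).fun_add (hda.sin.mul_const Q)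
    rw [hH] at hx ⊢
    rw [hd.deriv]
    simp only at hx
    intro h0
    have h1 : (T.θ * deriv ramp x) * (-Real.sin (T.angle x) * P + Real.cos (T.angle x) * Q) = 0 := by
      rw [← h0]; ring
    have h2 := (mul_eq_zero.1 h1).resolve_left (mul_ne_zero hθ hr.ne')
    -- A common zero of `cos α * P + sin α * Q` and its derivative in `α` would give `P = 0`.
    have h3 : P = 0 := by
      have h4 := Real.sin_sq_add_cos_sq (T.angle x)
      calc P = (Real.sin (T.angle x) ^ 2 + Real.cos (T.angle x) ^ 2) * P := by rw [h4, one_mul]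
        _ = Real.cos (T.angle x) * (Real.cos (T.angle x) * P + Real.sin (T.angle x) * Q) -
          Real.sin (T.angle x) * (-Real.sin (T.angle x) * P + Real.cos (T.angle x) * Q) := by ring
        _ = 0 := by rw [hx, h2]; ring
    exact hne l hl h3

end

/-! ### Great circles and parametrizations of a plane. -/

section
theorem exists_cos_sin {p q : ℝ} (h : p ^ 2 + q ^ 2 = 1) :
    ∃ φ : ℝ, Real.cos φ = p ∧ Real.sin φ = q := by
  let z : ℂ := ⟨p, q⟩
  have hz : ‖z‖ = 1 := by
    have h1 : ‖z‖ ^ 2 = 1 := by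
      rw [← Complex.normSq_eq_norm_sq, Complex.normSq_apply, ← h]
      ring
    exact (pow_eq_one_iff_of_nonneg (norm_nonneg _) two_ne_zero).1 h1
  have hz0 : z ≠ 0 := fun h0 => by rw [h0, norm_zero] at hz; norm_num at hz
  exact ⟨z.arg, by rw [Complex.cos_arg hz0, hz, div_one], by rw [Complex.sin_arg, hz, div_one]⟩

/-- A great circle through two unit vectors. -/
theorem exists_arc {x v : E3} (hx : ‖x‖ = 1) (hv : ‖v‖ = 1) (hxv : ∀ t : ℝ, v ≠ t • x) :
    ∃ (m : E3) (θ : ℝ), IsOrthonormalPair x m ∧ rot x m θ x = v ∧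
      ∃ α β : ℝ, m = α • v + β • x := by
  have hxx : (inner ℝ x x : ℝ) = 1 := by rw [real_inner_self_eq_norm_sq, hx]; norm_num
  have hvv : (inner ℝ v v : ℝ) = 1 := by rw [real_inner_self_eq_norm_sq, hv]; norm_num
  obtain ⟨p, hp⟩ : ∃ p : ℝ, p = inner ℝ x v := ⟨_, rfl⟩
  obtain ⟨w, hw⟩ : ∃ w, w = v - p • x := ⟨_, rfl⟩
  have hw0 : ‖w‖ ≠ 0 := norm_ne_zero_iff.2 fun h => hxv p (sub_eq_zero.1 (hw ▸ h))
  have hxw : (inner ℝ x w : ℝ) = 0 := by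
    rw [hw, inner_sub_right, real_inner_smul_right, hxx, ← hp]; ring
  have hww : ‖w‖ ^ 2 = 1 - p ^ 2 := by
    rw [← real_inner_self_eq_norm_sq, hw]
    simp only [inner_sub_left, inner_sub_right, real_inner_smul_left, real_inner_smul_right, hxx,
      hvv, real_inner_comm x v, ← hp]
    ring
  have hm : IsOrthonormalPair x (‖w‖⁻¹ • w) := by
    refine ⟨hx, ?_, ?_⟩
    · rw [norm_smul, norm_inv, norm_norm, inv_mul_cancel₀ hw0]
    · rw [real_inner_smul_right, hxw, mul_zero]
  obtain ⟨θ, h1, h2⟩ := exists_cos_sin (p := p) (q := ‖w‖) (by linarith)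
  refine ⟨‖w‖⁻¹ • w, θ, hm, ?_, ‖w‖⁻¹, -(‖w‖⁻¹ * p), ?_⟩
  · rw [hm.rot_left, h1, h2, smul_smul, mul_inv_cancel₀ hw0, one_smul, hw]
    abel
  · rw [hw]; module

/-! ### Rotating a disc in its plane -/

/-- The images of the standard basis vectors. -/
def frame (E : E2 →ₗᵢ[ℝ] E3) (a : Fin 2) : E3 := E (EuclideanSpace.single a 1)

theorem apply_eq_frame (E : E2 →ₗᵢ[ℝ] E3) (u : E2) : E u = u 0 • frame E 0 + u 1 • frame E 1 := by
  have : u = u 0 • EuclideanSpace.single 0 (1 : ℝ) + u 1 • EuclideanSpace.single 1 (1 : ℝ) := by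
    ext a
    fin_cases a <;> simp
  conv_lhs => rw [this, map_add, map_smul, map_smul]
  rfl

theorem isOrthonormalPair_frame (E : E2 →ₗᵢ[ℝ] E3) : IsOrthonormalPair (frame E 0) (frame E 1) := by
  refine ⟨?_, ?_, ?_⟩
  · rw [frame, E.norm_map]; simp
  · rw [frame, E.norm_map]; simp
  · rw [frame, frame, E.inner_map_map, EuclideanSpace.inner_single_left]; simp

theorem eq_frame {E : E2 →ₗᵢ[ℝ] E3} {b : E3} (hE : IsUnitNormal E b) {y : E3}
    (hy : (inner ℝ b y : ℝ) = 0) :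
    y = (inner ℝ (frame E 0) y : ℝ) • frame E 0 + (inner ℝ (frame E 1) y : ℝ) • frame E 1 := by
  obtain ⟨u, rfl⟩ := hE.mem_range_iff.2 hy
  have h := isOrthonormalPair_frame E
  change E u = (inner ℝ (frame E 0) (E u) : ℝ) • frame E 0 +
    (inner ℝ (frame E 1) (E u) : ℝ) • frame E 1
  rw [apply_eq_frame E u]
  simp only [inner_add_right, real_inner_smul_right, h.inner_left, h.inner_right, h.inner_eq,
    h.inner_eq']
  simp

/-- Two parametrizations of a plane that agree up to a rotation. -/
theorem exists_rotate_eq {E B : E2 →ₗᵢ[ℝ] E3} {b : E3} (hE : IsUnitNormal E b)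
    (hB : IsUnitNormal B b)
    (h₁ : (inner ℝ (frame E 0) (frame B 1) : ℝ) = -inner ℝ (frame E 1) (frame B 0))
    (h₂ : (inner ℝ (frame E 1) (frame B 1) : ℝ) = inner ℝ (frame E 0) (frame B 0)) :
    ∃ φ, (isOrthonormalPair_frame E).rotate φ E = B := by
  have e := isOrthonormalPair_frame E
  have hB0 := eq_frame hE (hB.inner_eq (EuclideanSpace.single 0 1))
  have hB1 := eq_frame hE (hB.inner_eq (EuclideanSpace.single 1 1))
  change frame B 0 = (inner ℝ (frame E 0) (frame B 0) : ℝ) • frame E 0 +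
    (inner ℝ (frame E 1) (frame B 0) : ℝ) • frame E 1 at hB0
  change frame B 1 = (inner ℝ (frame E 0) (frame B 1) : ℝ) • frame E 0 +
    (inner ℝ (frame E 1) (frame B 1) : ℝ) • frame E 1 at hB1
  rw [h₁, h₂] at hB1
  obtain ⟨p, hp⟩ : ∃ p : ℝ, p = inner ℝ (frame E 0) (frame B 0) := ⟨_, rfl⟩
  obtain ⟨q, hq⟩ : ∃ q : ℝ, q = inner ℝ (frame E 1) (frame B 0) := ⟨_, rfl⟩
  rw [← hp, ← hq] at hB0 hB1
  have hpq : p ^ 2 + q ^ 2 = 1 := by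
    have h := (isOrthonormalPair_frame B).inner_left
    rw [hB0] at h
    simp only [inner_add_left, inner_add_right, real_inner_smul_left, real_inner_smul_right,
      e.inner_left, e.inner_right, e.inner_eq, e.inner_eq'] at h
    linarith
  obtain ⟨φ, c1, c2⟩ := exists_cos_sin hpq
  refine ⟨φ, LinearIsometry.ext fun u => ?_⟩
  rw [IsOrthonormalPair.rotate_apply, apply_eq_frame E, apply_eq_frame B, rot_add_right, rot_smul,
    rot_smul, e.rot_left, e.rot_right, c1, c2, hB0, hB1]
  module

/-- Two parametrizations of a plane agree up to a rotation, after a half turn of one of them that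
maps the plane to itself with reversed orientation if necessary. -/
theorem exists_rotate_rotate_eq {E B : E2 →ₗᵢ[ℝ] E3} {b v m : E3} (hE : IsUnitNormal E b)
    (hB : IsUnitNormal B b) (hm : IsOrthonormalPair v m) {α β : ℝ} (hαβ : α ^ 2 + β ^ 2 = 1)
    (hb : b = α • v + β • m) :
    (∃ φ, (isOrthonormalPair_frame E).rotate φ E = B) ∨
    ∃ φ, (isOrthonormalPair_frame (hm.rotate Real.pi E)).rotate φ (hm.rotate Real.pi E) = B := by
  have e := isOrthonormalPair_frame E
  have f := isOrthonormalPair_frame B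
  have hB0 := eq_frame hE (hB.inner_eq (EuclideanSpace.single 0 1))
  have hB1 := eq_frame hE (hB.inner_eq (EuclideanSpace.single 1 1))
  change frame B 0 = (inner ℝ (frame E 0) (frame B 0) : ℝ) • frame E 0 +
    (inner ℝ (frame E 1) (frame B 0) : ℝ) • frame E 1 at hB0
  change frame B 1 = (inner ℝ (frame E 0) (frame B 1) : ℝ) • frame E 0 +
    (inner ℝ (frame E 1) (frame B 1) : ℝ) • frame E 1 at hB1
  obtain ⟨p, hp⟩ : ∃ p : ℝ, p = inner ℝ (frame E 0) (frame B 0) := ⟨_, rfl⟩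
  obtain ⟨q, hq⟩ : ∃ q : ℝ, q = inner ℝ (frame E 1) (frame B 0) := ⟨_, rfl⟩
  obtain ⟨p', hp'⟩ : ∃ p : ℝ, p = inner ℝ (frame E 0) (frame B 1) := ⟨_, rfl⟩
  obtain ⟨q', hq'⟩ : ∃ q : ℝ, q = inner ℝ (frame E 1) (frame B 1) := ⟨_, rfl⟩
  rw [← hp, ← hq] at hB0
  rw [← hp', ← hq'] at hB1
  have k1 := f.inner_left
  have k2 := f.inner_right
  have k3 := f.inner_eq
  rw [hB0] at k1
  rw [hB1] at k2
  rw [hB0, hB1] at k3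
  simp only [inner_add_left, inner_add_right, real_inner_smul_left, real_inner_smul_right,
    e.inner_left, e.inner_right, e.inner_eq, e.inner_eq'] at k1 k2 k3
  -- The change of orthonormal frames has determinant `1` or `-1`; the sign tells whether the
  -- orientations agree.
  have k4 : (p * q' - q * p') ^ 2 = 1 := by
    linear_combination (p' * p' + q' * q') * k1 + k2 - (p * p' + q * q') * k3
  rcases (sq_eq_sq_iff_eq_or_eq_neg.1 (k4.trans (one_pow 2).symm)) with k5 | k5
  · left
    refine exists_rotate_eq hE hB ?_ ?_
    · rw [← hp', ← hq]
      linear_combination (-q) * k5 - p' * k1 + p * k3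
    · rw [← hp, ← hq']
      linear_combination p * k5 - q' * k1 + q * k3
  · right
    -- The half turn in the plane of `v` and `m` acts on the plane orthogonal to `b` as the
    -- reflection that negates `g`, which corrects the orientation.
    obtain ⟨g, hg⟩ : ∃ g, g = α • m - β • v := ⟨_, rfl⟩
    have hbg : (inner ℝ b g : ℝ) = 0 := by
      rw [hb, hg]
      simp only [inner_add_left, inner_sub_right, real_inner_smul_left, real_inner_smul_right,
        hm.inner_left, hm.inner_right, hm.inner_eq, hm.inner_eq']
      ring
    have hgg : (inner ℝ g g : ℝ) = 1 := by
      rw [hg]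
      simp only [inner_sub_left, inner_sub_right, real_inner_smul_left, real_inner_smul_right,
        hm.inner_left, hm.inner_right, hm.inner_eq, hm.inner_eq']
      linarith
    have hpi : ∀ y, (inner ℝ b y : ℝ) = 0 → rot v m Real.pi y =
        y - (2 * (inner ℝ g y : ℝ)) • g := by
      intro y hy
      obtain ⟨s, hs⟩ : ∃ s : ℝ, s = inner ℝ v y := ⟨_, rfl⟩
      obtain ⟨t, ht⟩ : ∃ t : ℝ, t = inner ℝ m y := ⟨_, rfl⟩
      rw [hb, inner_add_left, real_inner_smul_left, real_inner_smul_left, ← hs, ← ht] at hy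
      rw [rot, hg, inner_sub_left, real_inner_smul_left, real_inner_smul_left, ← hs, ← ht,
        Real.cos_pi, Real.sin_pi]
      have e1 : s = -β * (α * t - β * s) := by linear_combination (-s) * hαβ + α * hy
      have e2 : t = α * (α * t - β * s) := by linear_combination (-t) * hαβ + β * hy
      have e3 : y + ((-1 - 1) * s - 0 * t) • v + (0 * s + (-1 - 1) * t) • m =
          y - (2 * s) • v - (2 * t) • m := by module
      rw [e3]
      have e4 : (2 * s) • v = (2 * (-β * (α * t - β * s))) • v := by rw [← e1]
      have e5 : (2 * t) • m = (2 * (α * (α * t - β * s))) • m := by rw [← e2]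
      rw [e4, e5]
      module
    have hE' : IsUnitNormal (hm.rotate Real.pi E) b := by
      refine ⟨hE.norm_eq, fun u => ?_⟩
      rw [hm.rotate_apply, hpi _ (hE.inner_eq u), inner_sub_right, real_inner_smul_right,
        hE.inner_eq, hbg]
      ring
    have hgE := eq_frame hE hbg
    obtain ⟨a, ha⟩ : ∃ a : ℝ, a = inner ℝ (frame E 0) g := ⟨_, rfl⟩
    obtain ⟨d, hd⟩ : ∃ d : ℝ, d = inner ℝ (frame E 1) g := ⟨_, rfl⟩
    rw [← ha, ← hd] at hgE
    have had : a ^ 2 + d ^ 2 = 1 := by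
      rw [hgE] at hgg
      simp only [inner_add_left, inner_add_right, real_inner_smul_left, real_inner_smul_right,
        e.inner_left, e.inner_right, e.inner_eq, e.inner_eq'] at hgg
      linarith
    have f0 : frame (hm.rotate Real.pi E) 0 = frame E 0 - (2 * a) • g := by
      rw [ha, real_inner_comm]
      exact hpi _ (hE.inner_eq _)
    have f1 : frame (hm.rotate Real.pi E) 1 = frame E 1 - (2 * d) • g := by
      rw [hd, real_inner_comm]
      exact hpi _ (hE.inner_eq _)
    have k6 : p' = q := by linear_combination (-q) * k5 - p' * k1 + p * k3
    have k7 : q' = -p := by linear_combination p * k5 - q' * k1 + q * k3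
    rw [k6, k7] at hB1
    refine exists_rotate_eq hE' hB ?_ ?_
    · rw [f0, f1, hB1, hB0, hgE]
      simp only [inner_add_left, inner_add_right, inner_sub_left, real_inner_smul_left,
        real_inner_smul_right, e.inner_left, e.inner_right, e.inner_eq, e.inner_eq']
      linear_combination (-2 * q) * had
    · rw [f0, f1, hB1, hB0, hgE]
      simp only [inner_add_left, inner_add_right, inner_sub_left, real_inner_smul_left,
        real_inner_smul_right, e.inner_left, e.inner_right, e.inner_eq, e.inner_eq']
      linear_combination (2 * p) * had

end

/-! ### Generic normals and moving a disc to a prescribed position. -/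

section
-- A real vector space is not a finite union of proper subspaces; here these are the spans of pairs
-- from `S` together with `0`.
theorem exists_generic {S : Set E3} (hS : S.Finite) :
    ∃ v : E3, ‖v‖ = 1 ∧ ∀ p ∈ S, ∀ q ∈ S, ∀ r s : ℝ, v ≠ r • p + s • q := by
  have := (hS.insert 0).to_subtype
  let P : ↥(insert 0 S) × ↥(insert 0 S) → Submodule ℝ E3 := fun x =>
    Submodule.span ℝ (range ![(x.1 : E3), (x.2 : E3)])
  have hP : ∀ x, P x ≠ ⊤ := fun x h => by
    have h1 := finrank_range_le_card (R := ℝ) ![(x.1 : E3), (x.2 : E3)]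
    rw [Set.finrank] at h1
    change Module.finrank ℝ (P x) ≤ _ at h1
    rw [h, finrank_top] at h1
    simp at h1
  have hne : (⋃ x, (P x : Set E3)) ≠ univ := fun h => by
    obtain ⟨x, hx⟩ := Subspace.exists_eq_top_of_iUnion_eq_univ h
    exact hP x hx
  obtain ⟨w, hw⟩ := (ne_univ_iff_exists_notMem _).1 hne
  have hw' : ∀ p ∈ insert 0 S, ∀ q ∈ insert 0 S, ∀ r s : ℝ, w ≠ r • p + s • q :=
    fun p hp q hq r s h => hw (mem_iUnion.2 ⟨(⟨p, hp⟩, ⟨q, hq⟩), by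
      rw [h]
      exact add_mem (Submodule.smul_mem _ _ (Submodule.subset_span ⟨0, rfl⟩))
        (Submodule.smul_mem _ _ (Submodule.subset_span ⟨1, rfl⟩))⟩)
  have hw0 : ‖w‖ ≠ 0 := norm_ne_zero_iff.2 fun h =>
    hw' 0 (mem_insert _ _) 0 (mem_insert _ _) 0 0 (by rw [h]; simp)
  refine ⟨‖w‖⁻¹ • w, by rw [norm_smul, norm_inv, norm_norm, inv_mul_cancel₀ hw0],
    fun p hp q hq r s h => hw' p (mem_insert_of_mem _ hp) q (mem_insert_of_mem _ hq)
      (‖w‖ * r) (‖w‖ * s) ?_⟩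
  have e : w = ‖w‖ • (‖w‖⁻¹ • w) := (smul_inv_smul₀ hw0 w).symm
  rw [h] at e
  refine e.trans ?_
  module

theorem IsUnitNormal.rotate {A : E2 →ₗᵢ[ℝ] E3} {n m₁ m₂ : E3} (hn : IsUnitNormal A n)
    (hm : IsOrthonormalPair m₁ m₂) (θ : ℝ) : IsUnitNormal (hm.rotate θ A) (rot m₁ m₂ θ n) :=
  ⟨by rw [hm.norm_rot, hn.norm_eq], fun u => by
    rw [hm.rotate_apply, hm.inner_rot_rot, hn.inner_eq]⟩

theorem IsUnitNormal.update {A : Fin 4 → E2 →ₗᵢ[ℝ] E3} {n : Fin 4 → E3}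
    (hn : ∀ a, IsUnitNormal (A a) (n a)) {k : Fin 4} {B : E2 →ₗᵢ[ℝ] E3} {b : E3}
    (hB : IsUnitNormal B b) (a : Fin 4) :
    IsUnitNormal (Function.update A k B a) (Function.update n k b a) := by
  by_cases ha : a = k
  · subst ha; rwa [Function.update_self, Function.update_self]
  · rw [Function.update_of_ne ha, Function.update_of_ne ha]; exact hn a

theorem Indep3.neg_left {x y z : E3} (h : Indep3 x y z) : Indep3 (-x) y z := fun r s t h0 => by
  obtain ⟨h1, h2, h3⟩ := h (-r) s t (by rw [← h0]; module)
  exact ⟨neg_eq_zero.1 h1, h2, h3⟩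

theorem InGeneralPosition.update_neg {n : Fin 4 → E3} {k : Fin 4} {b : E3}
    (h : InGeneralPosition (Function.update n k b)) :
    InGeneralPosition (Function.update n k (-b)) := by
  intro a a' d h1 h2 h3
  have := h a a' d h1 h2 h3
  by_cases ha : a = k
  · subst ha
    rw [Function.update_self, Function.update_of_ne h1.symm, Function.update_of_ne h2.symm] at *
    exact this.neg_left
  by_cases ha' : a' = k
  · subst ha'
    rw [Function.update_self, Function.update_of_ne h1, Function.update_of_ne h3.symm] at *
    exact this.swap.neg_left.swap
  by_cases hd : d = k
  · subst hd
    rw [Function.update_self, Function.update_of_ne h2, Function.update_of_ne h3] at *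
    exact this.rotate.rotate.neg_left.rotate
  · rw [Function.update_of_ne ha, Function.update_of_ne ha', Function.update_of_ne hd] at *
    exact this

variable {F : Type*} [TopologicalSpace F] [ChartedSpace E2 F] [IsManifold (𝓡 2) ∞ F]
  [CompactSpace F] [T2Space F] {c : Fin 4 → E2 → F} {A : Fin 4 → E2 →ₗᵢ[ℝ] E3} {k : Fin 4}
  {n : Fin 4 → E3}

theorem reachable_of_arc_of_spin (hn : ∀ a, IsUnitNormal (A a) (n a)) (hgp : InGeneralPosition n)
    {m : E3} (hm : IsOrthonormalPair (n k) m) (harc : ∀ a, a ≠ k → ∀ r s : ℝ, n a ≠ r • n k + s • m)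
    {θ φ : ℝ} (hgp' : InGeneralPosition (Function.update n k (rot (n k) m θ (n k))))
    {B : E2 →ₗᵢ[ℝ] E3}
    (hφ : (isOrthonormalPair_frame (hm.rotate θ (A k))).rotate φ (hm.rotate θ (A k)) = B) :
    Reachable c A (Function.update A k B) := by
  have h1 := reachable_of_arc (c := c) hn hgp hm harc hgp'
  have hE := (hn k).rotate hm θ
  have hn' := IsUnitNormal.update (k := k) hn hE
  have hpair : ∀ E : E2 →ₗᵢ[ℝ] E3, E = Function.update A k (hm.rotate θ (A k)) k →
      Reachable c (Function.update A k (hm.rotate θ (A k))) (Function.update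
        (Function.update A k (hm.rotate θ (A k))) k ((isOrthonormalPair_frame E).rotate φ E)) := by
    intro E hEk
    have hEn : ∀ a, (inner ℝ (frame E a)
        (Function.update n k (rot (n k) m θ (n k)) k) : ℝ) = 0 := fun a => by
      rw [real_inner_comm, hEk]
      exact (hn' k).inner_eq _
    have := reachable_of_spin (c := c) (k := k) hn' hgp' (isOrthonormalPair_frame E) (hEn 0) (hEn 1) φ
    rwa [← hEk] at this
  have h2 := hpair (hm.rotate θ (A k)) (by rw [Function.update_self])
  rw [Function.update_idem, hφ] at h2
  exact h1.trans h2

/-- `hgen` and general position at the end keep the other normals off the plane through `n k` and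
`b`, so the whole great circle through them is available, not only the arc. -/
theorem reachable_update_of_generic (hn : ∀ a, IsUnitNormal (A a) (n a)) (hgp : InGeneralPosition n)
    {B : E2 →ₗᵢ[ℝ] E3} {b : E3} (hB : IsUnitNormal B b)
    (hgp' : InGeneralPosition (Function.update n k b))
    (hgen : ∀ a, a ≠ k → ∀ r s : ℝ, n k ≠ r • n a + s • b) :
    Reachable c A (Function.update A k B) := by
  obtain ⟨a₀, ha₀⟩ : ∃ a, a ≠ k := by clear * -; revert k; decide
  obtain ⟨m, θ, hm, hr, α, β, hαβ⟩ := exists_arc (hn k).norm_eq hB.norm_eq fun t ht => by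
    have ht0 : t ≠ 0 := fun h => hB.ne_zero (by rw [ht, h, zero_smul])
    exact hgen a₀ ha₀ 0 t⁻¹ (by rw [ht, smul_smul, inv_mul_cancel₀ ht0]; simp)
  have harc : ∀ a, a ≠ k → ∀ r s : ℝ, n a ≠ r • n k + s • m := fun a ha r s h => by
    have h1 : n a = (r + s * β) • n k + (s * α) • b := by rw [h, hαβ]; module
    by_cases h0 : r + s * β = 0
    · rw [h0, zero_smul, zero_add] at h1
      have := hgp'.ne_smul ha (s * α)
      rw [Function.update_self, Function.update_of_ne ha] at this
      exact this h1
    · refine hgen a ha (r + s * β)⁻¹ (-((r + s * β)⁻¹ * (s * α))) ?_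
      rw [h1, smul_add, inv_smul_smul₀ h0]
      module
  have hE : IsUnitNormal (hm.rotate θ (A k)) b := hr ▸ (hn k).rotate hm θ
  have hb : b = Real.cos θ • n k + Real.sin θ • m := by rw [← hm.rot_left, hr]
  rcases exists_rotate_rotate_eq hE hB hm (Real.cos_sq_add_sin_sq θ) hb with ⟨φ, hφ⟩ | ⟨φ, hφ⟩
  · exact reachable_of_arc_of_spin hn hgp hm harc (by rw [hr]; exact hgp') hφ
  -- Going on by half a turn ends at the normal `-b`, hence in the same plane with reversed
  -- orientation.
  · have e1 : hm.rotate Real.pi (hm.rotate θ (A k)) = hm.rotate (Real.pi + θ) (A k) :=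
      LinearIsometry.ext fun u => by
        rw [hm.rotate_apply, hm.rotate_apply, hm.rotate_apply, hm.rot_rot]
    have e2 : rot (n k) m (Real.pi + θ) (n k) = -b := by
      rw [hm.rot_left, hb, add_comm Real.pi, Real.cos_add_pi, Real.sin_add_pi]
      module
    refine reachable_of_arc_of_spin (θ := Real.pi + θ) (φ := φ) hn hgp hm harc
      (by rw [e2]; exact hgp'.update_neg) ?_
    simp only [e1] at hφ
    exact hφ

/-- A single disc can be moved to any other position that is in general position to the others. -/
theorem reachable_update (hn : ∀ a, IsUnitNormal (A a) (n a)) (hgp : InGeneralPosition n)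
    {B : E2 →ₗᵢ[ℝ] E3} {b : E3} (hB : IsUnitNormal B b)
    (hgp' : InGeneralPosition (Function.update n k b)) :
    Reachable c A (Function.update A k B) := by
  -- The great circle through `n k` and `b` may contain another normal, so the move goes by way of a
  -- generic normal `v`.
  obtain ⟨v, hv1, hv⟩ := exists_generic ((finite_range n).insert b)
  have hvn : ∀ a a', ∀ r s : ℝ, v ≠ r • n a + s • n a' := fun a a' =>
    hv _ (mem_insert_of_mem _ ⟨a, rfl⟩) _ (mem_insert_of_mem _ ⟨a', rfl⟩)
  obtain ⟨m, θ, hm, hr, α, β, hαβ⟩ := exists_arc (hn k).norm_eq hv1 fun t ht =>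
    hvn k k t 0 (by rw [ht]; simp)
  have harc : ∀ a, a ≠ k → ∀ r s : ℝ, n a ≠ r • n k + s • m := fun a ha r s h => by
    have h1 : n a = (r + s * β) • n k + (s * α) • v := by rw [h, hαβ]; module
    by_cases h0 : s * α = 0
    · rw [h0, zero_smul, add_zero] at h1
      exact hgp.ne_smul ha _ h1
    · refine hvn a k (s * α)⁻¹ (-((s * α)⁻¹ * (r + s * β))) ?_
      rw [h1, smul_add, inv_smul_smul₀ h0]
      module
  have hgp₁ := hgp.update (k := k) hvn
  have h1 := reachable_of_arc (c := c) hn hgp hm harc (θ := θ) (by rw [hr]; exact hgp₁)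
  have hE : IsUnitNormal (hm.rotate θ (A k)) v := hr ▸ (hn k).rotate hm θ
  have h2 := reachable_update_of_generic (c := c) (k := k) (IsUnitNormal.update hn hE) hgp₁ hB
    (by rw [Function.update_idem]; exact hgp') fun a ha r s => by
      rw [Function.update_self, Function.update_of_ne ha]
      exact hv _ (mem_insert_of_mem _ ⟨a, rfl⟩) _ (mem_insert _ _) r s
  rw [Function.update_idem] at h2
  exact h1.trans h2

/-! ### Moving all discs -/

theorem Reachable.refl (c : Fin 4 → E2 → F) (A : Fin 4 → E2 →ₗᵢ[ℝ] E3) : Reachable c A A := by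
  rintro i R r hr hrR ⟨m, hi⟩ P
  refine ⟨i, ⟨⟨fun _ => i, hi.1.1.comp contMDiff_snd, fun _ => hi.1, fun _ _ => rfl, fun _ _ => rfl,
    fun _ _ _ => rfl⟩, ⟨m, hi⟩, fun f hf => ?_⟩, P.mono hrR.le⟩
  obtain ⟨v, hv⟩ := hf.exists_hasValue hi
  exact ⟨v, hv, hv⟩

/-- The discs are replaced one after the other; `hmix` provides general position at every
intermediate stage. -/
theorem reachable_of_mixed (hn : ∀ a, IsUnitNormal (A a) (n a)) {B : Fin 4 → E2 →ₗᵢ[ℝ] E3}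
    {b : Fin 4 → E3} (hb : ∀ a, IsUnitNormal (B a) (b a))
    (hmix : ∀ s : Fin 4 → Bool, InGeneralPosition fun a => if s a then b a else n a) :
    Reachable c A B := by
  have key : ∀ j : ℕ, j ≤ 4 → Reachable c A fun a => if a.val < j then B a else A a := by
    intro j
    induction j with
    | zero => intro _; simpa using Reachable.refl c A
    | succ j ih =>
      intro hj
      have hmix' : ∀ j : ℕ, InGeneralPosition fun a : Fin 4 => if a.val < j then b a else n a :=
        fun j => by simpa using hmix fun a => decide (a.val < j)
      have e1 : (fun a : Fin 4 => if a.val < j + 1 then B a else A a) =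
          Function.update (fun a : Fin 4 => if a.val < j then B a else A a) ⟨j, hj⟩ (B ⟨j, hj⟩) := by
        funext a
        by_cases ha : a = ⟨j, hj⟩
        · subst ha; simp
        · have : a.val ≠ j := fun h => ha (Fin.ext h)
          rw [Function.update_of_ne ha]
          congr 1
          exact propext (by omega)
      have e2 : (fun a : Fin 4 => if a.val < j + 1 then b a else n a) =
          Function.update (fun a : Fin 4 => if a.val < j then b a else n a) ⟨j, hj⟩ (b ⟨j, hj⟩) := by
        funext a
        by_cases ha : a = ⟨j, hj⟩
        · subst ha; simp
        · have : a.val ≠ j := fun h => ha (Fin.ext h)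
          rw [Function.update_of_ne ha]
          congr 1
          exact propext (by omega)
      rw [e1]
      refine (ih (by omega)).trans (reachable_update
        (n := fun a : Fin 4 => if a.val < j then b a else n a) (fun a => ?_) (hmix' j)
        (hb ⟨j, hj⟩) (e2 ▸ hmix' (j + 1)))
      split_ifs
      · exact hb a
      · exact hn a
  have h4 := key 4 le_rfl
  have : (fun a : Fin 4 => if a.val < 4 then B a else A a) = B := by
    funext a
    rw [if_pos a.isLt]
  rwa [this] at h4

/-- The vectors are chosen successively, each outside the spans of pairs from `S` and the earlier
ones. -/
theorem exists_generic_family {S : Set E3} (hS : S.Finite) : ∃ b : Fin 4 → E3,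
    (∀ k, ‖b k‖ = 1) ∧ ∀ k, ∀ p ∈ S ∪ b '' {j | j < k}, ∀ q ∈ S ∪ b '' {j | j < k},
      ∀ r s : ℝ, b k ≠ r • p + s • q := by
  obtain ⟨b₀, n₀, h₀⟩ := exists_generic hS
  obtain ⟨b₁, n₁, h₁⟩ := exists_generic (hS.insert b₀)
  obtain ⟨b₂, n₂, h₂⟩ := exists_generic ((hS.insert b₀).insert b₁)
  obtain ⟨b₃, n₃, h₃⟩ := exists_generic (((hS.insert b₀).insert b₁).insert b₂)
  refine ⟨![b₀, b₁, b₂, b₃], fun k => by fin_cases k <;> assumption, fun k p hp q hq => ?_⟩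
  fin_cases k
  · have hsub : ∀ p ∈ S ∪ ![b₀, b₁, b₂, b₃] '' {j | j < 0}, p ∈ (S : Set E3) := by
      rintro p (hp | ⟨j, hj, rfl⟩)
      · simp [hp]
      · fin_cases j <;> simp at hj ⊢
    exact h₀ p (hsub p hp) q (hsub q hq)
  · have hsub : ∀ p ∈ S ∪ ![b₀, b₁, b₂, b₃] '' {j | j < 1}, p ∈ (insert b₀ S : Set E3) := by
      rintro p (hp | ⟨j, hj, rfl⟩)
      · simp [hp]
      · fin_cases j <;> simp at hj ⊢
    exact h₁ p (hsub p hp) q (hsub q hq)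
  · have hsub : ∀ p ∈ S ∪ ![b₀, b₁, b₂, b₃] '' {j | j < 2}, p ∈ (insert b₁ (insert b₀ S) : Set E3) := by
      rintro p (hp | ⟨j, hj, rfl⟩)
      · simp [hp]
      · fin_cases j <;> simp at hj ⊢
    exact h₂ p (hsub p hp) q (hsub q hq)
  · have hsub : ∀ p ∈ S ∪ ![b₀, b₁, b₂, b₃] '' {j | j < 3}, p ∈ (insert b₂ (insert b₁ (insert b₀ S)) : Set E3) := by
      rintro p (hp | ⟨j, hj, rfl⟩)
      · simp [hp]
      · fin_cases j <;> simp at hj ⊢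
    exact h₃ p (hsub p hp) q (hsub q hq)

/-- Of three vectors in a mixed family, the generic one chosen last is not in the span of the other
two. This reduces independence to pairs, and to the original vectors when none is generic. -/
theorem inGeneralPosition_mixed {S : Set E3} {b : Fin 4 → E3} (hn : InGeneralPosition n)
    (hnS : ∀ a, n a ∈ S)
    (hb : ∀ k, ∀ p ∈ S ∪ b '' {j | j < k}, ∀ q ∈ S ∪ b '' {j | j < k},
      ∀ r s : ℝ, b k ≠ r • p + s • q) (s : Fin 4 → Bool) :
    InGeneralPosition fun a => if s a then b a else n a := by
  obtain ⟨w, hw⟩ : ∃ w : Fin 4 → E3, w = fun a => if s a then b a else n a := ⟨_, rfl⟩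
  -- The order of choice: original vectors come first, all with rank `0`; the shift by one gives
  -- generic vectors distinct positive ranks.
  obtain ⟨rank, hrank⟩ : ∃ rank : Fin 4 → ℕ, rank = fun a => if s a then a.val + 1 else 0 := ⟨_, rfl⟩
  rw [← hw]
  have hpos : ∀ {d}, 0 < rank d → w d = b d ∧ rank d = d.val + 1 := fun {d} hd => by
    rw [hrank] at hd ⊢
    by_cases h : s d
    · simp [hw, h]
    · simp [h] at hd
  have hzero : ∀ {d}, rank d = 0 → w d = n d := fun {d} hd => by
    rw [hrank] at hd
    by_cases h : s d
    · simp [h] at hd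
    · simp [hw, h]
  have hmem : ∀ {a d}, rank a < rank d → w a ∈ S ∪ b '' {j | j < d} := fun {a d} had => by
    obtain ⟨-, h2⟩ := hpos (lt_of_le_of_lt (Nat.zero_le _) had)
    rcases Nat.eq_zero_or_pos (rank a) with h | h
    · rw [hzero h]; exact Or.inl (hnS a)
    · obtain ⟨h3, h4⟩ := hpos h
      rw [h3]
      refine Or.inr ⟨a, ?_, rfl⟩
      rw [h2, h4] at had
      exact Fin.lt_def.2 (by omega)
  have hcomb : ∀ {a a' d}, rank a < rank d → rank a' < rank d → ∀ r t : ℝ,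
      w d ≠ r • w a + t • w a' := fun {a a' d} h1 h2 r t => by
    rw [(hpos (lt_of_le_of_lt (Nat.zero_le _) h1)).1]
    exact hb d _ (hmem h1) _ (hmem h2) r t
  have hn0 : ∀ a, n a ≠ 0 := fun a h => by
    obtain ⟨a', ha'⟩ : ∃ a', a ≠ a' := by clear * -; revert a; decide
    exact hn.ne_smul ha' 0 (by rw [h, zero_smul])
  have hw0 : ∀ a, w a ≠ 0 := fun a h => by
    rcases Nat.eq_zero_or_pos (rank a) with h0 | h0
    · exact hn0 a ((hzero h0).symm.trans h)
    · rw [(hpos h0).1] at h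
      exact hb a _ (Or.inl (hnS a)) _ (Or.inl (hnS a)) 0 0 (by rw [h]; simp)
  have hinj : ∀ {a a'}, a ≠ a' → rank a = rank a' → rank a = 0 := fun {a a'} haa' h => by
    by_contra h0
    have h1 := (hpos (Nat.pos_of_ne_zero h0)).2
    have h2 := (hpos (Nat.pos_of_ne_zero (h ▸ h0))).2
    exact haa' (Fin.ext (by omega))
  have hlt : ∀ {a a'}, rank a < rank a' → ∀ r t : ℝ, r • w a + t • w a' = 0 → r = 0 ∧ t = 0 := by
    intro a a' haa' r t h
    have ht : t = 0 := by
      by_contra ht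
      refine hcomb haa' haa' (-(t⁻¹ * r)) 0 ?_
      rw [← inv_smul_smul₀ ht (w a'), eq_neg_of_add_eq_zero_right h]
      module
    rw [ht, zero_smul, add_zero] at h
    exact ⟨(smul_eq_zero.1 h).resolve_right (hw0 a), ht⟩
  have hpair : ∀ {a a'}, a ≠ a' → ∀ r t : ℝ, r • w a + t • w a' = 0 → r = 0 ∧ t = 0 := by
    intro a a' haa' r t h
    rcases lt_trichotomy (rank a) (rank a') with h1 | h1 | h1
    · exact hlt h1 r t h
    · have h0 := hinj haa' h1
      rw [hzero h0, hzero (h1 ▸ h0)] at h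
      obtain ⟨d, had, hbd⟩ : ∃ d : Fin 4, a ≠ d ∧ a' ≠ d := by clear * -; revert a a'; decide
      obtain ⟨k1, k2, -⟩ := hn a a' d haa' had hbd r t 0 (by rw [h]; simp)
      exact ⟨k1, k2⟩
    · exact (hlt h1 t r (by rw [← h]; abel)).symm
  have key : ∀ {a a' d}, a ≠ a' → rank a < rank d → rank a' < rank d →
      Indep3 (w a) (w a') (w d) := by
    intro a a' d haa' h1 h2 r t u h
    have hu : u = 0 := by
      by_contra hu
      refine hcomb h1 h2 (-(u⁻¹ * r)) (-(u⁻¹ * t)) ?_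
      rw [← inv_smul_smul₀ hu (w d), eq_neg_of_add_eq_zero_right h]
      module
    rw [hu, zero_smul, add_zero] at h
    obtain ⟨k1, k2⟩ := hpair haa' r t h
    exact ⟨k1, k2, hu⟩
  intro a a' d h1 h2 h3
  by_cases c1 : rank a < rank d ∧ rank a' < rank d
  · exact key h1 c1.1 c1.2
  by_cases c2 : rank a < rank a' ∧ rank d < rank a'
  · exact (key h2 c2.1 c2.2).rotate.rotate.swap
  by_cases c3 : rank a' < rank a ∧ rank d < rank a
  · exact (key h3 c3.1 c3.2).rotate.rotate
  have e1 := hinj h1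
  have e2 := hinj h2
  have e3 := hinj h3
  have z1 : rank a = 0 := by omega
  have z2 : rank a' = 0 := by omega
  have z3 : rank d = 0 := by omega
  rw [hzero z1, hzero z2, hzero z3]
  exact hn a a' d h1 h2 h3

end

/-! ### Joining two configurations, and linear discs as isometric ones. -/

section
theorem IsUnitNormal.exists_isUnitNormal {A : E2 →ₗᵢ[ℝ] E3} {n v : E3} (hn : IsUnitNormal A n)
    (hv : ‖v‖ = 1) (hnv : ∀ t : ℝ, v ≠ t • n) : ∃ B : E2 →ₗᵢ[ℝ] E3, IsUnitNormal B v := by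
  obtain ⟨m, θ, hm, hr, -⟩ := exists_arc hn.norm_eq hv hnv
  exact ⟨hm.rotate θ A, hr ▸ hn.rotate hm θ⟩

/-- Any two positions of the discs in general position can be joined. -/
theorem reachable_of_inGeneralPosition {F : Type*} [TopologicalSpace F] [ChartedSpace E2 F]
    [IsManifold (𝓡 2) ∞ F] [CompactSpace F] [T2Space F] {c : Fin 4 → E2 → F}
    {A A' : Fin 4 → E2 →ₗᵢ[ℝ] E3} {n n' : Fin 4 → E3}
    (hn : ∀ a, IsUnitNormal (A a) (n a)) (hgp : InGeneralPosition n)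
    (hn' : ∀ a, IsUnitNormal (A' a) (n' a)) (hgp' : InGeneralPosition n') :
    Reachable c A A' := by
  -- Mixtures of `n` with `n'` need not be in general position, but mixtures of either one with `b`
  -- are.
  obtain ⟨b, hb1, hb⟩ := exists_generic_family ((finite_range n).union (finite_range n'))
  have hB : ∀ a, ∃ B : E2 →ₗᵢ[ℝ] E3, IsUnitNormal B (b a) := fun a =>
    (hn a).exists_isUnitNormal (hb1 a) fun t ht =>
      hb a (n a) (Or.inl (Or.inl ⟨a, rfl⟩)) (n a) (Or.inl (Or.inl ⟨a, rfl⟩)) t 0 (by rw [ht]; simp)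
  choose B hB using hB
  refine (reachable_of_mixed hn hB
    (inGeneralPosition_mixed hgp (fun a => Or.inl ⟨a, rfl⟩) hb)).trans
    (reachable_of_mixed hB hn' fun s => ?_)
  have := inGeneralPosition_mixed hgp' (fun a => Or.inr ⟨a, rfl⟩) hb fun a => !s a
  convert this using 2 with a
  cases s a <;> rfl

/-- Mapping the unit disc into the unit ball makes `A` a contraction; hitting the whole unit disc of
`L` makes its inverse one too. -/
theorem norm_apply_of_image_closedBall {A : E2 →ₗ[ℝ] E3} {L : Submodule ℝ E3}
    (hL : Module.finrank ℝ L = 2)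
    (hA : A '' Metric.closedBall 0 1 = (L : Set E3) ∩ Metric.closedBall 0 1) :
    (∀ u, ‖A u‖ = ‖u‖) ∧ LinearMap.range A = L := by
  have hball : ∀ u, ‖u‖ ≤ 1 → A u ∈ L ∧ ‖A u‖ ≤ 1 := fun u hu => by
    have : A u ∈ (L : Set E3) ∩ Metric.closedBall 0 1 :=
      hA ▸ mem_image_of_mem A (mem_closedBall_zero_iff.2 hu)
    exact ⟨this.1, mem_closedBall_zero_iff.1 this.2⟩
  have hunit : ∀ {E : Type} [NormedAddCommGroup E] [NormedSpace ℝ E] (u : E), u ≠ 0 →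
      ‖‖u‖⁻¹ • u‖ = 1 := fun u hu => by
    rw [norm_smul, norm_inv, norm_norm, inv_mul_cancel₀ (norm_ne_zero_iff.2 hu)]
  have hmem : ∀ u, A u ∈ L := fun u => by
    by_cases hu : u = 0
    · rw [hu, map_zero]; exact L.zero_mem
    · have := (hball _ (hunit u hu).le).1
      rwa [map_smul, L.smul_mem_iff (inv_ne_zero (norm_ne_zero_iff.2 hu))] at this
  have hle : ∀ u, ‖A u‖ ≤ ‖u‖ := fun u => by
    by_cases hu : u = 0
    · simp [hu]
    · have := (hball _ (hunit u hu).le).2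
      rwa [map_smul, norm_smul, norm_inv, norm_norm, inv_mul_le_one₀ (norm_pos_iff.2 hu)] at this
  have hlift : ∀ w ∈ L, ∃ u, A u = w ∧ ‖u‖ ≤ ‖w‖ := fun w hw => by
    by_cases hw0 : w = 0
    · exact ⟨0, by simp [hw0], by simp⟩
    · obtain ⟨u, hu, hu'⟩ : ‖w‖⁻¹ • w ∈ A '' Metric.closedBall 0 1 :=
        hA ▸ ⟨L.smul_mem _ hw, mem_closedBall_zero_iff.2 (hunit w hw0).le⟩
      refine ⟨‖w‖ • u, ?_, ?_⟩
      · rw [map_smul, hu', smul_inv_smul₀ (norm_ne_zero_iff.2 hw0)]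
      · rw [norm_smul, norm_norm]
        exact mul_le_of_le_one_right (norm_nonneg _) (mem_closedBall_zero_iff.1 hu)
  have hrange : LinearMap.range A = L :=
    le_antisymm (by rintro _ ⟨u, rfl⟩; exact hmem u) fun w hw => by
      obtain ⟨u, hu, -⟩ := hlift w hw
      exact ⟨u, hu⟩
  have hker : Function.Injective A := by
    rw [← LinearMap.ker_eq_bot, ← Submodule.finrank_eq_zero]
    have := A.finrank_range_add_finrank_ker
    rw [hrange, hL, finrank_euclideanSpace_fin] at this
    omega
  refine ⟨fun u => le_antisymm (hle u) ?_, hrange⟩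
  obtain ⟨u', h1, h2⟩ := hlift (A u) (hmem u)
  rwa [hker h1] at h2

theorem AreLinearDiscs.exists_linearIsometry {A : Fin 4 → E2 →ₗ[ℝ] E3} (hA : AreLinearDiscs A) :
    ∃ (B : Fin 4 → E2 →ₗᵢ[ℝ] E3) (n : Fin 4 → E3), (∀ k u, B k u = A k u) ∧
      (∀ k, IsUnitNormal (B k) (n k)) ∧ InGeneralPosition n := by
  obtain ⟨L, hL, hgp, hA⟩ := hA
  have h := fun k => norm_apply_of_image_closedBall (hL k) (hA k)
  choose n hn1 hn using fun k => exists_normal (hL k)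
  have hmem : ∀ k u, A k u ∈ L k := fun k u => (h k).2 ▸ LinearMap.mem_range_self _ _
  refine ⟨fun k => ⟨A k, (h k).1⟩, n, fun _ _ => rfl, fun k => ⟨hn1 k, fun u => hn k _ (hmem k u)⟩,
    fun a b d hab had hbd => indep3_of_orthogonal fun v ha hb hd => ?_⟩
  have hiff : ∀ k, (inner ℝ (n k) v : ℝ) = 0 → v ∈ L k := fun k =>
    (mem_plane_iff (hL k) (fun h0 => by simpa [h0] using hn1 k) (hn k)).2
  have : v ∈ L a ⊓ L b ⊓ L d := ⟨⟨hiff a ha, hiff b hb⟩, hiff d hd⟩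
  rwa [hgp.2 a b d hab had hbd, Submodule.mem_bot] at this

end

end QInvariant

end

open QInvariant in
theorem proposition2p2 {F : Type*} [TopologicalSpace F] [ChartedSpace E2 F]
    [IsManifold (𝓡 2) ∞ F] [CompactSpace F] [T2Space F]
    (c : Fin 4 → E2 → F)
    (hc_smooth : ∀ k, ContMDiffOn 𝓘(ℝ, E2) (𝓡 2) ∞ (c k) (Metric.closedBall 0 1))
    (hc_inj : ∀ k, InjOn (c k) (Metric.closedBall 0 1))
    (hc_disj : ∀ k l, k ≠ l →
      Disjoint (c k '' Metric.closedBall 0 1) (c l '' Metric.closedBall 0 1))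
    (i : F → E3) (hi : ∃ n, MemI n i)
    (A : Fin 4 → E2 →ₗ[ℝ] E3) (hA : AreLinearDiscs A)
    (hi_pre : i ⁻¹' Metric.closedBall 0 1 = discs c 1)
    (hi_lin : ∀ k, ∀ u ∈ Metric.closedBall (0 : E2) 1, i (c k u) = A k u)
    (A' : Fin 4 → E2 →ₗ[ℝ] E3) (hA' : AreLinearDiscs A') :
    ∃ j : F → E3, IsImmersion j ∧
      (∃ H : ℝ → F → E3, IsRegularHomotopy H ∧ H 0 = i ∧ H 1 = j ∧
        ∀ t ∈ Icc (0 : ℝ) 1, ∀ x, x ∉ discs c 1 → H t x = i x) ∧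
      j ⁻¹' Metric.closedBall 0 (1 / 2) = discs c (1 / 2) ∧
      (∀ k, ∀ u ∈ Metric.closedBall (0 : E2) (1 / 2), j (c k u) = A' k u) ∧
      (∃ n, MemI n j) ∧
      ∀ f : GenericImm F → ZMod 2, IsQInvariant f →
        ∃ v, HasValue f i v ∧ HasValue f j v := by
  obtain ⟨B, n, hB, hn, hgp⟩ := hA.exists_linearIsometry
  obtain ⟨B', n', hB', hn', hgp'⟩ := hA'.exists_linearIsometry
  have hP : FlatDiscs c B 1 i := ⟨fun k => (hc_smooth k).continuousOn, hc_disj, hi_pre,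
    fun k u hu => by rw [hB, hi_lin k u hu]⟩
  obtain ⟨j, hD, hj⟩ := reachable_of_inGeneralPosition (c := c) hn hgp hn' hgp' i 1 (1 / 2)
    (by norm_num) (by norm_num) hi hP
  obtain ⟨H, hH, himm, h0, h1, hfix⟩ := hD.homotopy
  obtain ⟨m, hm⟩ := hD.memI
  exact ⟨j, hm.1, ⟨H, ⟨hH.contMDiffOn, fun t _ => himm t⟩, h0 0 le_rfl, h1 1 le_rfl,
    fun t _ => hfix t⟩, hj.preimage, fun k u hu => by rw [hj.linear k u hu, hB'],
    ⟨m, hm⟩, hD.value⟩
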